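/- **Setting.** Let $n_a,n_b,n_y,n_u,p,q\ge 0$ be integers and $n_x=n_an_y+(n_b+1)n_u$. Let $u_k\in\mathbb R^{n_u}$, $e_k,y_k\in\mathbb R^{n_y}$ ($k\in\mathbb Z$) be random signals, $f:\mathbb R^{n_x}\to\mathbb R^{n_y}$ measurable, and $$y_k=f(x_k)+e_k\quad(k\ge 0),\qquad x_k=\mathrm{vec}(y_{k-1},\dots,y_{k-n_a},u_k,\dots,u_{k-n_b}).$$ Here $(e_k)$ is white noise: independent, identically distributed, with zero mean and finite variance. The input together with the initial outputs $(y_{-1},\dots,y_{-n_a})$ is independent of $(e_k)_{k\ge0}$. Almost every realization of $u$ is a quasi-stationary signal, that is, $\lim_{N\to\infty}\frac1N\sum_{k=0}^{N-1}u_ku_{k-\tau}^\top$ exists for every integer $\tau\ge0$. $\mathbb E_e$ denotes expectation over the noise $(e_k)_{k\ge0}$ with the realizations of the input and of the outputs before time $0$ held fixed. **Stable system.** For every $\rho>0$ there are $C(\rho)\in[0,\infty)$ and $\lambda\in[0,1)$ such that, for almost every realization of $u$, all integers $k\ge k_o\ge0$ and all $x,\tilde x\in\mathbb R^{n_x}$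 with $\|x-\tilde x\|_2<\rho$, one has $\mathbb E_e\|y_k-\tilde y_k\|_2^4<C(\rho)\lambda^{k-k_o}$, where $y_k$ and $\tilde y_k$ are the outputs of the system driven by the same $u$ and $e$ and started at time $k_o$ with regressor $x$ and $\tilde x$, respectively. **Model.** Let $\phi:\mathbb R^{n_x}\to\mathbb R^{n_y\times p}$ and let $f^{\mathrm{ANN}}_{\theta_a}:\mathbb R^{n_x}\to\mathbb R^{n_y}$, $\theta_a\in\mathbb R^q$, be any function approximator. For data $x_0,\dots,x_{N-1}$ the prediction with $\theta=(\theta_b,\theta_a)\in\mathbb R^{p}\times\mathbb R^{q}$ is $$\hat y_k=\phi(x_k)\theta_b+f^{\mathrm{ANN}}_{\theta_a}(x_k)-\phi(x_k)\theta_{\mathrm{aux}},\qquad \theta_{\mathrm{aux}}=(\Phi^\top\Phi)^{-1}\Phi^\top F_{\theta_a},$$ where $\Phi$ and $F_{\theta_a}$ stack the values of $\phi$ and $f^{\mathrm{ANN}}_{\theta_a}$ at the regressor points used for the projection: the whole training set $x_0,\dots,x_{N-1}$, or any other finite collection of points chosen by a fixed rule from $N$ and the data, for instance a fixed synthetic set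 (the inverse is read as $0$ if $\Phi^\top\Phi$ is singular). Let $\Theta\subset\mathbb R^p\times\mathbb R^q$ be compact and $\breve\Theta\supseteq\Theta$ open. Assume that the predictions are given by one-step-ahead predictors that do not depend on $N$: for all $\theta\in\breve\Theta$, all data and all $0\le k<N$, $$\hat y_k=\gamma_k\bigl(\theta,\{y_i\}_{i=-n_a}^{k-1},\{u_i\}_{i=-n_b}^{k}\bigr),$$ and that $\gamma_k$ is differentiable in $\theta$ on $\breve\Theta$. **Stable predictor.** There are $C\in[0,\infty)$ and $\lambda\in[0,1)$ such that for all $k\ge0$, $\theta\in\breve\Theta$ and all data sequences $(u,y)$, $(\tilde u,\tilde y)$, the difference of the values of $\gamma_k$ at the two sequences has norm at most $C\sum_{i=-n}^{k}\lambda^{k-i}\bigl(\|u_i-\tilde u_i\|_2+\|y_i-\tilde y_i\|_2\bigr)$ with $n=\max(n_a,n_b)$; the same bound holds for $\partial\gamma_k/\partial\theta$; and $\|\gamma_k(\theta,0,0)\|_2\le C$. **Theorem (Convergence).** Let $V_{\mathcal D_N}(\theta)=\frac1N\sum_{k=0}^{N-1}\|y_k-\hat y_k\|_2^2$. Under these assumptions,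 with probability $1$, $$\sup_{\theta\in\Theta}\bigl|V_{\mathcal D_N}(\theta)-\mathbb E_eV_{\mathcal D_N}(\theta)\bigr|\to0\qquad(N\to\infty).$$ Moreover, if with probability $1$ the limit $\bar V(\theta)=\lim_{N\to\infty}\mathbb E_e V_{\mathcal D_N}(\theta)=\lim_{N\to\infty}\frac1N\mathbb E_e\|Y-\hat Y\|_2^2$ exists for every $\theta\in\Theta$ ($Y,\hat Y$ being the stacked $y_k,\hat y_k$, $0\le k<N$), then, with probability $1$, $$\sup_{\theta\in\Theta}\bigl|V_{\mathcal D_N}(\theta)-\bar V(\theta)\bigr|\to0\qquad(N\to\infty).$$ -/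

import Mathlib

open MeasureTheory ProbabilityTheory Filter Topology
open scoped Matrix

noncomputable section

namespace OrthAug

/-- The regressor space `ℝ^{n_x}`, `n_x = n_a n_y + (n_b + 1) n_u`, with the Euclidean norm:
`n_a` lagged outputs and the `n_b + 1` inputs `u_k, …, u_{k - n_b}`. -/
abbrev Regressor (na nb ny nu : ℕ) : Type :=
  EuclideanSpace ℝ ((Fin na × Fin ny) ⊕ (Fin (nb + 1) × Fin nu))

/-- The parameter space; a point is `(θ_b, θ_a)`. -/
abbrev Param (p q : ℕ) : Type := EuclideanSpace ℝ (Fin p) × EuclideanSpace ℝ (Fin q)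

/-- `x_k = vec(y_{k-1}, …, y_{k-n_a}, u_k, …, u_{k-n_b})`. -/
def regressor (na nb : ℕ) {ny nu : ℕ} (y : ℤ → EuclideanSpace ℝ (Fin ny))
    (u : ℤ → EuclideanSpace ℝ (Fin nu)) (k : ℤ) : Regressor na nb ny nu :=
  WithLp.toLp 2 (Sum.elim (fun ia => y (k - 1 - (ia.1.val : ℤ)) ia.2)
    (fun jb => u (k - (jb.1.val : ℤ)) jb.2))

/-- The update `x_k ↦ x_{k+1}` of the regressor: the output `y_k` and the input `u_{k+1}` are
shifted in, the oldest entries drop out. -/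
def nextRegressor {na nb ny nu : ℕ} (x : Regressor na nb ny nu)
    (y : EuclideanSpace ℝ (Fin ny)) (u : EuclideanSpace ℝ (Fin nu)) : Regressor na nb ny nu :=
  WithLp.toLp 2 (Sum.elim
    (fun ia => if ia.1.val = 0 then y ia.2
      else x (Sum.inl (⟨ia.1.val - 1, lt_of_le_of_lt (Nat.sub_le _ _) ia.1.isLt⟩, ia.2)))
    (fun jb => if jb.1.val = 0 then u jb.2
      else x (Sum.inr (⟨jb.1.val - 1, lt_of_le_of_lt (Nat.sub_le _ _) jb.1.isLt⟩, jb.2))))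

/-- The regressor at time `k₀ + m` of the system `y_k = f(x_k) + e_k` started with
`x_{k₀} = x₀` and driven by the signals `u`, `e`. -/
def stateFrom {na nb ny nu : ℕ} (f : Regressor na nb ny nu → EuclideanSpace ℝ (Fin ny))
    (u : ℤ → EuclideanSpace ℝ (Fin nu)) (e : ℤ → EuclideanSpace ℝ (Fin ny))
    (k₀ : ℕ) (x₀ : Regressor na nb ny nu) : ℕ → Regressor na nb ny nu
  | 0 => x₀
  | m + 1 =>
      nextRegressor (stateFrom f u e k₀ x₀ m)
        (f (stateFrom f u e k₀ x₀ m) + e ((k₀ : ℤ) + (m : ℤ))) (u ((k₀ : ℤ) + (m : ℤ) + 1))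

/-- The output at time `k₀ + m` of the system started with `x_{k₀} = x₀`. -/
def outputFrom {na nb ny nu : ℕ} (f : Regressor na nb ny nu → EuclideanSpace ℝ (Fin ny))
    (u : ℤ → EuclideanSpace ℝ (Fin nu)) (e : ℤ → EuclideanSpace ℝ (Fin ny))
    (k₀ : ℕ) (x₀ : Regressor na nb ny nu) (m : ℕ) : EuclideanSpace ℝ (Fin ny) :=
  f (stateFrom f u e k₀ x₀ m) + e ((k₀ : ℤ) + (m : ℤ))

/-- The output sequence that agrees with `y₀` at negative times and satisfies
`y_k = f(x_k) + e_k` for all `k ≥ 0`. -/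
def simulate {na nb ny nu : ℕ} (f : Regressor na nb ny nu → EuclideanSpace ℝ (Fin ny))
    (u : ℤ → EuclideanSpace ℝ (Fin nu)) (e : ℤ → EuclideanSpace ℝ (Fin ny))
    (y₀ : ℤ → EuclideanSpace ℝ (Fin ny)) (k : ℤ) : EuclideanSpace ℝ (Fin ny) :=
  if k < 0 then y₀ k else outputFrom f u e 0 (regressor na nb y₀ u 0) k.toNat

/-- White noise with finite variance: independent, identically distributed, zero mean,
square integrable. -/
structure IsWhiteNoise {Ω : Type*} [MeasurableSpace Ω] {ny : ℕ}
    (e : ℤ → Ω → EuclideanSpace ℝ (Fin ny)) (P : Measure Ω) : Prop where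
  measurable : ∀ k, Measurable (e k)
  indep : iIndepFun e P
  identDistrib : ∀ k, IdentDistrib (e k) (e 0) P P
  memLp : MemLp (e 0) 2 P
  mean_zero : ∫ ω, e 0 ω ∂P = 0

/-- Quasi-stationarity of a signal: for every lag the time-averaged correlation
`(1/N) ∑_{k<N} u_k u_{k-τ}ᵀ` converges (entrywise). A signal need not be bounded. -/
def IsQuasiStationary {nu : ℕ} (u : ℤ → EuclideanSpace ℝ (Fin nu)) : Prop :=
  ∀ τ : ℕ, ∃ R : Matrix (Fin nu) (Fin nu) ℝ, ∀ a b,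
    Tendsto (fun N : ℕ => (N : ℝ)⁻¹ * ∑ k ∈ Finset.range N, u (k : ℤ) a * u ((k : ℤ) - (τ : ℤ)) b)
      atTop (𝓝 (R a b))

/-- Stability of the data-generating system in the fourth-moment sense. The expectation is over
the noise only (the integration variable `ω'`); the input realization `u(ω)` is kept fixed. -/
def StableSystem {Ω : Type*} [MeasurableSpace Ω] {na nb ny nu : ℕ}
    (f : Regressor na nb ny nu → EuclideanSpace ℝ (Fin ny))
    (u : ℤ → Ω → EuclideanSpace ℝ (Fin nu)) (e : ℤ → Ω → EuclideanSpace ℝ (Fin ny))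
    (P : Measure Ω) : Prop :=
  ∀ ρ : ℝ, 0 < ρ → ∃ C lam : ℝ, 0 ≤ C ∧ 0 ≤ lam ∧ lam < 1 ∧
    ∀ᵐ ω ∂P, ∀ (k₀ : ℕ) (x₀ x₁ : Regressor na nb ny nu), ‖x₀ - x₁‖ < ρ → ∀ m : ℕ,
      ∫⁻ ω', ‖outputFrom f (fun i => u i ω) (fun i => e i ω') k₀ x₀ m
          - outputFrom f (fun i => u i ω) (fun i => e i ω') k₀ x₁ m‖ₑ ^ 4 ∂P
        < ENNReal.ofReal (C * lam ^ m)

/-- The stacked regressor matrix `Φ` of a finite list of regressor points. -/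
def stackedPhi {X : Type*} {ny p : ℕ} (φ : X → Matrix (Fin ny) (Fin p) ℝ) (S : List X) :
    Matrix (Fin S.length × Fin ny) (Fin p) ℝ :=
  fun ia j => φ (S.get ia.1) ia.2 j

/-- The stacked values `F` of a function on a finite list of regressor points. -/
def stackedF {X : Type*} {ny : ℕ} (g : X → EuclideanSpace ℝ (Fin ny)) (S : List X) :
    Fin S.length × Fin ny → ℝ :=
  fun ia => g (S.get ia.1) ia.2

/-- `θ_aux = (Φᵀ Φ)⁻¹ Φᵀ F`, evaluated on the points `S`. -/
def thetaAux {X : Type*} {ny p : ℕ} (φ : X → Matrix (Fin ny) (Fin p) ℝ)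
    (g : X → EuclideanSpace ℝ (Fin ny)) (S : List X) : Fin p → ℝ :=
  ((stackedPhi φ S)ᵀ * stackedPhi φ S)⁻¹ *ᵥ ((stackedPhi φ S)ᵀ *ᵥ stackedF g S)

/-- A rule that selects, for every `N` and every data record `(y, u)`, the regressor points on
which `θ_aux` is evaluated. -/
abbrev PointRule (na nb ny nu : ℕ) : Type :=
  ℕ → (ℤ → EuclideanSpace ℝ (Fin ny)) → (ℤ → EuclideanSpace ℝ (Fin nu)) →
    List (Regressor na nb ny nu)

/-- The default rule: the whole training set `x_0, …, x_{N-1}`. -/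
def trainingPoints (na nb ny nu : ℕ) : PointRule na nb ny nu :=
  fun N y u => (List.range N).map (fun k => regressor na nb y u (k : ℤ))

/-- The `k`-th block of `Ŷ = Φ θ_b + F_{θ_a} - Φ θ_aux`, that is
`φ(x_k) θ_b + f_{θ_a}(x_k) - φ(x_k) θ_aux`, for the data record `(y, u)` of length `N`. -/
def orthPrediction {na nb ny nu p q : ℕ}
    (φ : Regressor na nb ny nu → Matrix (Fin ny) (Fin p) ℝ)
    (fANN : EuclideanSpace ℝ (Fin q) → Regressor na nb ny nu → EuclideanSpace ℝ (Fin ny))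
    (S : PointRule na nb ny nu) (N : ℕ) (θ : Param p q)
    (y : ℤ → EuclideanSpace ℝ (Fin ny)) (u : ℤ → EuclideanSpace ℝ (Fin nu)) (k : ℕ) :
    EuclideanSpace ℝ (Fin ny) :=
  WithLp.toLp 2 (φ (regressor na nb y u (k : ℤ)) *ᵥ θ.1.ofLp)
    + fANN θ.2 (regressor na nb y u (k : ℤ))
    - WithLp.toLp 2 (φ (regressor na nb y u (k : ℤ)) *ᵥ thetaAux φ (fANN θ.2) (S N y u))

/-- The empirical cost `V_{D_N}(θ) = (1/N) ‖Y - Ŷ‖²`. -/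
def cost {na nb ny nu p q : ℕ}
    (φ : Regressor na nb ny nu → Matrix (Fin ny) (Fin p) ℝ)
    (fANN : EuclideanSpace ℝ (Fin q) → Regressor na nb ny nu → EuclideanSpace ℝ (Fin ny))
    (S : PointRule na nb ny nu) (N : ℕ) (θ : Param p q)
    (y : ℤ → EuclideanSpace ℝ (Fin ny)) (u : ℤ → EuclideanSpace ℝ (Fin nu)) : ℝ :=
  (N : ℝ)⁻¹ * ∑ k ∈ Finset.range N, ‖y (k : ℤ) - orthPrediction φ fANN S N θ y u k‖ ^ 2

/-- The expected cost `(1/N) E‖Y - Ŷ‖²`. The expectation is over the noise `e_0, e_1, …`; the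
realizations of the input and of the outputs before time `0` are kept fixed. -/
def expectedCost {Ω : Type*} [MeasurableSpace Ω] {na nb ny nu p q : ℕ}
    (f : Regressor na nb ny nu → EuclideanSpace ℝ (Fin ny))
    (φ : Regressor na nb ny nu → Matrix (Fin ny) (Fin p) ℝ)
    (fANN : EuclideanSpace ℝ (Fin q) → Regressor na nb ny nu → EuclideanSpace ℝ (Fin ny))
    (S : PointRule na nb ny nu)
    (e : ℤ → Ω → EuclideanSpace ℝ (Fin ny)) (P : Measure Ω)
    (N : ℕ) (θ : Param p q)
    (y₀ : ℤ → EuclideanSpace ℝ (Fin ny)) (u : ℤ → EuclideanSpace ℝ (Fin nu)) : ℝ :=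
  ∫ ω', cost φ fANN S N θ (simulate f u (fun i => e i ω') y₀) u ∂P

/-- A family of one-step-ahead predictors
`γ_k(θ, y_{-n_a}, …, y_{k-1}, u_{-n_b}, …, u_k)`, `k ≥ 0`. -/
abbrev OneStepPredictor (na nb ny nu p q : ℕ) : Type :=
  (k : ℕ) → Param p q → (Set.Icc (-(na : ℤ)) ((k : ℤ) - 1) → EuclideanSpace ℝ (Fin ny)) →
    (Set.Icc (-(nb : ℤ)) (k : ℤ) → EuclideanSpace ℝ (Fin nu)) → EuclideanSpace ℝ (Fin ny)

/-- `γ_k` evaluated on the past of a data record `(y, u)`. -/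
def OneStepPredictor.eval {na nb ny nu p q : ℕ} (γ : OneStepPredictor na nb ny nu p q) (k : ℕ)
    (y : ℤ → EuclideanSpace ℝ (Fin ny)) (u : ℤ → EuclideanSpace ℝ (Fin nu)) (θ : Param p q) :
    EuclideanSpace ℝ (Fin ny) :=
  γ k θ (fun i => y i) (fun i => u i)

/-- `Γ_k = ∑_{i=-n}^{k} λ^{k-i} (‖u_i - ũ_i‖ + ‖y_i - ỹ_i‖)`, `n = max(n_a, n_b)`. -/
def discountedDist (na nb : ℕ) {ny nu : ℕ} (lam : ℝ) (k : ℕ)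
    (y y' : ℤ → EuclideanSpace ℝ (Fin ny)) (u u' : ℤ → EuclideanSpace ℝ (Fin nu)) : ℝ :=
  ∑ i ∈ Finset.Icc (-((max na nb : ℕ) : ℤ)) (k : ℤ),
    lam ^ ((k : ℤ) - i).toNat * (‖u i - u' i‖ + ‖y i - y' i‖)

/-- Stability of the predictor on the parameter set `Θ'`, with stable parameter derivatives. -/
def StablePredictor {na nb ny nu p q : ℕ} (γ : OneStepPredictor na nb ny nu p q)
    (Θ' : Set (Param p q)) : Prop :=
  ∃ C lam : ℝ, 0 ≤ C ∧ 0 ≤ lam ∧ lam < 1 ∧ ∀ k : ℕ, ∀ θ ∈ Θ',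
    (∀ (y y' : ℤ → EuclideanSpace ℝ (Fin ny)) (u u' : ℤ → EuclideanSpace ℝ (Fin nu)),
      ‖γ.eval k y u θ - γ.eval k y' u' θ‖ ≤ C * discountedDist na nb lam k y y' u u') ∧
    ‖γ.eval k 0 0 θ‖ ≤ C ∧
    (∀ (y y' : ℤ → EuclideanSpace ℝ (Fin ny)) (u u' : ℤ → EuclideanSpace ℝ (Fin nu)),
      ‖fderiv ℝ (γ.eval k y u) θ - fderiv ℝ (γ.eval k y' u') θ‖
        ≤ C * discountedDist na nb lam k y y' u u')

end OrthAug

end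

/-!
For fixed input and initial outputs, the prediction error at time `k` is a functional `Φ_k` of the
independent noise variables `e_0, …, e_k`, and replacing `e_j` by an independent copy changes `Φ_k`
by `O(λ^{k-j} (1 + ‖e_j‖))` in mean square. For the predictor this is its stability. For the system,
the fourth-moment contraction is assumed only for regressors at bounded distance; chaining along a
segment makes it global, at the price of a constant growing linearly in the distance, and by
Cauchy–Schwarz only second moments of the noise are needed.

The partial sums of `‖Φ_k‖² - E‖Φ_k‖²` are decomposed into martingale increments, one for each noise
variable. Conditioning on the past is integration over an independent copy of the future, so the
`j`-th increment is bounded by `(1 + ‖e_j‖)²` and a predictable weight. As the noise has no fourth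
moment, the increments are truncated where `‖e_j‖²` exceeds the horizon; orthogonality and
Borel–Cantelli give convergence along the times `⌊c ^ n⌋`. Between these times the partial sums are
interpolated by monotonicity, which works because `E‖Φ_k‖² ≤ β_k²` for a sequence whose squares
have convergent Cesàro means; the quasi-stationary input provides `β`. Since input and initial
outputs are independent of the noise, the strong law for almost every fixed realization of them
transfers to the observed signals.

Finally, the parameter derivatives bound the variation of the costs with the parameter by the mean
square of a stable functional that does not depend on the parameter. This makes the costs and
their expectations equicontinuous, and on a compact set pointwise convergence on a countable dense
subset becomes uniform.
-/

namespace OrthAug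

section Cesaro

/-- Convergence of the arithmetic means `N⁻¹ ∑_{k < N} a_k`. -/
def CesaroConvergent (a : ℕ → ℝ) : Prop :=
  ∃ l, Tendsto (fun N : ℕ => (N : ℝ)⁻¹ * ∑ k ∈ Finset.range N, a k) atTop (𝓝 l)

/-- The exponentially weighted sum `∑_{i ≤ k} λ^{k-i} a_i`: the response of a first-order filter
with pole `λ`. -/
noncomputable def geomFilter (lam : ℝ) (a : ℕ → ℝ) (k : ℕ) : ℝ :=
  ∑ i ∈ Finset.range (k + 1), lam ^ (k - i) * a i

variable {lam : ℝ} {a b : ℕ → ℝ}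

theorem exists_abs_le_mul_of_tendsto_inv_mul {A : ℕ → ℝ} {l : ℝ} (hA0 : A 0 = 0)
    (h : Tendsto (fun N : ℕ => (N : ℝ)⁻¹ * A N) atTop (𝓝 l)) :
    ∃ K, 0 ≤ K ∧ ∀ N : ℕ, |A N| ≤ K * N := by
  obtain ⟨K, hK⟩ := (Metric.isBounded_range_of_tendsto _ h).exists_norm_le
  have hbound : ∀ N : ℕ, |(N : ℝ)⁻¹ * A N| ≤ K := fun N => hK _ ⟨N, rfl⟩
  refine ⟨K, (abs_nonneg _).trans (hbound 0), fun N => ?_⟩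
  rcases N.eq_zero_or_pos with rfl | hN
  · simp [hA0]
  · have hN' : (0 : ℝ) < N := Nat.cast_pos.2 hN
    have h1 := hbound N
    rwa [abs_mul, abs_of_pos (inv_pos.2 hN'), inv_mul_le_iff₀ hN', mul_comm] at h1

theorem tendsto_inv_mul_comp_sub {A : ℕ → ℝ} {l : ℝ}
    (h : Tendsto (fun N : ℕ => (N : ℝ)⁻¹ * A N) atTop (𝓝 l)) (m : ℕ) :
    Tendsto (fun N : ℕ => (N : ℝ)⁻¹ * A (N - m)) atTop (𝓝 l) := by
  have hratio : Tendsto (fun N : ℕ => (N : ℝ) / (N + m)) atTop (𝓝 1) := by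
    exact_mod_cast tendsto_natCast_div_add_atTop (𝕜 := ℝ) (m : ℝ)
  refine (tendsto_add_atTop_iff_nat m).1 ?_
  have hmul := hratio.mul h
  rw [one_mul] at hmul
  refine hmul.congr' ?_
  filter_upwards [eventually_gt_atTop 0] with N hN
  have hN' : (N : ℝ) ≠ 0 := Nat.cast_ne_zero.2 hN.ne'
  rw [Nat.add_sub_cancel, Nat.cast_add]
  field_simp

namespace CesaroConvergent

theorem add (ha : CesaroConvergent a) (hb : CesaroConvergent b) :
    CesaroConvergent fun k => a k + b k := by
  obtain ⟨l, hl⟩ := ha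
  obtain ⟨m, hm⟩ := hb
  exact ⟨l + m, by simpa only [Finset.sum_add_distrib, mul_add] using hl.add hm⟩

theorem const_mul (c : ℝ) (ha : CesaroConvergent a) : CesaroConvergent fun k => c * a k := by
  obtain ⟨l, hl⟩ := ha
  refine ⟨c * l, (hl.const_mul c).congr fun N => ?_⟩
  rw [← Finset.mul_sum, mul_left_comm]

theorem exists_abs_sum_le (ha : CesaroConvergent a) :
    ∃ K, 0 ≤ K ∧ ∀ N : ℕ, |∑ k ∈ Finset.range N, a k| ≤ K * N :=
  ha.elim fun _ hl => exists_abs_le_mul_of_tendsto_inv_mul (Finset.sum_range_zero _) hl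

theorem tendsto_div_add_one (ha : CesaroConvergent a) :
    Tendsto (fun k : ℕ => a k / (k + 1)) atTop (𝓝 0) := by
  obtain ⟨l, hl⟩ := ha
  have hdiff := (hl.sub (tendsto_inv_mul_comp_sub hl 1)).comp (tendsto_add_atTop_nat 1)
  rw [sub_self] at hdiff
  refine hdiff.congr fun k => ?_
  rw [Function.comp_apply, Nat.add_sub_cancel, Finset.sum_range_succ, Nat.cast_add_one]
  ring

end CesaroConvergent

theorem cesaroConvergent_of_tendsto {l : ℝ} (h : Tendsto a atTop (𝓝 l)) : CesaroConvergent a :=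
  ⟨l, h.cesaro⟩

@[simp]
theorem geomFilter_zero (lam : ℝ) (a : ℕ → ℝ) : geomFilter lam a 0 = a 0 := by
  simp [geomFilter]

theorem geomFilter_succ (lam : ℝ) (a : ℕ → ℝ) (k : ℕ) :
    geomFilter lam a (k + 1) = lam * geomFilter lam a k + a (k + 1) := by
  rw [geomFilter, Finset.sum_range_succ, geomFilter, Finset.mul_sum]
  congr 1
  · refine Finset.sum_congr rfl fun i hi => ?_
    rw [Nat.succ_sub (Finset.mem_range_succ_iff.1 hi), pow_succ']
    ring
  · simp

theorem geomFilter_nonneg (h0 : 0 ≤ lam) (ha : ∀ i, 0 ≤ a i) (k : ℕ) :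
    0 ≤ geomFilter lam a k :=
  Finset.sum_nonneg fun i _ => mul_nonneg (pow_nonneg h0 _) (ha i)

theorem geomFilter_mono (h0 : 0 ≤ lam) (hab : ∀ i, a i ≤ b i) (k : ℕ) :
    geomFilter lam a k ≤ geomFilter lam b k :=
  Finset.sum_le_sum fun i _ => mul_le_mul_of_nonneg_left (hab i) (pow_nonneg h0 _)

theorem geomFilter_add (lam : ℝ) (a b : ℕ → ℝ) (k : ℕ) :
    geomFilter lam (fun i => a i + b i) k = geomFilter lam a k + geomFilter lam b k := by
  simp only [geomFilter, mul_add, Finset.sum_add_distrib]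

theorem geomFilter_const_mul (lam c : ℝ) (a : ℕ → ℝ) (k : ℕ) :
    geomFilter lam (fun i => c * a i) k = c * geomFilter lam a k := by
  simp only [geomFilter, Finset.mul_sum, mul_left_comm]

theorem sum_range_pow_le (h0 : 0 ≤ lam) (h1 : lam < 1) (n : ℕ) :
    ∑ i ∈ Finset.range n, lam ^ i ≤ (1 - lam)⁻¹ := by
  rw [← tsum_geometric_of_lt_one h0 h1]
  exact (summable_geometric_of_lt_one h0 h1).sum_le_tsum _ fun i _ => pow_nonneg h0 i

theorem sum_range_pow_sub_le (h0 : 0 ≤ lam) (h1 : lam < 1) (k : ℕ) :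
    ∑ i ∈ Finset.range (k + 1), lam ^ (k - i) ≤ (1 - lam)⁻¹ := by
  have hreflect := Finset.sum_range_reflect (fun i => lam ^ i) (k + 1)
  simp only [Nat.add_sub_cancel] at hreflect
  exact hreflect ▸ sum_range_pow_le h0 h1 (k + 1)

theorem geomFilter_one_le (h0 : 0 ≤ lam) (h1 : lam < 1) (k : ℕ) :
    geomFilter lam (fun _ => 1) k ≤ (1 - lam)⁻¹ := by
  simpa only [geomFilter, mul_one] using sum_range_pow_sub_le h0 h1 k

theorem geomFilter_pow_le {mu : ℝ} (h0 : 0 ≤ lam) (hlm : lam < mu) (k : ℕ) :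
    geomFilter lam (fun i => mu ^ i) k ≤ mu / (mu - lam) * mu ^ k := by
  have : 0 < mu := h0.trans_lt hlm
  have hsub : 0 < mu - lam := sub_pos.2 hlm
  induction k with
  | zero =>
    rw [geomFilter_zero, pow_zero, mul_one, le_div_iff₀ hsub]
    linarith
  | succ k ih =>
    calc geomFilter lam (fun i => mu ^ i) (k + 1)
        = lam * geomFilter lam (fun i => mu ^ i) k + mu ^ (k + 1) := geomFilter_succ ..
      _ ≤ lam * (mu / (mu - lam) * mu ^ k) + mu ^ (k + 1) := by gcongr
      _ = mu / (mu - lam) * mu ^ (k + 1) := by field_simp; ring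

theorem sq_sum_mul_le {ι : Type*} (s : Finset ι) {w : ι → ℝ} (a : ι → ℝ) (hw : ∀ i ∈ s, 0 ≤ w i) :
    (∑ i ∈ s, w i * a i) ^ 2 ≤ (∑ i ∈ s, w i) * ∑ i ∈ s, w i * a i ^ 2 :=
  Finset.sum_sq_le_sum_mul_sum_of_sq_le_mul s hw
    (fun i hi => mul_nonneg (hw i hi) (sq_nonneg _)) fun i _ => le_of_eq (by ring)

theorem sq_geomFilter_le (h0 : 0 ≤ lam) (h1 : lam < 1) (a : ℕ → ℝ) (k : ℕ) :
    geomFilter lam a k ^ 2 ≤ (1 - lam)⁻¹ * geomFilter lam (fun i => a i ^ 2) k :=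
  (sq_sum_mul_le _ a fun _ _ => pow_nonneg h0 _).trans
    (mul_le_mul_of_nonneg_right (sum_range_pow_sub_le h0 h1 k)
      (geomFilter_nonneg h0 (fun i => sq_nonneg (a i)) k))

theorem sum_geomFilter_succ (lam : ℝ) (a : ℕ → ℝ) (N : ℕ) :
    ∑ k ∈ Finset.range (N + 1), geomFilter lam a k
      = lam * ∑ k ∈ Finset.range N, geomFilter lam a k + ∑ i ∈ Finset.range (N + 1), a i := by
  simp only [Finset.sum_range_succ', geomFilter_succ, geomFilter_zero, Finset.sum_add_distrib,
    Finset.mul_sum, add_assoc]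

theorem sum_geomFilter_eq (lam : ℝ) (a : ℕ → ℝ) (N : ℕ) :
    ∑ k ∈ Finset.range N, geomFilter lam a k
      = ∑ m ∈ Finset.range N, lam ^ m * ∑ i ∈ Finset.range (N - m), a i := by
  induction N with
  | zero => simp
  | succ N ih =>
    rw [sum_geomFilter_succ, ih, Finset.sum_range_succ' (fun m => lam ^ m * _), Finset.mul_sum]
    simp only [pow_zero, one_mul, Nat.sub_zero, Nat.add_sub_add_right, pow_succ', mul_assoc]

theorem sum_geomFilter_le (h0 : 0 ≤ lam) (h1 : lam < 1) (ha : ∀ i, 0 ≤ a i) (N : ℕ) :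
    ∑ k ∈ Finset.range N, geomFilter lam a k ≤ (1 - lam)⁻¹ * ∑ i ∈ Finset.range N, a i := by
  calc ∑ k ∈ Finset.range N, geomFilter lam a k
      = ∑ m ∈ Finset.range N, lam ^ m * ∑ i ∈ Finset.range (N - m), a i := sum_geomFilter_eq ..
    _ ≤ ∑ m ∈ Finset.range N, lam ^ m * ∑ i ∈ Finset.range N, a i := by
        refine Finset.sum_le_sum fun m _ => mul_le_mul_of_nonneg_left ?_ (pow_nonneg h0 _)
        exact Finset.sum_le_sum_of_subset_of_nonneg
          (Finset.range_mono (Nat.sub_le _ _)) fun i _ _ => ha i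
    _ ≤ (1 - lam)⁻¹ * ∑ i ∈ Finset.range N, a i := by
        rw [← Finset.sum_mul]
        exact mul_le_mul_of_nonneg_right (sum_range_pow_le h0 h1 N)
          (Finset.sum_nonneg fun i _ => ha i)

theorem sum_sum_Ico_pow_mul_le (h0 : 0 ≤ lam) (h1 : lam < 1) (ha : ∀ i, 0 ≤ a i) (N : ℕ) :
    ∑ j ∈ Finset.range N, ∑ k ∈ Finset.Ico j N, lam ^ (k - j) * a k
      ≤ (1 - lam)⁻¹ * ∑ k ∈ Finset.range N, a k := by
  have hswap : ∑ j ∈ Finset.range N, ∑ k ∈ Finset.Ico j N, lam ^ (k - j) * a k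
      = ∑ k ∈ Finset.range N, ∑ j ∈ Finset.range (k + 1), lam ^ (k - j) * a k :=
    Finset.sum_comm' fun j k => by simp only [Finset.mem_range, Finset.mem_Ico]; omega
  rw [hswap, Finset.mul_sum]
  refine Finset.sum_le_sum fun k _ => ?_
  rw [← Finset.sum_mul]
  exact mul_le_mul_of_nonneg_right (sum_range_pow_sub_le h0 h1 k) (ha k)

theorem CesaroConvergent.geomFilter (h0 : 0 ≤ lam) (h1 : lam < 1) (ha : CesaroConvergent a) :
    CesaroConvergent (geomFilter lam a) := by
  obtain ⟨K, hK0, hK⟩ := ha.exists_abs_sum_le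
  obtain ⟨l, hl⟩ := ha
  have hseries : ∀ N : ℕ, (N : ℝ)⁻¹ * ∑ k ∈ Finset.range N, OrthAug.geomFilter lam a k
      = ∑' m, lam ^ m * ((N : ℝ)⁻¹ * ∑ k ∈ Finset.range (N - m), a k) := by
    intro N
    rw [sum_geomFilter_eq, tsum_eq_sum (s := Finset.range N), Finset.mul_sum]
    · exact Finset.sum_congr rfl fun m _ => by ring
    · intro m hm
      simp [Nat.sub_eq_zero_of_le (not_lt.1 (mt Finset.mem_range.2 hm))]
  refine ⟨∑' m, lam ^ m * l, ?_⟩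
  simp_rw [hseries]
  refine tendsto_tsum_of_dominated_convergence (bound := fun m => lam ^ m * K)
    ((summable_geometric_of_lt_one h0 h1).mul_right K)
    (fun m => (tendsto_inv_mul_comp_sub hl m).const_mul _) (Eventually.of_forall fun N m => ?_)
  rw [norm_mul, norm_mul, Real.norm_of_nonneg (pow_nonneg h0 m), norm_inv, Real.norm_natCast]
  refine mul_le_mul_of_nonneg_left (inv_mul_le_of_le_mul₀ N.cast_nonneg hK0 ?_) (pow_nonneg h0 m)
  calc ‖∑ k ∈ Finset.range (N - m), a k‖ ≤ K * (N - m : ℕ) := hK _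
    _ ≤ K * N := by gcongr; exact N.sub_le m
    _ = N * K := mul_comm ..

end Cesaro

section Orthogonality

variable {Ω : Type*} {mΩ : MeasurableSpace Ω} {P : Measure Ω}

theorem memLp_sum_sub_condExp {𝓕 : ℕ → MeasurableSpace Ω} {X : ℕ → Ω → ℝ}
    (hL : ∀ j, MemLp (X j) 2 P) (N : ℕ) :
    MemLp (fun ω => ∑ j ∈ Finset.range N, (X j - P[X j | 𝓕 j]) ω) 2 P :=
  memLp_finsetSum _ fun j _ => (hL j).sub ((hL j).condExp one_le_two)

variable [IsFiniteMeasure P]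

theorem integral_sq_sub_condExp_le {m : MeasurableSpace Ω} (hm : m ≤ mΩ) {X : Ω → ℝ}
    (hX : MemLp X 2 P) : ∫ ω, (X ω - (P[X | m]) ω) ^ 2 ∂P ≤ ∫ ω, X ω ^ 2 ∂P := by
  calc ∫ ω, (X ω - (P[X | m]) ω) ^ 2 ∂P = ∫ ω, (Var[X; P | m]) ω ∂P := (integral_condExp hm).symm
    _ ≤ ∫ ω, (P[X ^ 2 | m]) ω ∂P :=
        integral_mono_ae integrable_condExp integrable_condExp (condVar_ae_le_condExp_sq hm hX)
    _ = ∫ ω, X ω ^ 2 ∂P := integral_condExp hm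

theorem condExp_sub_condExp {m : MeasurableSpace Ω} (hm : m ≤ mΩ) {X : Ω → ℝ}
    (hX : Integrable X P) : P[X - P[X | m] | m] =ᵐ[P] 0 := by
  have hsub := condExp_sub hX (integrable_condExp (m := m) (μ := P) (f := X)) m
  rwa [condExp_of_stronglyMeasurable hm stronglyMeasurable_condExp integrable_condExp,
    sub_self] at hsub

theorem integral_mul_eq_zero_of_condExp_eq_zero {m : MeasurableSpace Ω} (hm : m ≤ mΩ)
    {S D : Ω → ℝ} (hS : StronglyMeasurable[m] S) (hSD : Integrable (S * D) P)
    (hD : Integrable D P) (hD0 : P[D | m] =ᵐ[P] 0) : ∫ ω, (S * D) ω ∂P = 0 := by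
  rw [← integral_condExp hm, integral_congr_ae (condExp_mul_of_stronglyMeasurable_left hS hSD hD)]
  refine integral_eq_zero_of_ae ?_
  filter_upwards [hD0] with ω hω
  rw [Pi.mul_apply, hω, Pi.zero_apply, mul_zero]

theorem integral_sq_sum_sub_condExp_le (𝓕 : Filtration ℕ mΩ) {X : ℕ → Ω → ℝ}
    (hX : ∀ j, StronglyMeasurable[𝓕 (j + 1)] (X j)) (hL : ∀ j, MemLp (X j) 2 P) (N : ℕ) :
    ∫ ω, (∑ j ∈ Finset.range N, (X j - P[X j | 𝓕 j]) ω) ^ 2 ∂P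
      ≤ ∑ j ∈ Finset.range N, ∫ ω, X j ω ^ 2 ∂P := by
  induction N with
  | zero => simp
  | succ n ih =>
    set S : Ω → ℝ := fun ω => ∑ j ∈ Finset.range n, (X j - P[X j | 𝓕 j]) ω with hS
    set D : Ω → ℝ := X n - P[X n | 𝓕 n] with hD
    have hSL : MemLp S 2 P := memLp_sum_sub_condExp hL n
    have hDL : MemLp D 2 P := (hL n).sub ((hL n).condExp one_le_two)
    have hSm : StronglyMeasurable[𝓕 n] S := by
      refine Finset.stronglyMeasurable_fun_sum _ fun j hj => ?_
      have hjn : j + 1 ≤ n := Finset.mem_range.1 hj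
      exact ((hX j).mono (𝓕.mono hjn)).sub
        (stronglyMeasurable_condExp.mono (𝓕.mono (Nat.le_of_succ_le hjn)))
    have hSD : Integrable (S * D) P := hSL.integrable_mul hDL
    have hcross : ∫ ω, (S * D) ω ∂P = 0 :=
      integral_mul_eq_zero_of_condExp_eq_zero (𝓕.le n) hSm hSD (hDL.integrable one_le_two)
        (condExp_sub_condExp (𝓕.le n) ((hL n).integrable one_le_two))
    calc ∫ ω, (∑ j ∈ Finset.range (n + 1), (X j - P[X j | 𝓕 j]) ω) ^ 2 ∂P
        = ∫ ω, (S ω ^ 2 + 2 * (S * D) ω + D ω ^ 2) ∂P := by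
          simp only [Finset.sum_range_succ, add_sq, hS, hD, Pi.mul_apply, mul_assoc]
      _ = ∫ ω, S ω ^ 2 ∂P + ∫ ω, D ω ^ 2 ∂P := by
          have hSSD : Integrable (fun ω => S ω ^ 2 + 2 * (S * D) ω) P :=
            hSL.integrable_sq.add (hSD.const_mul 2)
          rw [integral_add hSSD hDL.integrable_sq,
            integral_add hSL.integrable_sq (hSD.const_mul 2), integral_const_mul, hcross, mul_zero,
            add_zero]
      _ ≤ ∑ j ∈ Finset.range (n + 1), ∫ ω, X j ω ^ 2 ∂P := by
          rw [Finset.sum_range_succ]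
          exact add_le_add ih (integral_sq_sub_condExp_le (𝓕.le n) (hL n))

end Orthogonality

section Truncation

variable {Ω : Type*} {mΩ : MeasurableSpace Ω} {P : Measure Ω}

theorem ae_tendsto_zero_of_summable_integral {Y : ℕ → Ω → ℝ} (hY : ∀ n, Integrable (Y n) P)
    (hY0 : ∀ n ω, 0 ≤ Y n ω) (hs : Summable fun n => ∫ ω, Y n ω ∂P) :
    ∀ᵐ ω ∂P, Tendsto (fun n => Y n ω) atTop (𝓝 0) := by
  have hm : ∀ n, AEMeasurable (fun ω => ENNReal.ofReal (Y n ω)) P := fun n =>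
    (hY n).aestronglyMeasurable.aemeasurable.ennreal_ofReal
  have hfin : ∫⁻ ω, ∑' n, ENNReal.ofReal (Y n ω) ∂P ≠ ⊤ := by
    simp_rw [lintegral_tsum hm,
      ← ofReal_integral_eq_lintegral_ofReal (hY _) (Eventually.of_forall (hY0 _))]
    exact hs.tsum_ofReal_ne_top
  filter_upwards [ae_lt_top' (AEMeasurable.tsum hm) hfin] with ω hω
  have hlim := (ENNReal.tendsto_toReal ENNReal.zero_ne_top).comp
    (ENNReal.tendsto_atTop_zero_of_tsum_ne_top hω.ne)
  simpa only [Function.comp_def, ENNReal.toReal_ofReal (hY0 _ ω), ENNReal.toReal_zero] using hlim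

theorem sum_inv_pow_mul_indicator_sq_le {c : ℝ} (hc : 1 < c) {t : ℝ} (ht : 0 ≤ t) (L : ℕ) :
    ∑ n ∈ Finset.range L, (c ^ n)⁻¹ * (Set.Iic (c ^ n)).indicator (fun t => t ^ 2) t
      ≤ (1 - c⁻¹)⁻¹ * t := by
  have hc0 : 0 < c := one_pos.trans hc
  have hi0 : 0 ≤ c⁻¹ := inv_nonneg.2 hc0.le
  have hex : ∃ n : ℕ, t ≤ c ^ n := (pow_unbounded_of_one_lt t hc).imp fun _ h => h.le
  set n₀ := Nat.find hex
  calc ∑ n ∈ Finset.range L, (c ^ n)⁻¹ * (Set.Iic (c ^ n)).indicator (fun t => t ^ 2) t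
      = ∑ n ∈ Finset.Ico n₀ L, (c ^ n)⁻¹ * (Set.Iic (c ^ n)).indicator (fun t => t ^ 2) t := by
        refine (Finset.sum_subset (fun n hn => Finset.mem_range.2 (Finset.mem_Ico.1 hn).2)
          fun n hn hn' => ?_).symm
        have hlt : n < n₀ := by simp only [Finset.mem_range, Finset.mem_Ico] at hn hn'; omega
        rw [Set.indicator_of_notMem (Set.notMem_Iic.2 (not_le.1 (Nat.find_min hex hlt))), mul_zero]
    _ ≤ ∑ n ∈ Finset.Ico n₀ L, (c ^ n)⁻¹ * t ^ 2 := by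
        gcongr
        exact Set.indicator_le_self' (fun _ _ => sq_nonneg _) t
    _ = (c⁻¹ ^ n₀ * t ^ 2) * ∑ k ∈ Finset.range (L - n₀), c⁻¹ ^ k := by
        rw [Finset.sum_Ico_eq_sum_range, Finset.mul_sum]
        refine Finset.sum_congr rfl fun k _ => ?_
        rw [← inv_pow, pow_add]
        ring
    _ ≤ t * (1 - c⁻¹)⁻¹ := by
        refine mul_le_mul ?_ (sum_range_pow_le hi0 (inv_lt_one_of_one_lt₀ hc) _)
          (Finset.sum_nonneg fun k _ => pow_nonneg hi0 k) ht
        rw [inv_pow, inv_mul_le_iff₀ (pow_pos hc0 n₀), sq]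
        exact mul_le_mul_of_nonneg_right (Nat.find_spec hex) ht
    _ = (1 - c⁻¹)⁻¹ * t := mul_comm _ _

/-- `E[X² 1_{X ≤ T}]`, which controls the fluctuations of a sum of variables truncated at the
level `T`. -/
noncomputable def truncatedSecondMoment (X : Ω → ℝ) (P : Measure Ω) (T : ℝ) : ℝ :=
  ∫ ω, (Set.Iic T).indicator (fun t => t ^ 2) (X ω) ∂P

/-- `E[X 1_{X > T}]`, which controls the bias caused by truncating at the level `T`. -/
noncomputable def tailMean (X : Ω → ℝ) (P : Measure Ω) (T : ℝ) : ℝ :=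
  ∫ ω, (Set.Ioi T).indicator id (X ω) ∂P

theorem measurable_indicator_sq (T : ℝ) : Measurable ((Set.Iic T).indicator fun t : ℝ => t ^ 2) :=
  (measurable_id.pow_const 2).indicator measurableSet_Iic

theorem measurable_indicator_id (T : ℝ) : Measurable ((Set.Ioi T).indicator (id : ℝ → ℝ)) :=
  measurable_id.indicator measurableSet_Ioi

theorem truncatedSecondMoment_nonneg (X : Ω → ℝ) (T : ℝ) : 0 ≤ truncatedSecondMoment X P T :=
  integral_nonneg fun _ => Set.indicator_nonneg (fun _ _ => sq_nonneg _) _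

theorem tailMean_nonneg {X : Ω → ℝ} (hX0 : ∀ ω, 0 ≤ X ω) (T : ℝ) : 0 ≤ tailMean X P T :=
  integral_nonneg fun ω => Set.indicator_apply_nonneg fun _ => hX0 ω

theorem integrable_indicator_sq [IsFiniteMeasure P] {X : Ω → ℝ} (hX : AEMeasurable X P)
    (hX0 : ∀ ω, 0 ≤ X ω) (T : ℝ) :
    Integrable (fun ω => (Set.Iic T).indicator (fun t => t ^ 2) (X ω)) P := by
  refine Integrable.of_bound (C := T ^ 2)
    ((measurable_indicator_sq T).comp_aemeasurable hX).aestronglyMeasurable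
    (Eventually.of_forall fun ω => ?_)
  rw [Real.norm_of_nonneg (Set.indicator_nonneg (fun _ _ => sq_nonneg _) _)]
  exact Set.indicator_apply_le' (fun h => pow_le_pow_left₀ (hX0 ω) h 2) fun _ => sq_nonneg T

theorem integrable_indicator_id {X : Ω → ℝ} (hX : Integrable X P) (T : ℝ) :
    Integrable (fun ω => (Set.Ioi T).indicator id (X ω)) P :=
  hX.mono ((measurable_indicator_id T).comp_aemeasurable hX.aemeasurable).aestronglyMeasurable
    (Eventually.of_forall fun _ => norm_indicator_le_norm_self id _)

theorem tendsto_tailMean {X : Ω → ℝ} (hX : Integrable X P) :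
    Tendsto (tailMean X P) atTop (𝓝 0) := by
  rw [← integral_zero Ω ℝ (μ := P)]
  refine tendsto_integral_filter_of_dominated_convergence (fun ω => ‖X ω‖)
    (Eventually.of_forall fun T => (integrable_indicator_id hX T).aestronglyMeasurable)
    (Eventually.of_forall fun T => Eventually.of_forall fun ω => norm_indicator_le_norm_self id _)
    hX.norm (Eventually.of_forall fun ω => tendsto_const_nhds.congr' ?_)
  filter_upwards [eventually_ge_atTop (X ω)] with T hT
  exact (Set.indicator_of_notMem (not_lt.2 hT) id).symm

theorem summable_inv_pow_mul_truncatedSecondMoment [IsFiniteMeasure P] {X : Ω → ℝ}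
    (hX : Integrable X P) (hX0 : ∀ ω, 0 ≤ X ω) {c : ℝ} (hc : 1 < c) :
    Summable fun n : ℕ => (c ^ n)⁻¹ * truncatedSecondMoment X P (c ^ n) := by
  have hint := integrable_indicator_sq hX.aemeasurable hX0
  refine summable_of_sum_range_le (c := ∫ ω, (1 - c⁻¹)⁻¹ * X ω ∂P)
    (fun n => mul_nonneg (by positivity) (truncatedSecondMoment_nonneg X _)) fun L => ?_
  simp_rw [truncatedSecondMoment, ← integral_const_mul]
  rw [← integral_finsetSum _ fun n _ => (hint _).const_mul _]
  exact integral_mono (integrable_finsetSum _ fun n _ => (hint _).const_mul _) (hX.const_mul _)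
    fun ω => sum_inv_pow_mul_indicator_sq_le hc (hX0 ω) L

end Truncation

section Amplitude

variable {Ω : Type*} {mΩ : MeasurableSpace Ω}

/-- Scalar noise amplitudes: adapted with a delay of one step, independent of the past, identically
distributed and square integrable. The bound `1 ≤ ξ_j` lets `ξ_j²` absorb terms linear in `ξ_j`. -/
structure IsAmplitude (ξ : ℕ → Ω → ℝ) (𝓕 : Filtration ℕ mΩ) (P : Measure Ω) : Prop where
  stronglyMeasurable : ∀ j, StronglyMeasurable[𝓕 (j + 1)] (ξ j)
  indep : ∀ j, Indep (MeasurableSpace.comap (ξ j) inferInstance) (𝓕 j) P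
  identDistrib : ∀ j, IdentDistrib (ξ j) (ξ 0) P P
  one_le : ∀ j ω, 1 ≤ ξ j ω
  memLp_zero : MemLp (ξ 0) 2 P

/-- An increment `Δ` at step `j` with vanishing conditional mean, dominated by the amplitude `ξ_j`
and by a bound `H` that is known before step `j`. -/
structure IsDominatedIncrement (ξ : ℕ → Ω → ℝ) (𝓕 : Filtration ℕ mΩ) (P : Measure Ω) (C : ℝ)
    (j : ℕ) (Δ H : Ω → ℝ) : Prop where
  stronglyMeasurable : StronglyMeasurable[𝓕 (j + 1)] Δ
  integrable : Integrable Δ P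
  condExp_eq_zero : P[Δ | 𝓕 j] =ᵐ[P] 0
  bound_stronglyMeasurable : StronglyMeasurable[𝓕 j] H
  bound_nonneg : ∀ ω, 0 ≤ H ω
  bound_memLp : MemLp H 2 P
  abs_le : ∀ᵐ ω ∂P, |Δ ω| ≤ C * (ξ j ω * (ξ j ω + H ω))

variable {P : Measure Ω} {ξ : ℕ → Ω → ℝ} {𝓕 : Filtration ℕ mΩ}

namespace IsAmplitude

theorem memLp (h : IsAmplitude ξ 𝓕 P) (j : ℕ) : MemLp (ξ j) 2 P :=
  (h.identDistrib j).memLp_iff.2 h.memLp_zero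

theorem measurable (h : IsAmplitude ξ 𝓕 P) (j : ℕ) : Measurable (ξ j) :=
  ((h.stronglyMeasurable j).mono (𝓕.le _)).measurable

theorem integral_comp (h : IsAmplitude ξ 𝓕 P) (j : ℕ) {g : ℝ → ℝ} (hg : Measurable g) :
    ∫ ω, g (ξ j ω) ∂P = ∫ ω, g (ξ 0 ω) ∂P :=
  ((h.identDistrib j).comp hg).integral_eq

theorem indepFun (h : IsAmplitude ξ 𝓕 P) {j : ℕ} {H : Ω → ℝ} (hH : StronglyMeasurable[𝓕 j] H) :
    IndepFun (ξ j) H P :=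
  (IndepFun_iff_Indep ..).2 (indep_of_indep_of_le_right (h.indep j) hH.measurable.comap_le)

theorem condExp_comp [IsProbabilityMeasure P] (h : IsAmplitude ξ 𝓕 P) (j : ℕ) {g : ℝ → ℝ}
    (hg : Measurable g) : P[fun ω => g (ξ j ω) | 𝓕 j] =ᵐ[P] fun _ => ∫ ω, g (ξ 0 ω) ∂P := by
  have hgξ : StronglyMeasurable[MeasurableSpace.comap (ξ j) inferInstance] fun ω => g (ξ j ω) :=
    (hg.comp (comap_measurable (ξ j))).stronglyMeasurable
  rw [← h.integral_comp j hg]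
  exact condExp_indep_eq (h.measurable j).comap_le (𝓕.le j) hgξ (h.indep j)

theorem ae_cesaroConvergent_sq (h : IsAmplitude ξ 𝓕 P) :
    ∀ᵐ ω ∂P, CesaroConvergent fun k => ξ k ω ^ 2 := by
  have hsq : Measurable fun x : ℝ => x ^ 2 := measurable_id.pow_const 2
  have hlt : ∀ i j, i < j → IndepFun (fun ω => ξ j ω ^ 2) (fun ω => ξ i ω ^ 2) P :=
    fun i j hij => (h.indepFun ((h.stronglyMeasurable i).mono (𝓕.mono hij))).comp hsq hsq
  have hpair : Pairwise (Function.onFun (fun X Y => IndepFun X Y P) fun j ω => ξ j ω ^ 2) :=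
    fun i j hij => hij.lt_or_gt.elim (fun hlt' => (hlt i j hlt').symm) (hlt j i)
  filter_upwards [strong_law_ae_real (fun j ω => ξ j ω ^ 2) h.memLp_zero.integrable_sq hpair
    fun j => (h.identDistrib j).comp hsq] with ω hω
  exact ⟨_, hω.congr fun n => div_eq_inv_mul ..⟩

theorem ae_exists_sum_le (h : IsAmplitude ξ 𝓕 P) :
    ∀ᵐ ω ∂P, ∃ K, 0 ≤ K ∧ ∀ N : ℕ, ∑ i ∈ Finset.range N, ξ i ω ≤ K * N := by
  filter_upwards [h.ae_cesaroConvergent_sq] with ω hω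
  obtain ⟨K, hK0, hK⟩ := hω.exists_abs_sum_le
  refine ⟨K, hK0, fun N => (Finset.sum_le_sum fun i _ => ?_).trans ((le_abs_self _).trans (hK N))⟩
  exact le_self_pow₀ (h.one_le i ω) two_ne_zero

theorem ae_eventually_forall_sq_le (h : IsAmplitude ξ 𝓕 P) {c : ℝ} (hc : 1 < c) :
    ∀ᵐ ω ∂P, ∀ᶠ n : ℕ in atTop, ∀ j < ⌊c ^ n⌋₊, ξ j ω ^ 2 ≤ c ^ n := by
  filter_upwards [h.ae_cesaroConvergent_sq] with ω hω
  obtain ⟨J, hJ⟩ := eventually_atTop.1 (hω.tendsto_div_add_one.eventually_lt_const one_pos)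
  filter_upwards [(tendsto_pow_atTop_atTop_of_one_lt hc).eventually_ge_atTop
    (∑ i ∈ Finset.range J, ξ i ω ^ 2)] with n hn j hj
  rcases lt_or_ge j J with hjJ | hJj
  · exact (Finset.single_le_sum (f := fun i => ξ i ω ^ 2) (fun i _ => sq_nonneg _)
      (Finset.mem_range.2 hjJ)).trans hn
  · calc ξ j ω ^ 2 ≤ (j + 1 : ℕ) := by
          rw [Nat.cast_add_one]
          exact ((div_lt_one (by positivity)).1 (hJ j hJj)).le
      _ ≤ (⌊c ^ n⌋₊ : ℝ) := Nat.cast_le.2 hj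
      _ ≤ c ^ n := Nat.floor_le (pow_nonneg (zero_le_one.trans hc.le) n)

end IsAmplitude

section Increments

variable {C : ℝ} {j : ℕ} {Δ H : Ω → ℝ} (T : ℝ)

namespace IsDominatedIncrement

theorem stronglyMeasurable_truncated (h : IsAmplitude ξ 𝓕 P)
    (hΔ : IsDominatedIncrement ξ 𝓕 P C j Δ H) :
    StronglyMeasurable[𝓕 (j + 1)] ({ω | ξ j ω ^ 2 ≤ T}.indicator Δ) :=
  hΔ.stronglyMeasurable.indicator (measurableSet_le
    ((h.stronglyMeasurable j).measurable.pow_const 2) measurable_const)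

theorem ae_sq_truncated_le (hΔ : IsDominatedIncrement ξ 𝓕 P C j Δ H) :
    ∀ᵐ ω ∂P, ({ω | ξ j ω ^ 2 ≤ T}.indicator Δ ω) ^ 2
      ≤ 2 * C ^ 2 * ((Set.Iic T).indicator (fun t => t ^ 2) (ξ j ω ^ 2)
        + ξ j ω ^ 2 * H ω ^ 2) := by
  filter_upwards [hΔ.abs_le] with ω hω
  by_cases hT : ξ j ω ^ 2 ≤ T
  · rw [Set.indicator_of_mem (s := {ω | ξ j ω ^ 2 ≤ T}) hT, Set.indicator_of_mem (Set.mem_Iic.2 hT)]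
    calc Δ ω ^ 2 = |Δ ω| ^ 2 := (sq_abs _).symm
      _ ≤ (C * (ξ j ω * (ξ j ω + H ω))) ^ 2 := pow_le_pow_left₀ (abs_nonneg _) hω 2
      _ = C ^ 2 * ξ j ω ^ 2 * (ξ j ω + H ω) ^ 2 := by ring
      _ ≤ C ^ 2 * ξ j ω ^ 2 * (2 * (ξ j ω ^ 2 + H ω ^ 2)) := by gcongr; exact add_sq_le
      _ = 2 * C ^ 2 * ((ξ j ω ^ 2) ^ 2 + ξ j ω ^ 2 * H ω ^ 2) := by ring
  · rw [Set.indicator_of_notMem (s := {ω | ξ j ω ^ 2 ≤ T}) hT,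
      Set.indicator_of_notMem (mt Set.mem_Iic.1 hT), zero_pow two_ne_zero]
    positivity

theorem integrable_majorant [IsFiniteMeasure P] (h : IsAmplitude ξ 𝓕 P)
    (hΔ : IsDominatedIncrement ξ 𝓕 P C j Δ H) :
    Integrable (fun ω => 2 * C ^ 2 * ((Set.Iic T).indicator (fun t => t ^ 2) (ξ j ω ^ 2)
      + ξ j ω ^ 2 * H ω ^ 2)) P := by
  have hsq : Measurable fun x : ℝ => x ^ 2 := measurable_id.pow_const 2
  exact ((integrable_indicator_sq ((h.measurable j).pow_const 2).aemeasurable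
    (fun _ => sq_nonneg _) T).add (((h.indepFun hΔ.bound_stronglyMeasurable).comp hsq
      hsq).integrable_mul (h.memLp j).integrable_sq hΔ.bound_memLp.integrable_sq)).const_mul _

theorem memLp_truncated [IsFiniteMeasure P] (h : IsAmplitude ξ 𝓕 P)
    (hΔ : IsDominatedIncrement ξ 𝓕 P C j Δ H) :
    MemLp ({ω | ξ j ω ^ 2 ≤ T}.indicator Δ) 2 P := by
  have hm := ((hΔ.stronglyMeasurable_truncated T h).mono (𝓕.le _)).aestronglyMeasurable (μ := P)
  refine (memLp_two_iff_integrable_sq hm).2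
    ((hΔ.integrable_majorant T h).mono' (hm.pow 2) ?_)
  filter_upwards [hΔ.ae_sq_truncated_le T] with ω hω
  rwa [Real.norm_of_nonneg (sq_nonneg _)]

theorem integral_sq_truncated_le [IsFiniteMeasure P] (h : IsAmplitude ξ 𝓕 P)
    (hΔ : IsDominatedIncrement ξ 𝓕 P C j Δ H) :
    ∫ ω, ({ω | ξ j ω ^ 2 ≤ T}.indicator Δ ω) ^ 2 ∂P
      ≤ 2 * C ^ 2 * (truncatedSecondMoment (fun ω => ξ 0 ω ^ 2) P T
        + (∫ ω, ξ 0 ω ^ 2 ∂P) * ∫ ω, H ω ^ 2 ∂P) := by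
  have hsq : Measurable fun x : ℝ => x ^ 2 := measurable_id.pow_const 2
  have hind : IndepFun (fun ω => ξ j ω ^ 2) (fun ω => H ω ^ 2) P :=
    (h.indepFun hΔ.bound_stronglyMeasurable).comp hsq hsq
  have hprod : Integrable (fun ω => ξ j ω ^ 2 * H ω ^ 2) P :=
    hind.integrable_mul (h.memLp j).integrable_sq hΔ.bound_memLp.integrable_sq
  refine (integral_mono_ae (hΔ.memLp_truncated T h).integrable_sq (hΔ.integrable_majorant T h)
    (hΔ.ae_sq_truncated_le T)).trans_eq ?_
  rw [integral_const_mul, integral_add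
    (integrable_indicator_sq ((h.measurable j).pow_const 2).aemeasurable (fun _ => sq_nonneg _) T)
    hprod, hind.integral_fun_mul_eq_mul_integral (h.memLp j).integrable_sq.aestronglyMeasurable
      hΔ.bound_memLp.integrable_sq.aestronglyMeasurable,
    h.integral_comp j hsq,
    h.integral_comp j (g := fun x => (Set.Iic T).indicator (fun t => t ^ 2) (x ^ 2))
      ((measurable_indicator_sq T).comp hsq)]
  rfl

theorem ae_abs_tail_le (h : IsAmplitude ξ 𝓕 P) (hC : 0 ≤ C)
    (hΔ : IsDominatedIncrement ξ 𝓕 P C j Δ H) :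
    ∀ᵐ ω ∂P, ‖{ω | ξ j ω ^ 2 ≤ T}ᶜ.indicator Δ ω‖
      ≤ C * ((1 + H ω) * (Set.Ioi T).indicator id (ξ j ω ^ 2)) := by
  filter_upwards [hΔ.abs_le] with ω hω
  by_cases hT : ξ j ω ^ 2 ≤ T
  · rw [Set.indicator_of_notMem (s := {ω | ξ j ω ^ 2 ≤ T}ᶜ) (Set.notMem_compl_iff.2 hT),
      Set.indicator_of_notMem (Set.notMem_Ioi.2 hT), norm_zero, mul_zero, mul_zero]
  · rw [Set.indicator_of_mem (s := {ω | ξ j ω ^ 2 ≤ T}ᶜ) (Set.mem_compl hT),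
      Set.indicator_of_mem (Set.mem_Ioi.2 (not_le.1 hT)), id, Real.norm_eq_abs]
    refine hω.trans (mul_le_mul_of_nonneg_left ?_ hC)
    have hle : ξ j ω * H ω ≤ ξ j ω ^ 2 * H ω :=
      mul_le_mul_of_nonneg_right (le_self_pow₀ (h.one_le j ω) two_ne_zero) (hΔ.bound_nonneg ω)
    linarith

theorem ae_abs_condExp_truncated_le [IsProbabilityMeasure P] (h : IsAmplitude ξ 𝓕 P) (hC : 0 ≤ C)
    (hΔ : IsDominatedIncrement ξ 𝓕 P C j Δ H) :
    ∀ᵐ ω ∂P, |(P[{ω | ξ j ω ^ 2 ≤ T}.indicator Δ | 𝓕 j]) ω|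
      ≤ C * tailMean (fun ω => ξ 0 ω ^ 2) P T * (1 + H ω) := by
  set R : Ω → ℝ := {ω | ξ j ω ^ 2 ≤ T}ᶜ.indicator Δ
  set G : Ω → ℝ := fun ω => (Set.Ioi T).indicator id (ξ j ω ^ 2)
  have hgm : Measurable fun x : ℝ => (Set.Ioi T).indicator id (x ^ 2) :=
    (measurable_indicator_id T).comp (measurable_id.pow_const 2)
  have hRi : Integrable R P := hΔ.integrable.indicator
    (measurableSet_le ((h.measurable j).pow_const 2) measurable_const).compl
  have hGi : Integrable G P := integrable_indicator_id (h.memLp j).integrable_sq T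
  have hHm : StronglyMeasurable[𝓕 j] fun ω => 1 + H ω :=
    stronglyMeasurable_const.add hΔ.bound_stronglyMeasurable
  have hprod : Integrable ((fun ω => 1 + H ω) * G) P :=
    ((h.indepFun hHm).comp hgm measurable_id).symm.integrable_mul
      ((integrable_const 1).add (hΔ.bound_memLp.integrable one_le_two)) hGi
  have hsplit : {ω | ξ j ω ^ 2 ≤ T}.indicator Δ = Δ - R :=
    eq_sub_of_add_eq (Set.indicator_self_add_compl _ Δ)
  rw [hsplit]
  filter_upwards [condExp_sub hΔ.integrable hRi (𝓕 j), norm_condExp_le (m := 𝓕 j) (μ := P) R,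
    condExp_mono (m := 𝓕 j) hRi.norm (hprod.smul C) (hΔ.ae_abs_tail_le T h hC),
    condExp_smul C ((fun ω => 1 + H ω) * G) (𝓕 j) (μ := P),
    condExp_mul_of_stronglyMeasurable_left hHm hprod hGi, hΔ.condExp_eq_zero,
    h.condExp_comp j hgm] with ω hsub hnorm hmono hsmul hmul hzero hmean
  rw [hsub, Pi.sub_apply, hzero, Pi.zero_apply, zero_sub, abs_neg]
  refine (hnorm.trans hmono).trans_eq ?_
  rw [hsmul, Pi.smul_apply, hmul, Pi.mul_apply, hmean, smul_eq_mul, mul_assoc, mul_comm (1 + H ω)]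
  rfl

end IsDominatedIncrement

end Increments

theorem inv_floor_pow_le {c : ℝ} (hc : 1 ≤ c) (n : ℕ) : (⌊c ^ n⌋₊ : ℝ)⁻¹ ≤ 2 * (c ^ n)⁻¹ := by
  have hfloor : (1 : ℝ) ≤ ⌊c ^ n⌋₊ := by
    exact_mod_cast (Nat.one_le_floor_iff _).2 (one_le_pow₀ hc)
  have hpow : 0 < c ^ n := pow_pos (one_pos.trans_le hc) n
  rw [← div_eq_mul_inv, inv_eq_one_div, div_le_div_iff₀ (one_pos.trans_le hfloor) hpow]
  linarith [Nat.lt_floor_add_one (c ^ n)]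

/-- The sum of the first `N` increments, each truncated where `ξ_j² > T` and then recentred to
conditional mean zero. -/
noncomputable def compensatedSum (ξ : ℕ → Ω → ℝ) (𝓕 : Filtration ℕ mΩ) (P : Measure Ω) (T : ℝ)
    (Δ : ℕ → Ω → ℝ) (N : ℕ) (ω : Ω) : ℝ :=
  ∑ j ∈ Finset.range N, ({ω | ξ j ω ^ 2 ≤ T}.indicator (Δ j) ω
    - (P[{ω | ξ j ω ^ 2 ≤ T}.indicator (Δ j) | 𝓕 j]) ω)

section Row

variable {Δ H : ℕ → Ω → ℝ} {C K : ℝ} (T : ℝ) (N : ℕ)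

theorem memLp_compensatedSum [IsFiniteMeasure P] (h : IsAmplitude ξ 𝓕 P)
    (hΔ : ∀ j, IsDominatedIncrement ξ 𝓕 P C j (Δ j) (H j)) :
    MemLp (compensatedSum ξ 𝓕 P T Δ N) 2 P :=
  memLp_sum_sub_condExp (fun j => (hΔ j).memLp_truncated T h) N

theorem integral_sq_compensatedSum_le [IsFiniteMeasure P] (h : IsAmplitude ξ 𝓕 P)
    (hΔ : ∀ j, IsDominatedIncrement ξ 𝓕 P C j (Δ j) (H j))
    (hH : ∑ j ∈ Finset.range N, ∫ ω, H j ω ^ 2 ∂P ≤ K * N) :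
    ∫ ω, compensatedSum ξ 𝓕 P T Δ N ω ^ 2 ∂P
      ≤ 2 * C ^ 2 * (truncatedSecondMoment (fun ω => ξ 0 ω ^ 2) P T
        + (∫ ω, ξ 0 ω ^ 2 ∂P) * K) * N := by
  have : 0 ≤ ∫ ω, ξ 0 ω ^ 2 ∂P := integral_nonneg fun ω => sq_nonneg _
  calc ∫ ω, compensatedSum ξ 𝓕 P T Δ N ω ^ 2 ∂P
      ≤ ∑ j ∈ Finset.range N, ∫ ω, ({ω | ξ j ω ^ 2 ≤ T}.indicator (Δ j) ω) ^ 2 ∂P :=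
        integral_sq_sum_sub_condExp_le 𝓕 (fun j => (hΔ j).stronglyMeasurable_truncated T h)
          (fun j => (hΔ j).memLp_truncated T h) N
    _ ≤ ∑ j ∈ Finset.range N, 2 * C ^ 2 * (truncatedSecondMoment (fun ω => ξ 0 ω ^ 2) P T
          + (∫ ω, ξ 0 ω ^ 2 ∂P) * ∫ ω, H j ω ^ 2 ∂P) :=
        Finset.sum_le_sum fun j _ => (hΔ j).integral_sq_truncated_le T h
    _ = 2 * C ^ 2 * (N * truncatedSecondMoment (fun ω => ξ 0 ω ^ 2) P T
          + (∫ ω, ξ 0 ω ^ 2 ∂P) * ∑ j ∈ Finset.range N, ∫ ω, H j ω ^ 2 ∂P) := by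
        rw [← Finset.mul_sum, Finset.sum_add_distrib, ← Finset.mul_sum, Finset.sum_const,
          Finset.card_range, nsmul_eq_mul]
    _ ≤ 2 * C ^ 2 * (N * truncatedSecondMoment (fun ω => ξ 0 ω ^ 2) P T
          + (∫ ω, ξ 0 ω ^ 2 ∂P) * (K * N)) := by gcongr
    _ = _ := by ring

theorem ae_abs_sum_le_compensatedSum [IsProbabilityMeasure P] (h : IsAmplitude ξ 𝓕 P) (hC : 0 ≤ C)
    (hΔ : ∀ j, IsDominatedIncrement ξ 𝓕 P C j (Δ j) (H j)) :
    ∀ᵐ ω ∂P, (∀ j < N, ξ j ω ^ 2 ≤ T) → |∑ j ∈ Finset.range N, Δ j ω|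
      ≤ |compensatedSum ξ 𝓕 P T Δ N ω| + C * tailMean (fun ω => ξ 0 ω ^ 2) P T
        * (N + ∑ j ∈ Finset.range N, H j ω) := by
  filter_upwards [ae_all_iff.2 fun j => (hΔ j).ae_abs_condExp_truncated_le T h hC]
    with ω hcondExp hξ
  have hsplit : ∑ j ∈ Finset.range N, Δ j ω = compensatedSum ξ 𝓕 P T Δ N ω
      + ∑ j ∈ Finset.range N, (P[{ω | ξ j ω ^ 2 ≤ T}.indicator (Δ j) | 𝓕 j]) ω := by
    rw [compensatedSum, ← Finset.sum_add_distrib]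
    refine Finset.sum_congr rfl fun j hj => ?_
    rw [sub_add_cancel, Set.indicator_of_mem (s := {ω | ξ j ω ^ 2 ≤ T})
      (hξ j (Finset.mem_range.1 hj))]
  rw [hsplit]
  refine (abs_add_le _ _).trans (add_le_add_right ((Finset.abs_sum_le_sum_abs _ _).trans
    ((Finset.sum_le_sum fun j _ => hcondExp j).trans_eq ?_)) _)
  rw [← Finset.mul_sum, Finset.sum_add_distrib, Finset.sum_const, Finset.card_range, nsmul_eq_mul,
    mul_one]

end Row

section Array

variable {Δ H : ℕ → ℕ → Ω → ℝ} {C K c : ℝ}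

theorem integral_sq_inv_mul_compensatedSum_le [IsFiniteMeasure P] (h : IsAmplitude ξ 𝓕 P)
    (hΔ : ∀ N j, IsDominatedIncrement ξ 𝓕 P C j (Δ N j) (H N j))
    (hH : ∀ N : ℕ, ∑ j ∈ Finset.range N, ∫ ω, H N j ω ^ 2 ∂P ≤ K * N) (hc : 1 ≤ c) (n : ℕ) :
    ∫ ω, ((⌊c ^ n⌋₊ : ℝ)⁻¹ * compensatedSum ξ 𝓕 P (c ^ n) (Δ ⌊c ^ n⌋₊) ⌊c ^ n⌋₊ ω) ^ 2 ∂P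
      ≤ 4 * C ^ 2 * ((c ^ n)⁻¹ * truncatedSecondMoment (fun ω => ξ 0 ω ^ 2) P (c ^ n))
        + 4 * C ^ 2 * ((∫ ω, ξ 0 ω ^ 2 ∂P) * K) * (c ^ n)⁻¹ := by
  set M := ⌊c ^ n⌋₊
  have hM : (0 : ℝ) < M := by exact_mod_cast (Nat.one_le_floor_iff _).2 (one_le_pow₀ hc)
  have hK : 0 ≤ K := nonneg_of_mul_nonneg_left
    ((Finset.sum_nonneg fun j _ => integral_nonneg fun ω => sq_nonneg _).trans (hH M)) hM
  have : 0 ≤ ∫ ω, ξ 0 ω ^ 2 ∂P := integral_nonneg fun ω => sq_nonneg _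
  have htrunc := truncatedSecondMoment_nonneg (P := P) (fun ω => ξ 0 ω ^ 2) (c ^ n)
  simp_rw [mul_pow]
  rw [integral_const_mul]
  calc (M : ℝ)⁻¹ ^ 2 * ∫ ω, compensatedSum ξ 𝓕 P (c ^ n) (Δ M) M ω ^ 2 ∂P
      ≤ (M : ℝ)⁻¹ ^ 2 * (2 * C ^ 2 * (truncatedSecondMoment (fun ω => ξ 0 ω ^ 2) P (c ^ n)
          + (∫ ω, ξ 0 ω ^ 2 ∂P) * K) * M) := by
        gcongr; exact integral_sq_compensatedSum_le _ _ h (hΔ M) (hH M)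
    _ = (M : ℝ)⁻¹ * (2 * C ^ 2 * (truncatedSecondMoment (fun ω => ξ 0 ω ^ 2) P (c ^ n)
          + (∫ ω, ξ 0 ω ^ 2 ∂P) * K)) := by field_simp
    _ ≤ (2 * (c ^ n)⁻¹) * (2 * C ^ 2 * (truncatedSecondMoment (fun ω => ξ 0 ω ^ 2) P (c ^ n)
          + (∫ ω, ξ 0 ω ^ 2 ∂P) * K)) := by
        gcongr; exact inv_floor_pow_le hc n
    _ = _ := by ring

theorem ae_tendsto_inv_mul_compensatedSum [IsFiniteMeasure P] (h : IsAmplitude ξ 𝓕 P)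
    (hΔ : ∀ N j, IsDominatedIncrement ξ 𝓕 P C j (Δ N j) (H N j))
    (hH : ∀ N : ℕ, ∑ j ∈ Finset.range N, ∫ ω, H N j ω ^ 2 ∂P ≤ K * N) (hc : 1 < c) :
    ∀ᵐ ω ∂P, Tendsto (fun n : ℕ =>
      (⌊c ^ n⌋₊ : ℝ)⁻¹ * compensatedSum ξ 𝓕 P (c ^ n) (Δ ⌊c ^ n⌋₊) ⌊c ^ n⌋₊ ω) atTop (𝓝 0) := by
  have hgeom : Summable fun n : ℕ => (c ^ n)⁻¹ := by
    simp_rw [← inv_pow]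
    exact summable_geometric_of_lt_one (inv_nonneg.2 (zero_le_one.trans hc.le))
      (inv_lt_one_of_one_lt₀ hc)
  have hsummable := Summable.of_nonneg_of_le (fun n => integral_nonneg fun ω => sq_nonneg _)
    (integral_sq_inv_mul_compensatedSum_le h hΔ hH hc.le)
    (((summable_inv_pow_mul_truncatedSecondMoment h.memLp_zero.integrable_sq
      (fun ω => sq_nonneg _) hc).mul_left _).add (hgeom.mul_left _))
  filter_upwards [ae_tendsto_zero_of_summable_integral
    (fun n => ((memLp_compensatedSum (c ^ n) ⌊c ^ n⌋₊ h (hΔ _)).const_mul _).integrable_sq)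
    (fun n ω => sq_nonneg _) hsummable] with ω hω
  refine (tendsto_zero_iff_abs_tendsto_zero _).2 ?_
  simpa only [Function.comp_def, Real.sqrt_sq_eq_abs, Real.sqrt_zero] using hω.sqrt

theorem IsAmplitude.tendsto_array [IsProbabilityMeasure P] (h : IsAmplitude ξ 𝓕 P) (hC : 0 ≤ C)
    (hΔ : ∀ N j, IsDominatedIncrement ξ 𝓕 P C j (Δ N j) (H N j))
    (hH : ∀ N : ℕ, ∑ j ∈ Finset.range N, ∫ ω, H N j ω ^ 2 ∂P ≤ K * N)
    (hHae : ∀ᵐ ω ∂P, ∃ K', ∀ N : ℕ, ∑ j ∈ Finset.range N, H N j ω ≤ K' * N) (hc : 1 < c) :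
    ∀ᵐ ω ∂P, Tendsto (fun n : ℕ =>
      (⌊c ^ n⌋₊ : ℝ)⁻¹ * ∑ j ∈ Finset.range ⌊c ^ n⌋₊, Δ ⌊c ^ n⌋₊ j ω) atTop (𝓝 0) := by
  have htail : Tendsto (fun n : ℕ => tailMean (fun ω => ξ 0 ω ^ 2) P (c ^ n)) atTop (𝓝 0) :=
    (tendsto_tailMean h.memLp_zero.integrable_sq).comp (tendsto_pow_atTop_atTop_of_one_lt hc)
  filter_upwards [ae_tendsto_inv_mul_compensatedSum h hΔ hH hc, hHae,
    h.ae_eventually_forall_sq_le hc,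
    ae_all_iff.2 fun n => ae_abs_sum_le_compensatedSum (c ^ n) ⌊c ^ n⌋₊ h hC (hΔ ⌊c ^ n⌋₊)]
    with ω hcompensated ⟨K', hK'⟩ hξ hsum
  have hlim := hcompensated.abs.add ((htail.const_mul C).mul_const (1 + K'))
  rw [abs_zero, mul_zero, zero_mul, add_zero] at hlim
  refine squeeze_zero_norm' ?_ hlim
  filter_upwards [hξ] with n hn
  set M := ⌊c ^ n⌋₊
  have hM : (0 : ℝ) < M := by exact_mod_cast (Nat.one_le_floor_iff _).2 (one_le_pow₀ hc.le)
  have htail0 := tailMean_nonneg (P := P) (fun ω => sq_nonneg (ξ 0 ω)) (c ^ n)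
  rw [norm_mul, Real.norm_eq_abs, Real.norm_eq_abs, abs_mul, abs_of_pos (inv_pos.2 hM),
    inv_mul_le_iff₀ hM, mul_add, mul_inv_cancel_left₀ hM.ne']
  calc |∑ j ∈ Finset.range M, Δ M j ω|
      ≤ |compensatedSum ξ 𝓕 P (c ^ n) (Δ M) M ω| + C * tailMean (fun ω => ξ 0 ω ^ 2) P (c ^ n)
        * (M + ∑ j ∈ Finset.range M, H M j ω) := hsum n hn
    _ ≤ |compensatedSum ξ 𝓕 P (c ^ n) (Δ M) M ω| + C * tailMean (fun ω => ξ 0 ω ^ 2) P (c ^ n)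
        * (M + K' * M) := by gcongr; exact hK' M
    _ = _ := by ring

end Array

end Amplitude

section Splice

/-- The sequence that follows `w` before time `j` and `w'` from time `j` on. -/
def splice {E : Type*} (j : ℕ) (w w' : ℕ → E) : ℕ → E := fun i => if i < j then w i else w' i

variable {E : Type*} {i j : ℕ}

theorem splice_of_lt (h : i < j) (w w' : ℕ → E) : splice j w w' i = w i :=
  if_pos h

theorem splice_of_le (h : j ≤ i) (w w' : ℕ → E) : splice j w w' i = w' i :=
  if_neg h.not_gt

theorem splice_zero (w w' : ℕ → E) : splice 0 w w' = w' :=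
  funext fun i => splice_of_le i.zero_le w w'

theorem splice_self (j : ℕ) (w : ℕ → E) : splice j w w = w :=
  funext fun _ => ite_self _

theorem measurable_splice [MeasurableSpace E] (j : ℕ) (w : ℕ → E) : Measurable (splice j w) :=
  measurable_pi_lambda _ fun i => .ite (.const _) measurable_const (measurable_pi_apply i)

end Splice

section PastAndFuture

variable {Ω E : Type*} {mΩ : MeasurableSpace Ω} {P : Measure Ω} [MeasurableSpace E]
  {e : ℕ → Ω → E}

/-- The tuple of the variables before time `j`. -/
def pastTuple (e : ℕ → Ω → E) (j : ℕ) (ω : Ω) : {i // i < j} → E := fun i => e i ω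

/-- The tuple of the variables from time `j` on. -/
def futureTuple (e : ℕ → Ω → E) (j : ℕ) (ω : Ω) : {i // ¬ i < j} → E := fun i => e i ω

/-- The sequence with given values before and from time `j` on. -/
def joinTuples (E : Type*) [MeasurableSpace E] (j : ℕ) :
    ({i // i < j} → E) × ({i // ¬ i < j} → E) ≃ᵐ (ℕ → E) :=
  (MeasurableEquiv.piEquivPiSubtypeProd (fun _ => E) (· < j)).symm

theorem joinTuples_pastTuple_futureTuple (e : ℕ → Ω → E) (j : ℕ) (ω ω' : Ω) :
    joinTuples E j (pastTuple e j ω, futureTuple e j ω') = splice j (e · ω) (e · ω') :=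
  rfl

theorem measurable_pastTuple (he : ∀ i, Measurable (e i)) (j : ℕ) : Measurable (pastTuple e j) :=
  measurable_pi_lambda _ fun i => he i

theorem measurable_futureTuple (he : ∀ i, Measurable (e i)) (j : ℕ) :
    Measurable (futureTuple e j) :=
  measurable_pi_lambda _ fun i => he i

theorem indepFun_pastTuple_futureTuple (he : ∀ i, Measurable (e i)) (hi : iIndepFun e P) (j : ℕ) :
    IndepFun (pastTuple e j) (futureTuple e j) P := by
  have hcomap (S : Set ℕ) : MeasurableSpace.comap (fun ω (i : S) => e i ω) MeasurableSpace.pi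
      = ⨆ i ∈ S, MeasurableSpace.comap (e i) inferInstance := by
    simp_rw [MeasurableSpace.pi, MeasurableSpace.comap_iSup, iSup_subtype',
      MeasurableSpace.comap_comp]
    rfl
  have hindep := indep_iSup_of_disjoint (fun i => (he i).comap_le) hi
    (disjoint_compl_right (a := {i | i < j}))
  rw [← hcomap, ← hcomap] at hindep
  exact (IndepFun_iff_Indep ..).2 hindep

/-- The filtration generated by the variables before time `j`. -/
def pastFiltration (e : ℕ → Ω → E) (he : ∀ i, Measurable (e i)) : Filtration ℕ mΩ where
  seq j := MeasurableSpace.comap (pastTuple e j) inferInstance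
  mono' i j hij := by
    have hrestrict : Measurable fun (x : {l // l < j} → E) (l : {l // l < i}) =>
        x ⟨l, l.2.trans_le hij⟩ := by fun_prop
    exact (hrestrict.comp (comap_measurable (pastTuple e j))).comap_le
  le' j := (measurable_pastTuple he j).comap_le

theorem measurable_pastFiltration (he : ∀ i, Measurable (e i)) {i j : ℕ} (hij : i < j) :
    Measurable[pastFiltration e he j] (e i) :=
  (measurable_pi_apply (⟨i, hij⟩ : {i // i < j})).comp (comap_measurable (pastTuple e j))

variable [IsProbabilityMeasure P]

theorem lintegral_eq_lintegral_lintegral_splice (he : ∀ i, Measurable (e i)) (hi : iIndepFun e P)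
    (j : ℕ) {G : (ℕ → E) → ENNReal} (hG : Measurable G) :
    ∫⁻ ω, G (e · ω) ∂P = ∫⁻ ω, ∫⁻ ω', G (splice j (e · ω) (e · ω')) ∂P ∂P := by
  have hpast := measurable_pastTuple he j
  have hfuture := measurable_futureTuple he j
  have hGj : Measurable fun p => G (joinTuples E j p) := hG.comp (joinTuples E j).measurable
  calc ∫⁻ ω, G (e · ω) ∂P
      = ∫⁻ ω, G (joinTuples E j (pastTuple e j ω, futureTuple e j ω)) ∂P := by
        simp_rw [joinTuples_pastTuple_futureTuple, splice_self]
    _ = ∫⁻ p, G (joinTuples E j p) ∂(P.map (pastTuple e j)).prod (P.map (futureTuple e j)) := by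
        rw [← (indepFun_iff_map_prod_eq_prod_map_map hpast.aemeasurable hfuture.aemeasurable).1
          (indepFun_pastTuple_futureTuple he hi j), lintegral_map hGj (hpast.prodMk hfuture)]
    _ = ∫⁻ ω, ∫⁻ y, G (joinTuples E j (pastTuple e j ω, y)) ∂P.map (futureTuple e j) ∂P := by
        rw [lintegral_prod _ hGj.aemeasurable, lintegral_map hGj.lintegral_prod_right' hpast]
    _ = _ := lintegral_congr fun ω => lintegral_map (hGj.comp measurable_prodMk_left) hfuture

theorem condExp_pastFiltration [StandardBorelSpace E] [Nonempty E] (he : ∀ i, Measurable (e i))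
    (hi : iIndepFun e P) (j : ℕ) {G : (ℕ → E) → ℝ} (hG : Measurable G)
    (hint : Integrable (fun ω => G (e · ω)) P) :
    P[fun ω => G (e · ω) | pastFiltration e he j]
      =ᵐ[P] fun ω => ∫ ω', G (splice j (e · ω) (e · ω')) ∂P := by
  have hpast := measurable_pastTuple he j
  have hfuture := measurable_futureTuple he j
  have hGj : Measurable fun p => G (joinTuples E j p) := hG.comp (joinTuples E j).measurable
  have hjoin : (fun ω => G (joinTuples E j (pastTuple e j ω, futureTuple e j ω)))
      = fun ω => G (e · ω) := by
    simp_rw [joinTuples_pastTuple_futureTuple, splice_self]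
  have hdistrib : condDistrib (futureTuple e j) (pastTuple e j) P
      =ᵐ[P.map (pastTuple e j)] Kernel.const _ (P.map (futureTuple e j)) := by
    have := Measure.isProbabilityMeasure_map (μ := P) hfuture.aemeasurable
    refine condDistrib_ae_eq_of_measure_eq_compProd _ hfuture.aemeasurable ?_
    rw [Measure.compProd_const]
    exact (indepFun_iff_map_prod_eq_prod_map_map hpast.aemeasurable hfuture.aemeasurable).1
      (indepFun_pastTuple_futureTuple he hi j)
  rw [← hjoin] at hint ⊢
  filter_upwards [condExp_prod_ae_eq_integral_condDistrib hpast hfuture.aemeasurable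
    hGj.stronglyMeasurable hint, ae_of_ae_map hpast.aemeasurable hdistrib] with ω hω hωdistrib
  exact hω.trans (hωdistrib ▸ integral_map hfuture.aemeasurable
    (hGj.comp measurable_prodMk_left).aestronglyMeasurable)

end PastAndFuture

section Noise

variable {Ω E : Type*} {mΩ : MeasurableSpace Ω} [NormedAddCommGroup E] [MeasurableSpace E]

/-- Independent, identically distributed and square integrable noise, not necessarily centred. -/
structure IsL2Noise (e : ℕ → Ω → E) (P : Measure Ω) : Prop where
  measurable : ∀ i, Measurable (e i)
  iIndepFun : iIndepFun e P
  identDistrib : ∀ i, IdentDistrib (e i) (e 0) P P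
  memLp_zero : MemLp (e 0) 2 P

variable {P : Measure Ω} {e : ℕ → Ω → E}

theorem IsL2Noise.measurable_pi (he : IsL2Noise e P) : Measurable fun ω => (e · ω) :=
  measurable_pi_lambda _ he.measurable

theorem IsL2Noise.isAmplitude_one_add_norm [BorelSpace E] [IsProbabilityMeasure P]
    (he : IsL2Noise e P) :
    IsAmplitude (fun j ω => 1 + ‖e j ω‖) (pastFiltration e he.measurable) P where
  stronglyMeasurable j :=
    ((measurable_norm.comp (measurable_pastFiltration he.measurable j.lt_succ_self)).const_add
      1).stronglyMeasurable
  indep j := by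
    have hnorm : Measurable fun x : {i // ¬ i < j} → E => 1 + ‖x ⟨j, lt_irrefl j⟩‖ :=
      (measurable_pi_apply (⟨j, lt_irrefl j⟩ : {i // ¬ i < j})).norm.const_add 1
    exact (IndepFun_iff_Indep ..).1 ((indepFun_pastTuple_futureTuple he.measurable he.iIndepFun
      j).symm.comp hnorm measurable_id)
  identDistrib j := (he.identDistrib j).comp (measurable_norm.const_add 1)
  one_le j ω := le_add_of_nonneg_right (norm_nonneg _)
  memLp_zero := MemLp.add (f := fun _ => (1 : ℝ)) (memLp_const 1) he.memLp_zero.norm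

end Noise

section SquareNorms

theorem abs_norm_sq_sub_norm_sq_le {V : Type*} [SeminormedAddCommGroup V] {u v : V} {a b : ℝ}
    (ha : ‖u - v‖ ≤ a) (hb : ‖v‖ ≤ b) : |‖u‖ ^ 2 - ‖v‖ ^ 2| ≤ a * (a + 2 * b) := by
  have hdist : |‖u‖ - ‖v‖| ≤ a := (abs_norm_sub_norm_le u v).trans ha
  have hsum : ‖u‖ + ‖v‖ ≤ a + 2 * b := by linarith [le_of_abs_le hdist]
  rw [sq_sub_sq, abs_mul, abs_of_nonneg (by positivity), mul_comm]
  exact mul_le_mul hdist hsum (by positivity) ((norm_nonneg _).trans ha)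

variable {Ω F : Type*} {mΩ : MeasurableSpace Ω} {P : Measure Ω} [NormedAddCommGroup F]

theorem integral_norm_sq_eq_norm_toLp_sq {U : Ω → F} (hU : MemLp U 2 P) :
    ∫ ω, ‖U ω‖ ^ 2 ∂P = ‖hU.toLp U‖ ^ 2 := by
  have h0 : 0 ≤ ∫ ω, ‖U ω‖ ^ 2 ∂P := integral_nonneg fun ω => sq_nonneg _
  rw [Lp.norm_toLp, hU.eLpNorm_eq_integral_rpow_norm two_ne_zero ENNReal.ofNat_ne_top]
  simp only [ENNReal.toReal_ofNat, Real.rpow_two]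
  rw [ENNReal.toReal_ofReal (Real.rpow_nonneg h0 _), ← Real.rpow_mul_natCast h0]
  norm_num

theorem integral_norm_sq_le {U : Ω → F} {b : ℝ} (hU : AEStronglyMeasurable U P)
    (hb0 : 0 ≤ b) (hb : eLpNorm U 2 P ≤ ENNReal.ofReal b) : ∫ ω, ‖U ω‖ ^ 2 ∂P ≤ b ^ 2 := by
  have hUL : MemLp U 2 P := ⟨hU, hb.trans_lt ENNReal.ofReal_lt_top⟩
  rw [integral_norm_sq_eq_norm_toLp_sq hUL, Lp.norm_toLp]
  exact pow_le_pow_left₀ ENNReal.toReal_nonneg (ENNReal.toReal_le_of_le_ofReal hb0 hb) 2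

theorem abs_integral_norm_sq_sub_le {U V : Ω → F} {a b : ℝ} (hU : AEStronglyMeasurable U P)
    (hV : AEStronglyMeasurable V P) (ha0 : 0 ≤ a) (hb0 : 0 ≤ b)
    (ha : eLpNorm (U - V) 2 P ≤ ENNReal.ofReal a) (hb : eLpNorm V 2 P ≤ ENNReal.ofReal b) :
    |∫ ω, ‖U ω‖ ^ 2 ∂P - ∫ ω, ‖V ω‖ ^ 2 ∂P| ≤ a * (a + 2 * b) := by
  have hVL : MemLp V 2 P := ⟨hV, hb.trans_lt ENNReal.ofReal_lt_top⟩
  have hUL : MemLp U 2 P :=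
    sub_add_cancel U V ▸ MemLp.add ⟨hU.sub hV, ha.trans_lt ENNReal.ofReal_lt_top⟩ hVL
  rw [integral_norm_sq_eq_norm_toLp_sq hUL, integral_norm_sq_eq_norm_toLp_sq hVL]
  refine abs_norm_sq_sub_norm_sq_le ?_ ?_
  · rw [← MemLp.toLp_sub, Lp.norm_toLp]
    exact ENNReal.toReal_le_of_le_ofReal ha0 ha
  · rw [Lp.norm_toLp]
    exact ENNReal.toReal_le_of_le_ofReal hb0 hb

end SquareNorms

section PastAndFutureSums

/-- The discounted sum of the values of `a` strictly before time `j`. -/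
def pastSum (lam : ℝ) (a : ℕ → ℝ) (j : ℕ) : ℝ :=
  ∑ i ∈ Finset.range j, lam ^ (j - i) * a i

/-- The discounted sum of the values of `a` from time `j` up to, but excluding, the horizon `N`. -/
def futureSum (lam : ℝ) (a : ℕ → ℝ) (N j : ℕ) : ℝ :=
  ∑ k ∈ Finset.Ico j N, lam ^ (k - j) * a k

variable {lam : ℝ} {a : ℕ → ℝ}

theorem pastSum_nonneg (h0 : 0 ≤ lam) (ha : ∀ i, 0 ≤ a i) (j : ℕ) : 0 ≤ pastSum lam a j :=
  Finset.sum_nonneg fun i _ => mul_nonneg (pow_nonneg h0 _) (ha i)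

theorem pastSum_le_geomFilter (h0 : 0 ≤ lam) (ha : ∀ i, 0 ≤ a i) (j : ℕ) :
    pastSum lam a j ≤ geomFilter lam a j := by
  rw [geomFilter, Finset.sum_range_succ]
  exact le_add_of_nonneg_right (mul_nonneg (pow_nonneg h0 _) (ha j))

theorem sum_pastSum_le (h0 : 0 ≤ lam) (h1 : lam < 1) (ha : ∀ i, 0 ≤ a i) (N : ℕ) :
    ∑ j ∈ Finset.range N, pastSum lam a j ≤ (1 - lam)⁻¹ * ∑ i ∈ Finset.range N, a i :=
  (Finset.sum_le_sum fun j _ => pastSum_le_geomFilter h0 ha j).trans (sum_geomFilter_le h0 h1 ha N)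

theorem futureSum_nonneg (h0 : 0 ≤ lam) (ha : ∀ i, 0 ≤ a i) (N j : ℕ) :
    0 ≤ futureSum lam a N j :=
  Finset.sum_nonneg fun k _ => mul_nonneg (pow_nonneg h0 _) (ha k)

theorem sum_Ico_pow_sub_le (h0 : 0 ≤ lam) (h1 : lam < 1) (j N : ℕ) :
    ∑ k ∈ Finset.Ico j N, lam ^ (k - j) ≤ (1 - lam)⁻¹ := by
  simpa only [Finset.sum_Ico_eq_sum_range, Nat.add_sub_cancel_left] using
    sum_range_pow_le h0 h1 (N - j)

theorem sum_futureSum_le {K : ℝ} (h0 : 0 ≤ lam) (h1 : lam < 1) (ha : ∀ i, 0 ≤ a i)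
    (hK : ∀ N : ℕ, ∑ k ∈ Finset.range N, a k ^ 2 ≤ K * N) (N : ℕ) :
    ∑ j ∈ Finset.range N, futureSum lam a N j ≤ (1 - lam)⁻¹ * (1 + K) * N := by
  have hL : 0 ≤ (1 - lam)⁻¹ := inv_nonneg.2 (sub_nonneg.2 h1.le)
  rw [mul_assoc]
  refine (sum_sum_Ico_pow_mul_le h0 h1 ha N).trans (mul_le_mul_of_nonneg_left ?_ hL)
  calc ∑ k ∈ Finset.range N, a k ≤ ∑ k ∈ Finset.range N, (1 + a k ^ 2) :=
        Finset.sum_le_sum fun k _ => by nlinarith [sq_nonneg (a k - 1)]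
    _ = N + ∑ k ∈ Finset.range N, a k ^ 2 := by
        rw [Finset.sum_add_distrib, Finset.sum_const, Finset.card_range, nsmul_one]
    _ ≤ (1 + K) * N := by linarith [hK N]

theorem sum_futureSum_sq_le (h0 : 0 ≤ lam) (h1 : lam < 1) (a : ℕ → ℝ) (N : ℕ) :
    ∑ j ∈ Finset.range N, futureSum lam a N j ^ 2
      ≤ (1 - lam)⁻¹ ^ 2 * ∑ k ∈ Finset.range N, a k ^ 2 := by
  have hL : 0 ≤ (1 - lam)⁻¹ := inv_nonneg.2 (sub_nonneg.2 h1.le)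
  calc ∑ j ∈ Finset.range N, futureSum lam a N j ^ 2
      ≤ ∑ j ∈ Finset.range N, (1 - lam)⁻¹ * futureSum lam (fun k => a k ^ 2) N j :=
        Finset.sum_le_sum fun j _ => (sq_sum_mul_le _ a fun k _ => pow_nonneg h0 _).trans
          (mul_le_mul_of_nonneg_right (sum_Ico_pow_sub_le h0 h1 j N)
            (futureSum_nonneg h0 (fun k => sq_nonneg (a k)) N j))
    _ ≤ (1 - lam)⁻¹ * ((1 - lam)⁻¹ * ∑ k ∈ Finset.range N, a k ^ 2) := by
        rw [← Finset.mul_sum]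
        exact mul_le_mul_of_nonneg_left
          (sum_sum_Ico_pow_mul_le h0 h1 (fun k => sq_nonneg (a k)) N) hL
    _ = _ := by ring

theorem abs_sum_Ico_le_of_abs_le {β d : ℕ → ℝ} {C x G : ℝ} {j : ℕ} (h0 : 0 ≤ lam) (h1 : lam < 1)
    (hC : 0 ≤ C) (hβ : ∀ k, 0 ≤ β k) (hx : 0 ≤ x) (hG : 0 ≤ G)
    (hd : ∀ k, j ≤ k → |d k|
      ≤ C * lam ^ (k - j) * x * (C * lam ^ (k - j) * x + 2 * (β k + C * G))) (N : ℕ) :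
    |∑ k ∈ Finset.Ico j N, d k|
      ≤ C * (2 + 2 * C * (1 - lam)⁻¹) * (x * (x + (futureSum lam β N j + G))) := by
  have : 0 ≤ (1 - lam)⁻¹ := inv_nonneg.2 (sub_nonneg.2 h1.le)
  have hB : 0 ≤ futureSum lam β N j := futureSum_nonneg h0 hβ N j
  have hterm (k : ℕ) (hk : k ∈ Finset.Ico j N) : |d k|
      ≤ C * x * (C * x + 2 * C * G) * lam ^ (k - j) + 2 * C * x * (lam ^ (k - j) * β k) := by
    refine (hd k (Finset.mem_Ico.1 hk).1).trans ?_
    have : C * lam ^ (k - j) * x * (C * lam ^ (k - j) * x)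
        ≤ C * lam ^ (k - j) * x * (C * 1 * x) := by
      gcongr; exact pow_le_one₀ h0 h1.le
    linarith
  calc |∑ k ∈ Finset.Ico j N, d k|
      ≤ ∑ k ∈ Finset.Ico j N,
          (C * x * (C * x + 2 * C * G) * lam ^ (k - j) + 2 * C * x * (lam ^ (k - j) * β k)) :=
        (Finset.abs_sum_le_sum_abs _ _).trans (Finset.sum_le_sum hterm)
    _ = C * x * (C * x + 2 * C * G) * ∑ k ∈ Finset.Ico j N, lam ^ (k - j)
          + 2 * C * x * futureSum lam β N j := by
        rw [Finset.sum_add_distrib, ← Finset.mul_sum, ← Finset.mul_sum, futureSum]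
    _ ≤ C * x * (C * x + 2 * C * G) * (1 - lam)⁻¹ + 2 * C * x * futureSum lam β N j := by
        gcongr; exact sum_Ico_pow_sub_le h0 h1 j N
    _ ≤ C * (2 + 2 * C * (1 - lam)⁻¹) * (x * (x + (futureSum lam β N j + G))) := by
        have hCxG : 0 ≤ C * x * G := by positivity
        have hCxx : 0 ≤ C * x * x := by positivity
        have hCLxx : 0 ≤ C * C * (1 - lam)⁻¹ * x * x := by positivity
        have hCLxB : 0 ≤ C * C * (1 - lam)⁻¹ * x * futureSum lam β N j := by positivity
        linarith

end PastAndFutureSums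

section Increments

variable {Ω E F : Type*} {mΩ : MeasurableSpace Ω} {P : Measure Ω} [MeasurableSpace E]
  [NormedAddCommGroup F] {e : ℕ → Ω → E} {Φ : ℕ → (ℕ → E) → F}

/-- The increment at time `j` of the martingale of conditional expectations of `‖Φ_k‖²`. -/
noncomputable def sqNormIncrement (he : ∀ i, Measurable (e i)) (P : Measure Ω)
    (Φ : ℕ → (ℕ → E) → F) (k j : ℕ) : Ω → ℝ :=
  P[fun ω => ‖Φ k (e · ω)‖ ^ 2 | pastFiltration e he (j + 1)]
    - P[fun ω => ‖Φ k (e · ω)‖ ^ 2 | pastFiltration e he j]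

/-- The increment at time `j` of the martingale of conditional expectations of
`∑_{k < N} ‖Φ_k‖²`; the terms with `k < j` do not contribute. -/
noncomputable def sumSqNormIncrement (he : ∀ i, Measurable (e i)) (P : Measure Ω)
    (Φ : ℕ → (ℕ → E) → F) (N j : ℕ) : Ω → ℝ :=
  ∑ k ∈ Finset.Ico j N, sqNormIncrement he P Φ k j

theorem stronglyMeasurable_sqNormIncrement (he : ∀ i, Measurable (e i)) (k j : ℕ) :
    StronglyMeasurable[pastFiltration e he (j + 1)] (sqNormIncrement he P Φ k j) :=
  stronglyMeasurable_condExp.sub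
    (stronglyMeasurable_condExp.mono ((pastFiltration e he).mono j.le_succ))

theorem integrable_sqNormIncrement (he : ∀ i, Measurable (e i)) (k j : ℕ) :
    Integrable (sqNormIncrement he P Φ k j) P :=
  integrable_condExp.sub integrable_condExp

variable [IsFiniteMeasure P]

theorem condExp_sqNormIncrement (he : ∀ i, Measurable (e i)) (k j : ℕ) :
    P[sqNormIncrement he P Φ k j | pastFiltration e he j] =ᵐ[P] 0 := by
  set X : Ω → ℝ := fun ω => ‖Φ k (e · ω)‖ ^ 2
  set 𝓕 := pastFiltration e he
  have htower : P[P[X | 𝓕 (j + 1)] | 𝓕 j] =ᵐ[P] P[X | 𝓕 j] :=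
    condExp_condExp_of_le (𝓕.mono j.le_succ) (𝓕.le _)
  refine (condExp_congr_ae (EventuallyEq.rfl.sub htower.symm)).trans ?_
  exact condExp_sub_condExp (𝓕.le j) integrable_condExp

theorem condExp_sumSqNormIncrement (he : ∀ i, Measurable (e i)) (N j : ℕ) :
    P[sumSqNormIncrement he P Φ N j | pastFiltration e he j] =ᵐ[P] 0 := by
  refine (condExp_finsetSum (fun k _ => integrable_sqNormIncrement he k j) _).trans ?_
  filter_upwards [ae_all_iff.2 fun k => condExp_sqNormIncrement (P := P) (Φ := Φ) he k j] with ω hω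
  simp only [Finset.sum_apply, hω, Pi.zero_apply, Finset.sum_const_zero]

end Increments

section StrongLaw

variable {Ω E F : Type*} {mΩ : MeasurableSpace Ω} {P : Measure Ω}
  [NormedAddCommGroup E] [MeasurableSpace E] [NormedAddCommGroup F] [MeasurableSpace F]

/-- A process `Φ_k(e_0, e_1, …)` of functionals of the noise with exponentially forgetting
sensitivity in mean square: replacing the noise at time `j ≤ k` by an independent copy (with the
earlier noise fixed and the later noise averaged out) changes `Φ_k` by `O(λ^{k-j} (1 + ‖e_j‖))`;
the mean square sizes of `Φ_k` are at most `β_k`, where the Cesàro means of `β_k²` converge. -/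
structure IsForgetting (e : ℕ → Ω → E) (P : Measure Ω) (Φ : ℕ → (ℕ → E) → F) (C lam : ℝ)
    (β : ℕ → ℝ) : Prop where
  const_nonneg : 0 ≤ C
  rate_nonneg : 0 ≤ lam
  rate_lt_one : lam < 1
  measurable : ∀ k, Measurable (Φ k)
  causal : ∀ k (w w' : ℕ → E), (∀ i ≤ k, w i = w' i) → Φ k w = Φ k w'
  forget : ∀ (w : ℕ → E) (j k : ℕ), j ≤ k →
    eLpNorm (fun ω => Φ k (splice (j + 1) w (e · ω)) - Φ k (splice j w (e · ω))) 2 P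
      ≤ ENNReal.ofReal (C * lam ^ (k - j) * (1 + ‖w j‖))
  size_nonneg : ∀ k, 0 ≤ β k
  size_le : ∀ k, eLpNorm (fun ω => Φ k (e · ω)) 2 P ≤ ENNReal.ofReal (β k)
  cesaroConvergent : CesaroConvergent fun k => β k ^ 2

variable {e : ℕ → Ω → E} {Φ : ℕ → (ℕ → E) → F} {C lam : ℝ} {β : ℕ → ℝ}

section PredictableBound

/-- The predictable part of the bound on the martingale increment at time `j` of
`∑_{k < N} ‖Φ_k‖²`. -/
noncomputable def predictableBound (e : ℕ → Ω → E) (lam : ℝ) (β : ℕ → ℝ) (N j : ℕ) (ω : Ω) : ℝ :=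
  futureSum lam β N j + pastSum lam (fun i => 1 + ‖e i ω‖) j

theorem stronglyMeasurable_predictableBound [BorelSpace E] (he : ∀ i, Measurable (e i)) (N j : ℕ) :
    StronglyMeasurable[pastFiltration e he j] (predictableBound e lam β N j) :=
  stronglyMeasurable_const.add (Finset.stronglyMeasurable_fun_sum _ fun _ hi =>
    (((measurable_norm.comp (measurable_pastFiltration he (Finset.mem_range.1 hi))).const_add
      1).const_mul _).stronglyMeasurable)

variable {ξ : ℕ → Ω → ℝ} {𝓕 : Filtration ℕ mΩ}

theorem IsAmplitude.memLp_pastSum (h : IsAmplitude ξ 𝓕 P) (lam : ℝ) (j : ℕ) :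
    MemLp (fun ω => pastSum lam (ξ · ω) j) 2 P :=
  memLp_finsetSum _ fun i _ => (h.memLp i).const_mul _

theorem IsAmplitude.integral_sq_pastSum_le (h : IsAmplitude ξ 𝓕 P) (h0 : 0 ≤ lam) (h1 : lam < 1)
    (j : ℕ) :
    ∫ ω, pastSum lam (ξ · ω) j ^ 2 ∂P ≤ (1 - lam)⁻¹ ^ 2 * ∫ ω, ξ 0 ω ^ 2 ∂P := by
  have hterm (i : ℕ) : Integrable (fun ω => lam ^ (j - i) * ξ i ω ^ 2) P :=
    (h.memLp i).integrable_sq.const_mul _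
  have hξ0 (i : ℕ) (ω : Ω) : 0 ≤ ξ i ω := zero_le_one.trans (h.one_le i ω)
  calc ∫ ω, pastSum lam (ξ · ω) j ^ 2 ∂P
      ≤ ∫ ω, (1 - lam)⁻¹ * geomFilter lam (fun i => ξ i ω ^ 2) j ∂P :=
        integral_mono (h.memLp_pastSum lam j).integrable_sq
          ((integrable_finsetSum _ fun i _ => hterm i).const_mul _) fun ω =>
          (pow_le_pow_left₀ (pastSum_nonneg h0 (hξ0 · ω) j)
            (pastSum_le_geomFilter h0 (hξ0 · ω) j) 2).trans (sq_geomFilter_le h0 h1 _ j)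
    _ = (1 - lam)⁻¹ * (geomFilter lam (fun _ => 1) j * ∫ ω, ξ 0 ω ^ 2 ∂P) := by
        simp only [integral_const_mul, geomFilter]
        rw [integral_finsetSum _ fun i _ => hterm i, Finset.sum_mul]
        simp only [integral_const_mul, mul_one,
          fun i => h.integral_comp i (g := fun x => x ^ 2) (measurable_id.pow_const 2)]
    _ ≤ (1 - lam)⁻¹ * ((1 - lam)⁻¹ * ∫ ω, ξ 0 ω ^ 2 ∂P) := by
        have : 0 ≤ ∫ ω, ξ 0 ω ^ 2 ∂P := integral_nonneg fun ω => sq_nonneg _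
        have : 0 ≤ (1 - lam)⁻¹ := inv_nonneg.2 (sub_nonneg.2 h1.le)
        gcongr
        exact geomFilter_one_le h0 h1 j
    _ = _ := by ring

variable [BorelSpace E] [IsProbabilityMeasure P]

theorem memLp_predictableBound (he : IsL2Noise e P) (lam : ℝ) (β : ℕ → ℝ) (N j : ℕ) :
    MemLp (predictableBound e lam β N j) 2 P :=
  MemLp.add (f := fun _ => futureSum lam β N j) (memLp_const _)
    (he.isAmplitude_one_add_norm.memLp_pastSum lam j)

theorem integral_sq_predictableBound_le (he : IsL2Noise e P) (h0 : 0 ≤ lam) (h1 : lam < 1)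
    (β : ℕ → ℝ) (N j : ℕ) :
    ∫ ω, predictableBound e lam β N j ω ^ 2 ∂P
      ≤ 2 * futureSum lam β N j ^ 2
        + 2 * ((1 - lam)⁻¹ ^ 2 * ∫ ω, (1 + ‖e 0 ω‖) ^ 2 ∂P) := by
  have hpast := (he.isAmplitude_one_add_norm.memLp_pastSum lam j).integrable_sq.const_mul 2
  have hmono := integral_mono (memLp_predictableBound he lam β N j).integrable_sq
    ((integrable_const _).add hpast) fun ω => (add_sq_le.trans_eq (mul_add ..))
  simp only [Pi.add_apply] at hmono
  rw [integral_add (integrable_const _) hpast, integral_const, probReal_univ, one_smul,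
    integral_const_mul] at hmono
  linarith [he.isAmplitude_one_add_norm.integral_sq_pastSum_le h0 h1 j]

theorem sum_integral_sq_predictableBound_le {K : ℝ} (he : IsL2Noise e P) (h0 : 0 ≤ lam)
    (h1 : lam < 1) (hK : ∀ N : ℕ, ∑ k ∈ Finset.range N, β k ^ 2 ≤ K * N) (N : ℕ) :
    ∑ j ∈ Finset.range N, ∫ ω, predictableBound e lam β N j ω ^ 2 ∂P
      ≤ 2 * (1 - lam)⁻¹ ^ 2 * (K + ∫ ω, (1 + ‖e 0 ω‖) ^ 2 ∂P) * N := by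
  have hfuture := (sum_futureSum_sq_le h0 h1 β N).trans
    (mul_le_mul_of_nonneg_left (hK N) (sq_nonneg _))
  calc ∑ j ∈ Finset.range N, ∫ ω, predictableBound e lam β N j ω ^ 2 ∂P
      ≤ ∑ j ∈ Finset.range N, (2 * futureSum lam β N j ^ 2
          + 2 * ((1 - lam)⁻¹ ^ 2 * ∫ ω, (1 + ‖e 0 ω‖) ^ 2 ∂P)) :=
        Finset.sum_le_sum fun j _ => integral_sq_predictableBound_le he h0 h1 β N j
    _ = 2 * ∑ j ∈ Finset.range N, futureSum lam β N j ^ 2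
          + N * (2 * ((1 - lam)⁻¹ ^ 2 * ∫ ω, (1 + ‖e 0 ω‖) ^ 2 ∂P)) := by
        rw [Finset.sum_add_distrib, ← Finset.mul_sum, Finset.sum_const, Finset.card_range,
          nsmul_eq_mul]
    _ ≤ _ := by linarith

theorem ae_exists_sum_predictableBound_le {K : ℝ} (he : IsL2Noise e P) (h0 : 0 ≤ lam)
    (h1 : lam < 1) (hβ : ∀ k, 0 ≤ β k)
    (hK : ∀ N : ℕ, ∑ k ∈ Finset.range N, β k ^ 2 ≤ K * N) :
    ∀ᵐ ω ∂P, ∃ K', ∀ N : ℕ, ∑ j ∈ Finset.range N, predictableBound e lam β N j ω ≤ K' * N := by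
  filter_upwards [he.isAmplitude_one_add_norm.ae_exists_sum_le] with ω ⟨K', _, hK'⟩
  refine ⟨(1 - lam)⁻¹ * (1 + K) + (1 - lam)⁻¹ * K', fun N => ?_⟩
  have hpast := (sum_pastSum_le h0 h1 (fun i => by positivity) N).trans
    (mul_le_mul_of_nonneg_left (hK' N) (inv_nonneg.2 (sub_nonneg.2 h1.le)))
  simp only [predictableBound, Finset.sum_add_distrib]
  linarith [sum_futureSum_le h0 h1 hβ hK N]

end PredictableBound

namespace IsForgetting

theorem memLp [BorelSpace F] [SecondCountableTopology F] (h : IsForgetting e P Φ C lam β)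
    (he : ∀ i, Measurable (e i)) (k : ℕ) : MemLp (fun ω => Φ k (e · ω)) 2 P :=
  ⟨((h.measurable k).comp (measurable_pi_lambda _ he)).aestronglyMeasurable,
    (h.size_le k).trans_lt ENNReal.ofReal_lt_top⟩

theorem exists_sum_sq_le (h : IsForgetting e P Φ C lam β) :
    ∃ K, 0 ≤ K ∧ ∀ N : ℕ, ∑ k ∈ Finset.range N, β k ^ 2 ≤ K * N := by
  obtain ⟨K, hK0, hK⟩ := h.cesaroConvergent.exists_abs_sum_le
  exact ⟨K, hK0, fun N => (le_abs_self _).trans (hK N)⟩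

variable [BorelSpace F] [SecondCountableTopology F]

theorem aestronglyMeasurable_splice (h : IsForgetting e P Φ C lam β) (he : ∀ i, Measurable (e i))
    (k j : ℕ) (w : ℕ → E) : AEStronglyMeasurable (fun ω => Φ k (splice j w (e · ω))) P :=
  ((h.measurable k).comp
    ((measurable_splice j w).comp (measurable_pi_lambda _ he))).aestronglyMeasurable

theorem eLpNorm_splice_le_add_sum (h : IsForgetting e P Φ C lam β) (he : ∀ i, Measurable (e i))
    (w : ℕ → E) {j k : ℕ} (hjk : j ≤ k) :
    eLpNorm (fun ω => Φ k (splice j w (e · ω))) 2 P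
      ≤ ENNReal.ofReal (β k + ∑ i ∈ Finset.range j, C * lam ^ (k - i) * (1 + ‖w i‖)) := by
  have hterm (i : ℕ) : 0 ≤ C * lam ^ (k - i) * (1 + ‖w i‖) :=
    mul_nonneg (mul_nonneg h.const_nonneg (pow_nonneg h.rate_nonneg _)) (by positivity)
  induction j with
  | zero => simpa only [splice_zero, Finset.sum_range_zero, add_zero] using h.size_le k
  | succ j ih =>
    have hj := h.aestronglyMeasurable_splice he k j w
    have hsucc := h.aestronglyMeasurable_splice he k (j + 1) w
    have hsplit := eLpNorm_add_le hj (hsucc.sub hj) one_le_two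
    rw [add_sub_cancel] at hsplit
    refine (hsplit.trans (add_le_add (ih (by omega)) (h.forget w j k (by omega)))).trans_eq ?_
    rw [← ENNReal.ofReal_add (add_nonneg (h.size_nonneg k) (Finset.sum_nonneg fun i _ => hterm i))
      (hterm j), Finset.sum_range_succ, add_assoc]

theorem eLpNorm_splice_le (h : IsForgetting e P Φ C lam β) (he : ∀ i, Measurable (e i))
    (w : ℕ → E) {j k : ℕ} (hjk : j ≤ k) :
    eLpNorm (fun ω => Φ k (splice j w (e · ω))) 2 P
      ≤ ENNReal.ofReal (β k + C * pastSum lam (fun i => 1 + ‖w i‖) j) := by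
  refine (h.eLpNorm_splice_le_add_sum he w hjk).trans
    (ENNReal.ofReal_le_ofReal (add_le_add_right ?_ _))
  rw [pastSum, Finset.mul_sum]
  refine Finset.sum_le_sum fun i _ => ?_
  rw [mul_assoc]
  exact mul_le_mul_of_nonneg_left (mul_le_mul_of_nonneg_right
    (pow_le_pow_of_le_one h.rate_nonneg h.rate_lt_one.le (by omega)) (by positivity))
    h.const_nonneg

section MartingaleDecomposition

variable [IsProbabilityMeasure P] [StandardBorelSpace E]

theorem condExp_norm_sq (h : IsForgetting e P Φ C lam β) (he : ∀ i, Measurable (e i))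
    (hi : iIndepFun e P) (k j : ℕ) :
    P[fun ω => ‖Φ k (e · ω)‖ ^ 2 | pastFiltration e he j]
      =ᵐ[P] fun ω => ∫ ω', ‖Φ k (splice j (e · ω) (e · ω'))‖ ^ 2 ∂P :=
  condExp_pastFiltration he hi j (G := fun w => ‖Φ k w‖ ^ 2)
    ((h.measurable k).norm.pow_const 2) (h.memLp he k).integrable_norm_pow'

theorem ae_abs_sqNormIncrement_le (h : IsForgetting e P Φ C lam β) (he : ∀ i, Measurable (e i))
    (hi : iIndepFun e P) {j k : ℕ} (hjk : j ≤ k) :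
    ∀ᵐ ω ∂P, |sqNormIncrement he P Φ k j ω|
      ≤ C * lam ^ (k - j) * (1 + ‖e j ω‖) * (C * lam ^ (k - j) * (1 + ‖e j ω‖)
        + 2 * (β k + C * pastSum lam (fun i => 1 + ‖e i ω‖) j)) := by
  filter_upwards [h.condExp_norm_sq he hi k (j + 1), h.condExp_norm_sq he hi k j]
    with ω hsucc hj
  have hpast : 0 ≤ pastSum lam (fun i => 1 + ‖e i ω‖) j :=
    pastSum_nonneg h.rate_nonneg (fun i => by positivity) j
  rw [sqNormIncrement, Pi.sub_apply, hsucc, hj]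
  exact abs_integral_norm_sq_sub_le (h.aestronglyMeasurable_splice he k (j + 1) _)
    (h.aestronglyMeasurable_splice he k j _)
    (mul_nonneg (mul_nonneg h.const_nonneg (pow_nonneg h.rate_nonneg _)) (by positivity))
    (add_nonneg (h.size_nonneg k) (mul_nonneg h.const_nonneg hpast))
    (h.forget (e · ω) j k hjk) (h.eLpNorm_splice_le he _ hjk)

theorem ae_sum_sqNormIncrement (h : IsForgetting e P Φ C lam β) (he : ∀ i, Measurable (e i))
    (hi : iIndepFun e P) :
    ∀ᵐ ω ∂P, ∀ k, ∑ j ∈ Finset.range (k + 1), sqNormIncrement he P Φ k j ω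
      = ‖Φ k (e · ω)‖ ^ 2 - ∫ ω', ‖Φ k (e · ω')‖ ^ 2 ∂P := by
  refine ae_all_iff.2 fun k => ?_
  filter_upwards [h.condExp_norm_sq he hi k (k + 1), h.condExp_norm_sq he hi k 0]
    with ω hlast hzero
  have hcausal (ω' : Ω) : Φ k (splice (k + 1) (e · ω) (e · ω')) = Φ k (e · ω) :=
    h.causal k _ _ fun i hik => splice_of_lt (Nat.lt_succ_of_le hik) _ _
  simp only [sqNormIncrement, Pi.sub_apply]
  rw [Finset.sum_range_sub fun j =>
    (P[fun ω => ‖Φ k (e · ω)‖ ^ 2 | pastFiltration e he j]) ω, hlast, hzero]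
  simp only [hcausal, integral_const, probReal_univ, one_smul, splice_zero]

theorem isDominatedIncrement_sumSqNormIncrement [BorelSpace E] (h : IsForgetting e P Φ C lam β)
    (he : IsL2Noise e P) (N j : ℕ) :
    IsDominatedIncrement (fun i ω => 1 + ‖e i ω‖) (pastFiltration e he.measurable) P
      (C * (2 + 2 * C * (1 - lam)⁻¹)) j (sumSqNormIncrement he.measurable P Φ N j)
      (predictableBound e lam β N j) where
  stronglyMeasurable :=
    Finset.stronglyMeasurable_sum _ fun k _ => stronglyMeasurable_sqNormIncrement _ k j
  integrable := integrable_finsetSum' _ fun k _ => integrable_sqNormIncrement _ k j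
  condExp_eq_zero := condExp_sumSqNormIncrement _ N j
  bound_stronglyMeasurable := stronglyMeasurable_predictableBound _ N j
  bound_nonneg _ := add_nonneg (futureSum_nonneg h.rate_nonneg h.size_nonneg N j)
    (pastSum_nonneg h.rate_nonneg (fun i => by positivity) j)
  bound_memLp := memLp_predictableBound he lam β N j
  abs_le := by
    have hterms : ∀ᵐ ω ∂P, ∀ k, j ≤ k → |sqNormIncrement he.measurable P Φ k j ω|
        ≤ C * lam ^ (k - j) * (1 + ‖e j ω‖) * (C * lam ^ (k - j) * (1 + ‖e j ω‖)
          + 2 * (β k + C * pastSum lam (fun i => 1 + ‖e i ω‖) j)) :=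
      ae_all_iff.2 fun k => eventually_imp_distrib_left.2 fun hjk =>
        h.ae_abs_sqNormIncrement_le he.measurable he.iIndepFun hjk
    filter_upwards [hterms] with ω hω
    rw [sumSqNormIncrement, Finset.sum_apply]
    exact abs_sum_Ico_le_of_abs_le h.rate_nonneg h.rate_lt_one h.const_nonneg h.size_nonneg
      (by positivity) (pastSum_nonneg h.rate_nonneg (fun i => by positivity) j) hω N

end MartingaleDecomposition

variable [IsProbabilityMeasure P] [StandardBorelSpace E] [BorelSpace E]

theorem ae_tendsto_floor_pow (h : IsForgetting e P Φ C lam β) (he : IsL2Noise e P) {c : ℝ}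
    (hc : 1 < c) :
    ∀ᵐ ω ∂P, Tendsto (fun n : ℕ => (⌊c ^ n⌋₊ : ℝ)⁻¹ * ∑ k ∈ Finset.range ⌊c ^ n⌋₊,
      (‖Φ k (e · ω)‖ ^ 2 - ∫ ω', ‖Φ k (e · ω')‖ ^ 2 ∂P)) atTop (𝓝 0) := by
  obtain ⟨K, _, hK⟩ := h.exists_sum_sq_le
  have hL : 0 ≤ (1 - lam)⁻¹ := inv_nonneg.2 (sub_nonneg.2 h.rate_lt_one.le)
  have hconst : 0 ≤ C * (2 + 2 * C * (1 - lam)⁻¹) := by have := h.const_nonneg; positivity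
  filter_upwards [he.isAmplitude_one_add_norm.tendsto_array hconst
      (h.isDominatedIncrement_sumSqNormIncrement he)
      (sum_integral_sq_predictableBound_le he h.rate_nonneg h.rate_lt_one hK)
      (ae_exists_sum_predictableBound_le he h.rate_nonneg h.rate_lt_one h.size_nonneg hK) hc,
    h.ae_sum_sqNormIncrement he.measurable he.iIndepFun] with ω hω hsum
  refine hω.congr fun n => ?_
  simp_rw [← hsum, sumSqNormIncrement, Finset.sum_apply]
  congr 1
  exact Finset.sum_comm' fun j k => by simp only [Finset.mem_range, Finset.mem_Ico]; omega

/-- Adding `∑ β_k²` makes the partial sums monotone, which fills the gaps between the times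
`⌊c ^ n⌋₊`. -/
theorem ae_tendsto_mean_norm_sq_sub (h : IsForgetting e P Φ C lam β) (he : IsL2Noise e P) :
    ∀ᵐ ω ∂P, Tendsto (fun N : ℕ => (N : ℝ)⁻¹ * ∑ k ∈ Finset.range N,
      (‖Φ k (e · ω)‖ ^ 2 - ∫ ω', ‖Φ k (e · ω')‖ ^ 2 ∂P)) atTop (𝓝 0) := by
  obtain ⟨l, hl⟩ := h.cesaroConvergent
  let c (m : ℕ) : ℝ := 1 + 1 / ((m : ℝ) + 1)
  have hc1 (m : ℕ) : 1 < c m := lt_add_of_pos_right _ (by positivity)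
  have hc : Tendsto c atTop (𝓝 1) := by
    simpa only [add_zero] using (tendsto_one_div_add_atTop_nhds_zero_nat (𝕜 := ℝ)).const_add 1
  filter_upwards [ae_all_iff.2 fun m => h.ae_tendsto_floor_pow he (hc1 m)] with ω hω
  let D (N : ℕ) : ℝ := ∑ k ∈ Finset.range N,
    (‖Φ k (e · ω)‖ ^ 2 - ∫ ω', ‖Φ k (e · ω')‖ ^ 2 ∂P)
  let B (N : ℕ) : ℝ := ∑ k ∈ Finset.range N, β k ^ 2
  have hmono : Monotone fun N => D N + B N := by
    refine monotone_nat_of_le_succ fun N => ?_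
    have hsize := integral_norm_sq_le (h.memLp he.measurable N).1 (h.size_nonneg N) (h.size_le N)
    simp only [D, B, Finset.sum_range_succ]
    linarith [sq_nonneg ‖Φ N (e · ω)‖]
  have hDB : Tendsto (fun N : ℕ => (D N + B N) / N) atTop (𝓝 l) := by
    refine tendsto_div_of_monotone_of_tendsto_div_floor_pow _ l hmono c hc1 hc fun m => ?_
    have hfloor : Tendsto (fun n : ℕ => ⌊c m ^ n⌋₊) atTop atTop :=
      tendsto_nat_floor_atTop.comp (tendsto_pow_atTop_atTop_of_one_lt (hc1 m))
    have hsum := (hω m).add (hl.comp hfloor)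
    rw [zero_add] at hsum
    exact hsum.congr fun n => by rw [Function.comp_apply, ← mul_add, div_eq_inv_mul]
  rw [← sub_self l]
  exact (hDB.sub hl).congr fun N => by rw [div_eq_inv_mul, mul_add, add_sub_cancel_right]

end IsForgetting

end StrongLaw

/-- Two-sided signals with values in `ℝⁿ`. -/
abbrev Signal (n : ℕ) : Type := ℤ → EuclideanSpace ℝ (Fin n)

/-- A noise sequence indexed by the natural numbers, seen as a two-sided sequence; its (irrelevant)
values at negative times are `w 0`. -/
def extendNoise {E : Type*} (w : ℕ → E) : ℤ → E := fun i => w i.toNat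

theorem extendNoise_natCast {E : Type*} (w : ℕ → E) (k : ℕ) : extendNoise w k = w k := rfl

variable {na nb ny nu : ℕ}

section Regressors

theorem regressor_congr {y y' : Signal ny} {u : Signal nu} {k : ℤ}
    (h : ∀ i, k - na ≤ i → i < k → y i = y' i) :
    regressor na nb y u k = regressor na nb y' u k := by
  ext (⟨i, c⟩ | ⟨i, c⟩)
  · simp only [regressor, Sum.elim_inl]
    rw [h _ (by have := i.isLt; omega) (by omega)]
  · rfl

theorem nextRegressor_regressor (y : Signal ny) (u : Signal nu) (k : ℤ) :
    nextRegressor (regressor na nb y u k) (y k) (u (k + 1)) = regressor na nb y u (k + 1) := by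
  ext (⟨i, c⟩ | ⟨i, c⟩)
  · simp only [nextRegressor, regressor, Sum.elim_inl]
    split_ifs with hi
    · simp [hi]
    · rw [show k - 1 - ((i.val - 1 : ℕ) : ℤ) = k + 1 - 1 - (i.val : ℤ) by omega]
  · simp only [nextRegressor, regressor, Sum.elim_inr]
    split_ifs with hi
    · simp [hi]
    · rw [show k - ((i.val - 1 : ℕ) : ℤ) = k + 1 - (i.val : ℤ) by omega]

theorem nextRegressor_sub (x x' : Regressor na nb ny nu) (a a' : EuclideanSpace ℝ (Fin ny))
    (v v' : EuclideanSpace ℝ (Fin nu)) :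
    nextRegressor x a v - nextRegressor x' a' v'
      = nextRegressor (x - x') (a - a') (v - v') := by
  ext (⟨i, c⟩ | ⟨i, c⟩) <;> simp only [nextRegressor, PiLp.sub_apply, Sum.elim_inl,
    Sum.elim_inr] <;> split_ifs <;> rfl

theorem sum_sq_ite_fst_val_eq_zero_le (n : ℕ) {ι : Type*} [Fintype ι] (a : ι → ℝ) :
    ∑ i : Fin n × ι, (if i.1.val = 0 then a i.2 else 0) ^ 2 ≤ ∑ c, a c ^ 2 := by
  rw [Fintype.sum_prod_type_right]
  refine Finset.sum_le_sum fun c _ => ?_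
  cases n with
  | zero => simpa using sq_nonneg (a c)
  | succ n => simp

theorem norm_nextRegressor_zero_le (a : EuclideanSpace ℝ (Fin ny))
    (v : EuclideanSpace ℝ (Fin nu)) :
    ‖nextRegressor (0 : Regressor na nb ny nu) a v‖ ≤ ‖a‖ + ‖v‖ := by
  refine le_of_sq_le_sq (a := ‖nextRegressor (0 : Regressor na nb ny nu) a v‖) ?_ (by positivity)
  calc ‖nextRegressor (0 : Regressor na nb ny nu) a v‖ ^ 2 ≤ ‖a‖ ^ 2 + ‖v‖ ^ 2 := by
        simp only [EuclideanSpace.real_norm_sq_eq, Fintype.sum_sum_type]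
        exact add_le_add (sum_sq_ite_fst_val_eq_zero_le na a.ofLp)
          (sum_sq_ite_fst_val_eq_zero_le (nb + 1) v.ofLp)
    _ ≤ (‖a‖ + ‖v‖) ^ 2 := by linarith [mul_nonneg (norm_nonneg a) (norm_nonneg v)]

theorem norm_nextRegressor_sub_le (x : Regressor na nb ny nu) (a b : EuclideanSpace ℝ (Fin ny))
    (v v' : EuclideanSpace ℝ (Fin nu)) :
    ‖nextRegressor x a v - nextRegressor x b v'‖ ≤ ‖a - b‖ + ‖v - v'‖ := by
  rw [nextRegressor_sub, sub_self]
  exact norm_nextRegressor_zero_le _ _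

theorem measurable_nextRegressor :
    Measurable fun p : Regressor na nb ny nu × EuclideanSpace ℝ (Fin ny) ×
      EuclideanSpace ℝ (Fin nu) => nextRegressor p.1 p.2.1 p.2.2 := by
  refine (WithLp.measurable_toLp 2 _).comp (measurable_pi_lambda _ ?_)
  rintro (⟨i, c⟩ | ⟨i, c⟩) <;> simp only [Sum.elim_inl, Sum.elim_inr] <;> split_ifs <;> fun_prop

end Regressors

section Trajectories

variable {f : Regressor na nb ny nu → EuclideanSpace ℝ (Fin ny)} {u : Signal nu}
  {e e' : Signal ny}

theorem stateFrom_congr {k₀ : ℕ} {x₀ : Regressor na nb ny nu} {m : ℕ}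
    (h : ∀ i < m, e (k₀ + i : ℤ) = e' (k₀ + i : ℤ)) :
    stateFrom f u e k₀ x₀ m = stateFrom f u e' k₀ x₀ m := by
  induction m with
  | zero => rfl
  | succ m ih => rw [stateFrom, stateFrom, ih fun i hi => h i (by omega), h m m.lt_succ_self]

theorem outputFrom_congr {k₀ : ℕ} {x₀ : Regressor na nb ny nu} {m : ℕ}
    (h : ∀ i ≤ m, e (k₀ + i : ℤ) = e' (k₀ + i : ℤ)) :
    outputFrom f u e k₀ x₀ m = outputFrom f u e' k₀ x₀ m := by
  rw [outputFrom, outputFrom, stateFrom_congr fun i hi => h i hi.le, h m le_rfl]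

theorem stateFrom_add (k₀ a : ℕ) (x₀ : Regressor na nb ny nu) (m : ℕ) :
    stateFrom f u e k₀ x₀ (a + m) = stateFrom f u e (k₀ + a) (stateFrom f u e k₀ x₀ a) m := by
  induction m with
  | zero => rfl
  | succ m ih =>
    rw [← add_assoc, stateFrom, stateFrom, ih]
    push_cast
    simp only [add_assoc]

theorem outputFrom_add (k₀ a : ℕ) (x₀ : Regressor na nb ny nu) (m : ℕ) :
    outputFrom f u e k₀ x₀ (a + m) = outputFrom f u e (k₀ + a) (stateFrom f u e k₀ x₀ a) m := by
  rw [outputFrom, outputFrom, stateFrom_add]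
  push_cast
  rw [add_assoc (k₀ : ℤ)]

theorem outputFrom_succ (k₀ : ℕ) (x₀ : Regressor na nb ny nu) (m : ℕ) :
    outputFrom f u e k₀ x₀ (m + 1)
      = outputFrom f u e (k₀ + 1) (nextRegressor x₀ (f x₀ + e k₀) (u (k₀ + 1))) m := by
  rw [add_comm m 1, outputFrom_add]
  simp [stateFrom]

theorem simulate_natCast (y₀ : Signal ny) (k : ℕ) :
    simulate f u e y₀ k = outputFrom f u e 0 (regressor na nb y₀ u 0) k := by
  simp [simulate]

theorem simulate_of_neg (y₀ : Signal ny) {k : ℤ} (hk : k < 0) : simulate f u e y₀ k = y₀ k :=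
  if_pos hk

theorem simulate_congr {y₀ : Signal ny} {k : ℤ} (h : ∀ i : ℕ, (i : ℤ) ≤ k → e i = e' i) :
    simulate f u e y₀ k = simulate f u e' y₀ k := by
  rcases lt_or_ge k 0 with hk | hk
  · rw [simulate_of_neg _ hk, simulate_of_neg _ hk]
  · lift k to ℕ using hk
    rw [simulate_natCast, simulate_natCast]
    exact outputFrom_congr fun i hi => by simpa using h i (by exact_mod_cast hi)

theorem simulate_congr_initial {y₀ y₁ : Signal ny}
    (h : ∀ i, -(na : ℤ) ≤ i → i < 0 → y₀ i = y₁ i) {k : ℤ} (hk : -(na : ℤ) ≤ k) :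
    simulate f u e y₀ k = simulate f u e y₁ k := by
  rcases lt_or_ge k 0 with hneg | hnonneg
  · rw [simulate_of_neg _ hneg, simulate_of_neg _ hneg, h k hk hneg]
  · lift k to ℕ using hnonneg
    rw [simulate_natCast, simulate_natCast,
      regressor_congr fun i hi hi0 => h i (by simpa using hi) hi0]

theorem simulate_eq_self {y : Signal ny}
    (h : ∀ k : ℤ, 0 ≤ k → y k = f (regressor na nb y u k) + e k) (k : ℤ) :
    simulate f u e y k = y k := by
  have hstate (m : ℕ) : stateFrom f u e 0 (regressor na nb y u 0) m = regressor na nb y u m := by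
    induction m with
    | zero => rfl
    | succ m ih =>
      rw [stateFrom, ih]
      simp only [Nat.cast_zero, zero_add]
      rw [← h m m.cast_nonneg, nextRegressor_regressor, Nat.cast_succ]
  rcases lt_or_ge k 0 with hk | hk
  · exact simulate_of_neg _ hk
  · lift k to ℕ using hk
    rw [simulate_natCast, outputFrom, hstate, h k k.cast_nonneg, Nat.cast_zero, zero_add]

end Trajectories

section Measurability

variable {α : Type*} [MeasurableSpace α] {f : Regressor na nb ny nu → EuclideanSpace ℝ (Fin ny)}
  {u : ℤ → α → EuclideanSpace ℝ (Fin nu)} {e y : ℤ → α → EuclideanSpace ℝ (Fin ny)}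

theorem measurable_regressor (hy : ∀ k, Measurable (y k)) (hu : ∀ k, Measurable (u k)) (k : ℤ) :
    Measurable fun a => regressor na nb (y · a) (u · a) k := by
  refine (WithLp.measurable_toLp 2 _).comp (measurable_pi_lambda _ ?_)
  rintro (⟨i, c⟩ | ⟨i, c⟩) <;> simp only [Sum.elim_inl, Sum.elim_inr] <;> fun_prop

theorem measurable_stateFrom (hf : Measurable f) (hu : ∀ k, Measurable (u k))
    (he : ∀ k, Measurable (e k)) {x : α → Regressor na nb ny nu} (hx : Measurable x) (k₀ m : ℕ) :
    Measurable fun a => stateFrom f (u · a) (e · a) k₀ (x a) m := by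
  induction m with
  | zero => exact hx
  | succ m ih =>
    exact measurable_nextRegressor.comp (ih.prodMk (((hf.comp ih).add (he _)).prodMk (hu _)))

theorem measurable_outputFrom (hf : Measurable f) (hu : ∀ k, Measurable (u k))
    (he : ∀ k, Measurable (e k)) {x : α → Regressor na nb ny nu} (hx : Measurable x) (k₀ m : ℕ) :
    Measurable fun a => outputFrom f (u · a) (e · a) k₀ (x a) m :=
  (hf.comp (measurable_stateFrom hf hu he hx k₀ m)).add (he _)

theorem measurable_simulate (hf : Measurable f) (hu : ∀ k, Measurable (u k))
    (he : ∀ k, Measurable (e k)) (hy : ∀ k, Measurable (y k)) (k : ℤ) :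
    Measurable fun a => simulate f (u · a) (e · a) (y · a) k := by
  rcases lt_or_ge k 0 with hk | hk
  · simpa only [simulate_of_neg _ hk] using hy k
  · lift k to ℕ using hk
    simpa only [simulate_natCast] using
      measurable_outputFrom hf hu he (measurable_regressor hy hu 0) 0 k

end Measurability

section Moments

variable {Ω : Type*} {mΩ : MeasurableSpace Ω} {P : Measure Ω} {F : Type*} [NormedAddCommGroup F]
  {g : Ω → F}

theorem eLpNorm_natCast_le_iff {n : ℕ} (hn : n ≠ 0) {a : ENNReal} :
    eLpNorm g n P ≤ a ↔ ∫⁻ ω, ‖g ω‖ₑ ^ n ∂P ≤ a ^ n := by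
  rw [eLpNorm_eq_lintegral_rpow_enorm_toReal (by simpa using hn) (by simp), ENNReal.toReal_natCast,
    one_div, ENNReal.rpow_inv_le_iff (by positivity)]
  simp only [ENNReal.rpow_natCast]

theorem eLpNorm_two_le_iff {a : ENNReal} :
    eLpNorm g 2 P ≤ a ↔ ∫⁻ ω, ‖g ω‖ₑ ^ 2 ∂P ≤ a ^ 2 :=
  eLpNorm_natCast_le_iff two_ne_zero

variable [IsProbabilityMeasure P]

theorem eLpNorm_two_le_of_lintegral_pow_four_le (hg : AEStronglyMeasurable g P) {a : ℝ}
    (ha : 0 ≤ a) (h : ∫⁻ ω, ‖g ω‖ₑ ^ 4 ∂P ≤ ENNReal.ofReal (a ^ 4)) :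
    eLpNorm g 2 P ≤ ENNReal.ofReal a := by
  rw [ENNReal.ofReal_pow ha] at h
  exact (eLpNorm_le_eLpNorm_of_exponent_le (q := 4) (by norm_num) hg).trans
    ((eLpNorm_natCast_le_iff four_ne_zero).2 h)

theorem eLpNorm_two_const (x : F) : eLpNorm (fun _ : Ω => x) 2 P = ENNReal.ofReal ‖x‖ := by
  rw [eLpNorm_const _ two_ne_zero (IsProbabilityMeasure.ne_zero P)]
  simp

end Moments

section Chaining

variable {X : Type*} [NormedAddCommGroup X] [NormedSpace ℝ X] {d : X → X → ENNReal} {a : ENNReal}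

theorem le_natCast_mul_of_forall_dist_le_one (hself : ∀ x, d x x = 0)
    (htriangle : ∀ x y z, d x z ≤ d x y + d y z) (hlocal : ∀ x y, dist x y ≤ 1 → d x y ≤ a)
    (n : ℕ) {x y : X} (hxy : dist x y ≤ n) : d x y ≤ n * a := by
  induction n generalizing x with
  | zero => simp [dist_le_zero.1 (by simpa using hxy), hself]
  | succ n ih =>
    have hn : (0 : ℝ) < n + 1 := by positivity
    push_cast at hxy
    set z := AffineMap.lineMap x y ((n + 1 : ℝ)⁻¹)
    have hxz : dist x z ≤ 1 := by
      rw [dist_left_lineMap, Real.norm_of_nonneg (by positivity), inv_mul_le_iff₀ hn]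
      linarith
    have hzy : dist z y ≤ n := by
      have : 1 - (n + 1 : ℝ)⁻¹ = (n + 1 : ℝ)⁻¹ * n := by field_simp; ring
      rw [dist_lineMap_right, this, Real.norm_of_nonneg (by positivity), mul_assoc,
        inv_mul_le_iff₀ hn, mul_comm _ (n : ℝ)]
      gcongr
    calc d x y ≤ a + n * a := (htriangle x z y).trans (add_le_add (hlocal x z hxz) (ih hzy))
      _ = (n + 1 : ℕ) * a := by push_cast; ring

theorem le_ofReal_mul_of_forall_dist_le_one (hself : ∀ x, d x x = 0)
    (htriangle : ∀ x y z, d x z ≤ d x y + d y z) (hlocal : ∀ x y, dist x y ≤ 1 → d x y ≤ a)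
    (x y : X) : d x y ≤ ENNReal.ofReal (1 + dist x y) * a := by
  refine (le_natCast_mul_of_forall_dist_le_one hself htriangle hlocal ⌈dist x y⌉₊
    (Nat.le_ceil _)).trans (mul_le_mul_left ?_ _)
  rw [← ENNReal.ofReal_natCast]
  exact ENNReal.ofReal_le_ofReal (by linarith [Nat.ceil_lt_add_one (dist_nonneg (x := x) (y := y))])

end Chaining

variable {Ω : Type*} {mΩ : MeasurableSpace Ω} {P : Measure Ω} {na nb ny nu : ℕ}
  {f : Regressor na nb ny nu → EuclideanSpace ℝ (Fin ny)} {v : Signal nu}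
  {e : ℕ → Ω → EuclideanSpace ℝ (Fin ny)} {C lam : ℝ}

section MeanSquareStability

/-- Exponential stability in mean square of the system driven by the fixed input `v` and the
noise `e`: two trajectories contract at rate `λ`, with a constant growing at most linearly in the
distance of their initial regressors. -/
structure MeanSquareStable (f : Regressor na nb ny nu → EuclideanSpace ℝ (Fin ny))
    (v : Signal nu) (e : ℕ → Ω → EuclideanSpace ℝ (Fin ny)) (P : Measure Ω) (C lam : ℝ) :
    Prop where
  const_nonneg : 0 ≤ C
  rate_nonneg : 0 ≤ lam
  rate_lt_one : lam < 1
  eLpNorm_sub_le : ∀ (k₀ m : ℕ) (x₀ x₁ : Regressor na nb ny nu),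
    eLpNorm (fun ω => outputFrom f v (extendNoise (e · ω)) k₀ x₀ m
      - outputFrom f v (extendNoise (e · ω)) k₀ x₁ m) 2 P
      ≤ ENNReal.ofReal (C * lam ^ m * (1 + ‖x₀ - x₁‖))

theorem MeanSquareStable.mono (h : MeanSquareStable f v e P C lam) {mu : ℝ} (hle : lam ≤ mu)
    (hmu : mu < 1) : MeanSquareStable f v e P C mu where
  const_nonneg := h.const_nonneg
  rate_nonneg := h.rate_nonneg.trans hle
  rate_lt_one := hmu
  eLpNorm_sub_le k₀ m x₀ x₁ := by
    have := h.const_nonneg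
    have := h.rate_nonneg
    exact (h.eLpNorm_sub_le k₀ m x₀ x₁).trans (ENNReal.ofReal_le_ofReal (by gcongr))

theorem measurable_outputFrom_extendNoise (hf : Measurable f) (v : Signal nu)
    (he : ∀ i, Measurable (e i)) {x : Ω → Regressor na nb ny nu} (hx : Measurable x)
    (k₀ m : ℕ) : Measurable fun ω => outputFrom f v (extendNoise (e · ω)) k₀ (x ω) m :=
  measurable_outputFrom (u := fun i _ => v i) (e := fun i ω => extendNoise (e · ω) i) hf
    (fun _ => measurable_const) (fun _ => he _) hx k₀ m

theorem exists_meanSquareStable_of_local [IsProbabilityMeasure P] (hf : Measurable f)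
    (he : ∀ i, Measurable (e i)) (hC : 0 ≤ C) (h0 : 0 ≤ lam) (h1 : lam < 1)
    (hlocal : ∀ (k₀ : ℕ) (x₀ x₁ : Regressor na nb ny nu), ‖x₀ - x₁‖ ≤ 1 → ∀ m : ℕ,
      ∫⁻ ω, ‖outputFrom f v (extendNoise (e · ω)) k₀ x₀ m
          - outputFrom f v (extendNoise (e · ω)) k₀ x₁ m‖ₑ ^ 4 ∂P ≤ ENNReal.ofReal (C * lam ^ m)) :
    ∃ C' lam' : ℝ, MeanSquareStable f v e P C' lam' := by
  have hroot (x : ℝ) (hx : 0 ≤ x) : (x ^ (1 / 4 : ℝ)) ^ 4 = x := by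
    rw [← Real.rpow_natCast, ← Real.rpow_mul hx]; norm_num
  have hc0 : 0 ≤ C ^ (1 / 4 : ℝ) := Real.rpow_nonneg hC _
  have hl0 : 0 ≤ lam ^ (1 / 4 : ℝ) := Real.rpow_nonneg h0 _
  refine ⟨C ^ (1 / 4 : ℝ), lam ^ (1 / 4 : ℝ), hc0, hl0, Real.rpow_lt_one h0 h1 (by norm_num),
    fun k₀ m x₀ x₁ => ?_⟩
  have hmeas (x : Regressor na nb ny nu) :
      AEStronglyMeasurable (fun ω => outputFrom f v (extendNoise (e · ω)) k₀ x m) P :=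
    (measurable_outputFrom_extendNoise hf v he measurable_const k₀ m).aestronglyMeasurable
  rw [mul_comm, ENNReal.ofReal_mul (by positivity), ← dist_eq_norm]
  refine le_ofReal_mul_of_forall_dist_le_one (d := fun x y => eLpNorm (fun ω =>
    outputFrom f v (extendNoise (e · ω)) k₀ x m - outputFrom f v (extendNoise (e · ω)) k₀ y m)
    2 P) (fun x => by simp) (fun x y z => ?_) (fun x y hxy => ?_) x₀ x₁
  · refine (congrArg (eLpNorm · 2 P) (funext fun ω => ?_)).trans_le
      (eLpNorm_add_le ((hmeas x).sub (hmeas y)) ((hmeas y).sub (hmeas z)) one_le_two)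
    exact (sub_add_sub_cancel _ _ _).symm
  · refine eLpNorm_two_le_of_lintegral_pow_four_le ((hmeas x).sub (hmeas y)) (by positivity) ?_
    rw [mul_pow, hroot C hC, pow_right_comm, hroot lam h0]
    exact hlocal k₀ x y (dist_eq_norm x y ▸ hxy) m

end MeanSquareStability

section RandomStart

/-- The root mean square `‖e_0‖_{L²}` of a noise sequence. -/
noncomputable def noiseScale (e : ℕ → Ω → EuclideanSpace ℝ (Fin ny)) (P : Measure Ω) : ℝ :=
  (eLpNorm (e 0) 2 P).toReal

theorem noiseScale_nonneg : 0 ≤ noiseScale e P := ENNReal.toReal_nonneg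

theorem IsL2Noise.eLpNorm_eq (he : IsL2Noise e P) (j : ℕ) :
    eLpNorm (e j) 2 P = ENNReal.ofReal (noiseScale e P) := by
  rw [noiseScale, ENNReal.ofReal_toReal he.memLp_zero.eLpNorm_ne_top,
    (he.identDistrib j).eLpNorm_eq]

variable [IsProbabilityMeasure P]

theorem IsL2Noise.eLpNorm_le_of_norm_le (he : IsL2Noise e P) {F : Type*} [NormedAddCommGroup F]
    {g : Ω → F} {c : ℝ} (hc : 0 ≤ c) {j : ℕ} (hg : ∀ ω, ‖g ω‖ ≤ c + ‖e j ω‖) :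
    eLpNorm g 2 P ≤ ENNReal.ofReal (c + noiseScale e P) := by
  calc eLpNorm g 2 P ≤ eLpNorm ((fun _ => c) + fun ω => ‖e j ω‖) 2 P := eLpNorm_mono_real hg
    _ ≤ eLpNorm (fun _ : Ω => c) 2 P + eLpNorm (fun ω => ‖e j ω‖) 2 P :=
        eLpNorm_add_le aestronglyMeasurable_const
          (he.measurable j).norm.aestronglyMeasurable one_le_two
    _ = ENNReal.ofReal (c + noiseScale e P) := by
        rw [eLpNorm_two_const, eLpNorm_norm, he.eLpNorm_eq, Real.norm_of_nonneg hc,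
          ENNReal.ofReal_add hc noiseScale_nonneg]

theorem outputFrom_splice {j : ℕ} (w w' : ℕ → EuclideanSpace ℝ (Fin ny))
    (x : Regressor na nb ny nu) {k₀ : ℕ} (hj : j ≤ k₀) (m : ℕ) :
    outputFrom f v (extendNoise (splice j w w')) k₀ x m
      = outputFrom f v (extendNoise w') k₀ x m :=
  outputFrom_congr fun i _ => by
    rw [← Nat.cast_add, extendNoise_natCast, extendNoise_natCast, splice_of_le (by omega)]

/-- Given the noise before `k₀` both initial regressors are fixed, and the noise from `k₀` on is
independent of them. -/
theorem MeanSquareStable.eLpNorm_predictable_start_le (h : MeanSquareStable f v e P C lam)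
    (hf : Measurable f) (he : IsL2Noise e P) {k₀ : ℕ}
    {X₀ X₁ : (ℕ → EuclideanSpace ℝ (Fin ny)) → Regressor na nb ny nu} (hX₀ : Measurable X₀)
    (hX₁ : Measurable X₁) (hpast₀ : ∀ w w', X₀ (splice k₀ w w') = X₀ w)
    (hpast₁ : ∀ w w', X₁ (splice k₀ w w') = X₁ w) (m : ℕ) :
    eLpNorm (fun ω => outputFrom f v (extendNoise (e · ω)) k₀ (X₀ (e · ω)) m
        - outputFrom f v (extendNoise (e · ω)) k₀ (X₁ (e · ω)) m) 2 P
      ≤ ENNReal.ofReal (C * lam ^ m)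
        * eLpNorm (fun ω => 1 + ‖X₀ (e · ω) - X₁ (e · ω)‖) 2 P := by
  have hrate : 0 ≤ C * lam ^ m := mul_nonneg h.const_nonneg (pow_nonneg h.rate_nonneg _)
  have hmeas {X : (ℕ → EuclideanSpace ℝ (Fin ny)) → Regressor na nb ny nu} (hX : Measurable X) :
      Measurable fun w => outputFrom f v (extendNoise w) k₀ (X w) m :=
    measurable_outputFrom_extendNoise (e := fun i w => w i) hf v measurable_pi_apply hX k₀ m
  have hdiff : Measurable fun ω => ‖1 + ‖X₀ (e · ω) - X₁ (e · ω)‖‖ₑ ^ 2 :=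
    ((((hX₀.sub hX₁).comp he.measurable_pi).norm.const_add 1).enorm).pow_const 2
  rw [eLpNorm_two_le_iff, mul_pow]
  calc ∫⁻ ω, ‖outputFrom f v (extendNoise (e · ω)) k₀ (X₀ (e · ω)) m
          - outputFrom f v (extendNoise (e · ω)) k₀ (X₁ (e · ω)) m‖ₑ ^ 2 ∂P
      = ∫⁻ ω, ∫⁻ ω', ‖outputFrom f v (extendNoise (e · ω')) k₀ (X₀ (e · ω)) m
          - outputFrom f v (extendNoise (e · ω')) k₀ (X₁ (e · ω)) m‖ₑ ^ 2 ∂P ∂P := by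
        refine (lintegral_eq_lintegral_lintegral_splice he.measurable he.iIndepFun k₀
          (((hmeas hX₀).sub (hmeas hX₁)).enorm.pow_const 2)).trans ?_
        simp only [Pi.sub_apply, hpast₀, hpast₁, outputFrom_splice _ _ _ le_rfl]
    _ ≤ ∫⁻ ω, ENNReal.ofReal (C * lam ^ m) ^ 2
          * ‖1 + ‖X₀ (e · ω) - X₁ (e · ω)‖‖ₑ ^ 2 ∂P := by
        refine lintegral_mono fun ω => ?_
        rw [← mul_pow, ← eLpNorm_two_le_iff, Real.enorm_of_nonneg (by positivity),
          ← ENNReal.ofReal_mul hrate]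
        exact h.eLpNorm_sub_le k₀ m _ _
    _ = ENNReal.ofReal (C * lam ^ m) ^ 2
          * ∫⁻ ω, ‖1 + ‖X₀ (e · ω) - X₁ (e · ω)‖‖ₑ ^ 2 ∂P := lintegral_const_mul _ hdiff
    _ ≤ ENNReal.ofReal (C * lam ^ m) ^ 2
          * eLpNorm (fun ω => 1 + ‖X₀ (e · ω) - X₁ (e · ω)‖) 2 P ^ 2 := by
        gcongr
        exact eLpNorm_two_le_iff.1 le_rfl

theorem MeanSquareStable.eLpNorm_start_le (h : MeanSquareStable f v e P C lam)
    (hf : Measurable f) (he : IsL2Noise e P) {j : ℕ}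
    {X₀ X₁ : EuclideanSpace ℝ (Fin ny) → Regressor na nb ny nu} (hX₀ : Measurable X₀)
    (hX₁ : Measurable X₁) {c : ℝ} (hc : 0 ≤ c) (hX : ∀ z, ‖X₀ z - X₁ z‖ ≤ c + ‖z‖) (m : ℕ) :
    eLpNorm (fun ω => outputFrom f v (extendNoise (e · ω)) (j + 1) (X₀ (e j ω)) m
        - outputFrom f v (extendNoise (e · ω)) (j + 1) (X₁ (e j ω)) m) 2 P
      ≤ ENNReal.ofReal (C * lam ^ m * (1 + c + noiseScale e P)) := by
  have hrate : 0 ≤ C * lam ^ m := mul_nonneg h.const_nonneg (pow_nonneg h.rate_nonneg _)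
  have hpast {X : EuclideanSpace ℝ (Fin ny) → Regressor na nb ny nu}
      (w w' : ℕ → EuclideanSpace ℝ (Fin ny)) : X (splice (j + 1) w w' j) = X (w j) := by
    rw [splice_of_lt j.lt_succ_self]
  refine (h.eLpNorm_predictable_start_le (X₀ := fun w => X₀ (w j)) (X₁ := fun w => X₁ (w j)) hf he
    (hX₀.comp (measurable_pi_apply j)) (hX₁.comp (measurable_pi_apply j)) hpast hpast m).trans ?_
  rw [ENNReal.ofReal_mul hrate]
  gcongr
  refine he.eLpNorm_le_of_norm_le (j := j) (by positivity) fun ω => ?_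
  rw [Real.norm_of_nonneg (by positivity)]
  linarith [hX (e j ω)]

end RandomStart

variable {Ω : Type*} {mΩ : MeasurableSpace Ω} {P : Measure Ω} {na nb ny nu : ℕ}
  {f : Regressor na nb ny nu → EuclideanSpace ℝ (Fin ny)} {v : Signal nu}
  {e : ℕ → Ω → EuclideanSpace ℝ (Fin ny)} {C lam : ℝ}

section SimulationBounds

theorem stateFrom_splice {i j : ℕ} (w w' : ℕ → EuclideanSpace ℝ (Fin ny))
    (x : Regressor na nb ny nu) (hij : j ≤ i) :
    stateFrom f v (extendNoise (splice i w w')) 0 x j = stateFrom f v (extendNoise w) 0 x j :=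
  stateFrom_congr fun l hl => by
    rw [Nat.cast_zero, zero_add, extendNoise_natCast, extendNoise_natCast,
      splice_of_lt (by omega)]

theorem simulate_splice {i j : ℕ} (w w' : ℕ → EuclideanSpace ℝ (Fin ny)) (y₀ : Signal ny)
    (hij : j ≤ i) (m : ℕ) :
    simulate f v (extendNoise (splice i w w')) y₀ ((j + m : ℕ) : ℤ)
      = outputFrom f v (extendNoise (splice i w w')) j
        (stateFrom f v (extendNoise w) 0 (regressor na nb y₀ v 0) j) m := by
  rw [simulate_natCast, outputFrom_add, zero_add, stateFrom_splice _ _ _ hij]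

theorem outputFrom_splice_succ {i j : ℕ} (w w' : ℕ → EuclideanSpace ℝ (Fin ny))
    (x : Regressor na nb ny nu) (hij : i ≤ j + 1) (m : ℕ) :
    outputFrom f v (extendNoise (splice i w w')) j x (m + 1)
      = outputFrom f v (extendNoise w') (j + 1)
        (nextRegressor x (f x + splice i w w' j) (v (j + 1))) m := by
  rw [outputFrom_succ, extendNoise_natCast, outputFrom_splice _ _ _ hij]

theorem measurable_nextRegressor_add (x : Regressor na nb ny nu) (a : EuclideanSpace ℝ (Fin ny))
    (b : EuclideanSpace ℝ (Fin nu)) :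
    Measurable fun z : EuclideanSpace ℝ (Fin ny) => nextRegressor x (a + z) b :=
  measurable_nextRegressor.comp
    (measurable_const.prodMk ((measurable_id.const_add a).prodMk measurable_const))

theorem measurable_simulate_extendNoise (hf : Measurable f) (v : Signal nu) (y₀ : Signal ny)
    (k : ℤ) : Measurable fun w : ℕ → EuclideanSpace ℝ (Fin ny) =>
      simulate f v (extendNoise w) y₀ k :=
  measurable_simulate (u := fun i _ => v i)
    (e := fun i (w : ℕ → EuclideanSpace ℝ (Fin ny)) => extendNoise w i)
    (y := fun i _ => y₀ i) hf (fun _ => measurable_const) (fun _ => measurable_pi_apply _)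
    (fun _ => measurable_const) k

variable [IsProbabilityMeasure P]

theorem MeanSquareStable.eLpNorm_outputFrom_splice_succ_le (h : MeanSquareStable f v e P C lam)
    (hf : Measurable f) (he : IsL2Noise e P) (w : ℕ → EuclideanSpace ℝ (Fin ny)) (j m : ℕ)
    (x : Regressor na nb ny nu) :
    eLpNorm (fun ω => outputFrom f v (extendNoise (splice (j + 1) w (e · ω))) j x (m + 1)
        - outputFrom f v (extendNoise (splice j w (e · ω))) j x (m + 1)) 2 P
      ≤ ENNReal.ofReal (C * lam ^ m * (1 + ‖w j‖ + noiseScale e P)) := by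
  simp only [outputFrom_splice_succ _ _ _ le_rfl, outputFrom_splice_succ _ _ _ j.le_succ,
    splice_of_lt j.lt_succ_self, splice_of_le le_rfl]
  refine h.eLpNorm_start_le hf he (X₀ := fun _ => nextRegressor x (f x + w j) (v (j + 1)))
    measurable_const (measurable_nextRegressor_add x (f x) _) (norm_nonneg _) (fun z => ?_) m
  calc ‖nextRegressor x (f x + w j) (v (j + 1)) - nextRegressor x (f x + z) (v (j + 1))‖
      ≤ ‖w j - z‖ := by
        simpa using norm_nextRegressor_sub_le x (f x + w j) (f x + z) (v (j + 1)) (v (j + 1))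
    _ ≤ ‖w j‖ + ‖z‖ := norm_sub_le _ _

theorem MeanSquareStable.eLpNorm_simulate_splice_le (h : MeanSquareStable f v e P C lam)
    (hlam : 0 < lam) (hf : Measurable f) (he : IsL2Noise e P) (y₀ : Signal ny)
    (w : ℕ → EuclideanSpace ℝ (Fin ny)) (j m : ℕ) :
    eLpNorm (fun ω => simulate f v (extendNoise (splice (j + 1) w (e · ω))) y₀ ((j + m : ℕ) : ℤ)
        - simulate f v (extendNoise (splice j w (e · ω))) y₀ ((j + m : ℕ) : ℤ)) 2 P
      ≤ ENNReal.ofReal ((1 + noiseScale e P) * (1 + C / lam) * lam ^ m * (1 + ‖w j‖)) := by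
  have hσ := noiseScale_nonneg (e := e) (P := P)
  have hCl : 0 ≤ C / lam := div_nonneg h.const_nonneg hlam.le
  have hw := norm_nonneg (w j)
  have hprod : 1 + ‖w j‖ + noiseScale e P ≤ (1 + noiseScale e P) * (1 + ‖w j‖) := by
    linarith [mul_nonneg hσ hw]
  simp only [simulate_splice _ _ _ j.le_succ, simulate_splice _ _ _ le_rfl]
  set x := stateFrom f v (extendNoise w) 0 (regressor na nb y₀ v 0) j
  cases m with
  | zero =>
    have hjump (ω : Ω) : outputFrom f v (extendNoise (splice (j + 1) w (e · ω))) j x 0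
        - outputFrom f v (extendNoise (splice j w (e · ω))) j x 0 = w j - e j ω := by
      simp [outputFrom, stateFrom, extendNoise_natCast, splice_of_lt j.lt_succ_self,
        splice_of_le le_rfl]
    simp only [hjump]
    refine (he.eLpNorm_le_of_norm_le hw (j := j) fun ω => norm_sub_le _ _).trans
      (ENNReal.ofReal_le_ofReal ?_)
    calc ‖w j‖ + noiseScale e P ≤ (1 + noiseScale e P) * 1 * 1 * (1 + ‖w j‖) := by linarith
      _ ≤ (1 + noiseScale e P) * (1 + C / lam) * lam ^ 0 * (1 + ‖w j‖) := by
        rw [pow_zero]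
        gcongr
        linarith
  | succ m =>
    refine (h.eLpNorm_outputFrom_splice_succ_le hf he w j m x).trans
      (ENNReal.ofReal_le_ofReal ?_)
    calc C * lam ^ m * (1 + ‖w j‖ + noiseScale e P)
        = C / lam * lam ^ (m + 1) * (1 + ‖w j‖ + noiseScale e P) := by
          rw [pow_succ]; field_simp
      _ ≤ (1 + C / lam) * lam ^ (m + 1) * ((1 + noiseScale e P) * (1 + ‖w j‖)) := by
          gcongr
          linarith
      _ = _ := by ring

theorem MeanSquareStable.eLpNorm_outputFrom_zero_succ_le (h : MeanSquareStable f v e P C lam)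
    (hf : Measurable f) (he : IsL2Noise e P) (j m : ℕ) :
    eLpNorm (fun ω => outputFrom f v (extendNoise (e · ω)) j 0 (m + 1)) 2 P
      ≤ eLpNorm (fun ω => outputFrom f v (extendNoise (e · ω)) (j + 1) 0 m) 2 P
        + ENNReal.ofReal
          (C * lam ^ m * (1 + (‖f 0‖ + noiseScale e P) + ‖v ((j + 1 : ℕ) : ℤ)‖)) := by
  set X : EuclideanSpace ℝ (Fin ny) → Regressor na nb ny nu := fun z =>
    nextRegressor 0 (f 0 + z) (v (j + 1))
  have hX : Measurable X := measurable_nextRegressor_add _ _ _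
  have hmeas {x : Ω → Regressor na nb ny nu} (hx : Measurable x) :
      AEStronglyMeasurable (fun ω => outputFrom f v (extendNoise (e · ω)) (j + 1) (x ω) m) P :=
    (measurable_outputFrom_extendNoise hf v he.measurable hx _ m).aestronglyMeasurable
  have hbound (z : EuclideanSpace ℝ (Fin ny)) : ‖X z - 0‖ ≤ ‖f 0‖ + ‖v (j + 1)‖ + ‖z‖ := by
    rw [sub_zero]
    linarith [norm_nextRegressor_zero_le (na := na) (nb := nb) (f 0 + z) (v (j + 1)),
      norm_add_le (f 0) z]
  calc eLpNorm (fun ω => outputFrom f v (extendNoise (e · ω)) j 0 (m + 1)) 2 P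
      = eLpNorm ((fun ω => outputFrom f v (extendNoise (e · ω)) (j + 1) 0 m)
          + fun ω => outputFrom f v (extendNoise (e · ω)) (j + 1) (X (e j ω)) m
            - outputFrom f v (extendNoise (e · ω)) (j + 1) 0 m) 2 P := by
        congr 1
        ext1 ω
        rw [Pi.add_apply, add_sub_cancel, outputFrom_succ, extendNoise_natCast]
    _ ≤ _ := eLpNorm_add_le (hmeas measurable_const)
        ((hmeas (hX.comp (he.measurable j))).sub (hmeas measurable_const)) one_le_two
    _ ≤ _ := by
        gcongr
        refine (h.eLpNorm_start_le hf he hX measurable_const (by positivity) hbound m).trans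
          (le_of_eq ?_)
        push_cast
        ring_nf

theorem MeanSquareStable.eLpNorm_outputFrom_zero_le (h : MeanSquareStable f v e P C lam)
    (hf : Measurable f) (he : IsL2Noise e P) (j m : ℕ) :
    eLpNorm (fun ω => outputFrom f v (extendNoise (e · ω)) j 0 m) 2 P
      ≤ ENNReal.ofReal (‖f 0‖ + noiseScale e P + ∑ i ∈ Finset.Ico (j + 1) (j + m + 1),
        C * lam ^ (j + m - i) * (1 + (‖f 0‖ + noiseScale e P) + ‖v i‖)) := by
  have hσ := noiseScale_nonneg (e := e) (P := P)
  have hC := h.const_nonneg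
  have h0 := h.rate_nonneg
  induction m generalizing j with
  | zero =>
    simp only [outputFrom, stateFrom, Nat.cast_zero, add_zero, extendNoise_natCast,
      Finset.Ico_self, Finset.sum_empty]
    exact he.eLpNorm_le_of_norm_le (norm_nonneg _) fun ω => norm_add_le _ _
  | succ m ih =>
    have hsum : ∑ i ∈ Finset.Ico (j + 1) (j + (m + 1) + 1),
          C * lam ^ (j + (m + 1) - i) * (1 + (‖f 0‖ + noiseScale e P) + ‖v i‖)
        = C * lam ^ m * (1 + (‖f 0‖ + noiseScale e P) + ‖v ((j + 1 : ℕ) : ℤ)‖)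
          + ∑ i ∈ Finset.Ico (j + 1 + 1) (j + 1 + m + 1),
            C * lam ^ (j + 1 + m - i) * (1 + (‖f 0‖ + noiseScale e P) + ‖v i‖) := by
      rw [Finset.sum_eq_sum_Ico_succ_bot (by omega), show j + (m + 1) = j + 1 + m by omega,
        Nat.add_sub_cancel_left]
    refine (h.eLpNorm_outputFrom_zero_succ_le hf he j m).trans
      ((add_le_add_left (ih (j + 1)) _).trans (le_of_eq ?_))
    rw [← ENNReal.ofReal_add (by positivity) (by positivity), hsum]
    ring_nf

theorem MeanSquareStable.eLpNorm_outputFrom_zero_zero_le (h : MeanSquareStable f v e P C lam)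
    (hf : Measurable f) (he : IsL2Noise e P) (k : ℕ) :
    eLpNorm (fun ω => outputFrom f v (extendNoise (e · ω)) 0 0 k) 2 P
      ≤ ENNReal.ofReal (‖f 0‖ + noiseScale e P + C * ((1 + (‖f 0‖ + noiseScale e P)) * (1 - lam)⁻¹
        + geomFilter lam (fun i => ‖v i‖) k)) := by
  have hC := h.const_nonneg
  have h0 := h.rate_nonneg
  have hσ := noiseScale_nonneg (e := e) (P := P)
  refine (h.eLpNorm_outputFrom_zero_le hf he 0 k).trans (ENNReal.ofReal_le_ofReal ?_)
  set D := ‖f 0‖ + noiseScale e P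
  simp only [zero_add]
  gcongr
  calc ∑ i ∈ Finset.Ico 1 (k + 1), C * lam ^ (k - i) * (1 + D + ‖v i‖)
      ≤ ∑ i ∈ Finset.range (k + 1), C * lam ^ (k - i) * (1 + D + ‖v i‖) := by
        rw [Finset.range_eq_Ico]
        exact Finset.sum_le_sum_of_subset_of_nonneg (Finset.Ico_subset_Ico_left zero_le_one)
          fun _ _ _ => by positivity
    _ = C * ((1 + D) * geomFilter lam (fun _ => 1) k + geomFilter lam (fun i => ‖v i‖) k) := by
        rw [← geomFilter_const_mul, ← geomFilter_add, ← geomFilter_const_mul]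
        exact Finset.sum_congr rfl fun i _ => by ring
    _ ≤ C * ((1 + D) * (1 - lam)⁻¹ + geomFilter lam (fun i => ‖v i‖) k) := by
        gcongr
        exact geomFilter_one_le h0 h.rate_lt_one k

theorem MeanSquareStable.exists_eLpNorm_simulate_le (h : MeanSquareStable f v e P C lam)
    (hf : Measurable f) (he : IsL2Noise e P) (y₀ : Signal ny) :
    ∃ K : ℝ, 0 ≤ K ∧ ∀ k : ℕ,
      eLpNorm (fun ω => simulate f v (extendNoise (e · ω)) y₀ k) 2 P
        ≤ ENNReal.ofReal (K * (1 + geomFilter lam (fun i => ‖v i‖) k)) := by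
  have hC := h.const_nonneg
  have h0 := h.rate_nonneg
  set x₀ := regressor na nb y₀ v 0
  have hD : 0 ≤ ‖f 0‖ + noiseScale e P := add_nonneg (norm_nonneg _) noiseScale_nonneg
  have hL : 0 ≤ (1 - lam)⁻¹ := inv_nonneg.2 (by linarith [h.rate_lt_one])
  set A := ‖f 0‖ + noiseScale e P + C * ((1 + (‖f 0‖ + noiseScale e P)) * (1 - lam)⁻¹)
    + C * (1 + ‖x₀‖)
  have hA0 : 0 ≤ A := by positivity
  refine ⟨A + C, by positivity, fun k => ?_⟩
  set g := geomFilter lam (fun i : ℕ => ‖v i‖) k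
  have hg : 0 ≤ g := geomFilter_nonneg h0 (fun i => norm_nonneg _) k
  have hmeas (x : Regressor na nb ny nu) :
      AEStronglyMeasurable (fun ω => outputFrom f v (extendNoise (e · ω)) 0 x k) P :=
    (measurable_outputFrom_extendNoise hf v he.measurable measurable_const 0 k).aestronglyMeasurable
  have hstart : C * lam ^ k * (1 + ‖x₀ - 0‖) ≤ C * 1 * (1 + ‖x₀‖) := by
    rw [sub_zero]
    gcongr
    exact pow_le_one₀ h0 h.rate_lt_one.le
  calc eLpNorm (fun ω => simulate f v (extendNoise (e · ω)) y₀ k) 2 P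
      = eLpNorm ((fun ω => outputFrom f v (extendNoise (e · ω)) 0 0 k)
          + fun ω => outputFrom f v (extendNoise (e · ω)) 0 x₀ k
            - outputFrom f v (extendNoise (e · ω)) 0 0 k) 2 P := by
        congr 1
        ext1 ω
        rw [Pi.add_apply, add_sub_cancel, simulate_natCast]
    _ ≤ _ := eLpNorm_add_le (hmeas 0) ((hmeas x₀).sub (hmeas 0)) one_le_two
    _ ≤ _ := add_le_add (h.eLpNorm_outputFrom_zero_zero_le hf he k) (h.eLpNorm_sub_le 0 k x₀ 0)
    _ ≤ _ := by
        rw [← ENNReal.ofReal_add (by positivity) (by positivity)]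
        refine ENNReal.ofReal_le_ofReal ?_
        linarith [mul_nonneg hA0 hg]

end SimulationBounds

section DiscountedDistance

variable {na nb ny nu : ℕ} {lam : ℝ}

theorem sum_Icc_natCast {M : Type*} [AddCommMonoid M] (F : ℤ → M) {j k : ℕ} (hjk : j ≤ k) :
    ∑ i ∈ Finset.Icc (j : ℤ) k, F i
      = ∑ m ∈ Finset.range (k - j + 1), F ((j + m : ℕ) : ℤ) := by
  refine Finset.sum_nbij' (fun i => (i - j).toNat) (fun m => ((j + m : ℕ) : ℤ)) ?_ ?_ ?_ ?_ ?_
  · intro i hi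
    simp only [Finset.mem_Icc, Finset.mem_range] at hi ⊢
    omega
  · intro m hm
    simp only [Finset.mem_Icc, Finset.mem_range] at hm ⊢
    omega
  · intro i hi
    simp only [Finset.mem_Icc] at hi
    omega
  · intro m _
    omega
  · intro i hi
    simp only [Finset.mem_Icc] at hi
    congr 1
    omega

theorem discountedDist_nonneg (h0 : 0 ≤ lam) (k : ℕ) (y y' : Signal ny) (v v' : Signal nu) :
    0 ≤ discountedDist na nb lam k y y' v v' :=
  Finset.sum_nonneg fun _ _ => by positivity

theorem norm_sub_le_discountedDist (h0 : 0 ≤ lam) (k : ℕ) (y y' : Signal ny)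
    (v v' : Signal nu) : ‖y k - y' k‖ ≤ discountedDist na nb lam k y y' v v' := by
  refine le_trans ?_ (Finset.single_le_sum (fun i _ => by positivity)
    (Finset.mem_Icc.2 ⟨by omega, le_rfl⟩ : (k : ℤ) ∈ _))
  simp

theorem discountedDist_le_add (h0 : 0 ≤ lam) (k : ℕ) (y y' : Signal ny) (v v' : Signal nu) :
    discountedDist na nb lam k y 0 v 0
      ≤ discountedDist na nb lam k y' 0 v' 0 + discountedDist na nb lam k y y' v v' := by
  simp only [discountedDist, ← Finset.sum_add_distrib, ← mul_add]
  refine Finset.sum_le_sum fun i _ => mul_le_mul_of_nonneg_left ?_ (by positivity)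
  simp only [Pi.zero_apply, sub_zero]
  linarith [norm_le_norm_add_norm_sub' (v i) (v' i), norm_le_norm_add_norm_sub' (y i) (y' i)]

theorem discountedDist_of_eq_before (lam : ℝ) {y y' : Signal ny} (v : Signal nu) {j k : ℕ}
    (hjk : j ≤ k) (h : ∀ i < (j : ℤ), y i = y' i) :
    discountedDist na nb lam k y y' v v
      = geomFilter lam (fun m => ‖y ((j + m : ℕ) : ℤ) - y' ((j + m : ℕ) : ℤ)‖) (k - j) := by
  have hsubset : Finset.Icc (j : ℤ) k ⊆ Finset.Icc (-((max na nb : ℕ) : ℤ)) k :=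
    Finset.Icc_subset_Icc (by omega) le_rfl
  rw [discountedDist, geomFilter, ← Finset.sum_subset hsubset, sum_Icc_natCast _ hjk]
  · refine Finset.sum_congr rfl fun m _ => ?_
    have htime : ((k : ℤ) - ((j + m : ℕ) : ℤ)).toNat = k - j - m := by omega
    rw [htime, sub_self, norm_zero, zero_add]
  · intro i hi hi'
    simp only [Finset.mem_Icc] at hi hi'
    rw [h i (by omega)]
    simp

/-- The size of a data record `(y, v)` before time `0`. -/
noncomputable def initialSize (na nb : ℕ) {ny nu : ℕ} (y : Signal ny) (v : Signal nu) : ℝ :=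
  ∑ i ∈ Finset.Icc (-((max na nb : ℕ) : ℤ)) (-1), (‖v i‖ + ‖y i‖)

theorem initialSize_nonneg (y : Signal ny) (v : Signal nu) : 0 ≤ initialSize na nb y v :=
  Finset.sum_nonneg fun _ _ => by positivity

theorem initialSize_simulate (f : Regressor na nb ny nu → EuclideanSpace ℝ (Fin ny))
    (v : Signal nu) (w y₀ : Signal ny) :
    initialSize na nb (simulate f v w y₀) v = initialSize na nb y₀ v := by
  refine Finset.sum_congr rfl fun i hi => ?_
  rw [simulate_of_neg y₀ (lt_of_le_of_lt (Finset.mem_Icc.1 hi).2 neg_one_lt_zero)]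

theorem discountedDist_zero_le (h0 : 0 ≤ lam) (h1 : lam ≤ 1) (y : Signal ny) (v : Signal nu)
    (k : ℕ) :
    discountedDist na nb lam k y 0 v 0
      ≤ initialSize na nb y v + geomFilter lam (fun i : ℕ => ‖v i‖ + ‖y i‖) k := by
  have hneg : (Finset.Icc (-((max na nb : ℕ) : ℤ)) (k : ℤ)).filter (fun i => i < 0)
      = Finset.Icc (-((max na nb : ℕ) : ℤ)) (-1) := by
    ext i
    simp only [Finset.mem_filter, Finset.mem_Icc]
    omega
  have hnonneg : (Finset.Icc (-((max na nb : ℕ) : ℤ)) (k : ℤ)).filter (fun i => ¬ i < 0)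
      = Finset.Icc ((0 : ℕ) : ℤ) k := by
    ext i
    simp only [Finset.mem_filter, Finset.mem_Icc]
    omega
  rw [discountedDist, ← Finset.sum_filter_add_sum_filter_not _ (fun i : ℤ => i < 0), hneg,
    hnonneg, sum_Icc_natCast _ (Nat.zero_le k)]
  refine add_le_add (Finset.sum_le_sum fun i _ => ?_) (Finset.sum_congr rfl fun m _ => ?_).le
  · simp only [Pi.zero_apply, sub_zero]
    exact mul_le_of_le_one_left (by positivity) (pow_le_one₀ h0 h1)
  · have htime : ((k : ℤ) - (m : ℤ)).toNat = k - m := by omega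
    simp only [Pi.zero_apply, sub_zero, zero_add, htime]

end DiscountedDistance

section StableFunctional

variable {na nb ny nu : ℕ} {F : Type*} [NormedAddCommGroup F]
  {g : ℕ → Signal ny → Signal nu → F} {C lam : ℝ}

/-- A family of functionals `g k` of a data record `(y, u)` whose sensitivity to the data is
discounted exponentially with rate `lam`, bounded at the zero record, and blind to the outputs
before time `-n_a`. Prediction errors of a stable predictor are of this kind. -/
structure IsStableFunctional (na nb : ℕ) {ny nu : ℕ} {F : Type*} [NormedAddCommGroup F]
    (g : ℕ → Signal ny → Signal nu → F) (C lam : ℝ) : Prop where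
  const_nonneg : 0 ≤ C
  rate_nonneg : 0 ≤ lam
  rate_lt_one : lam < 1
  norm_sub_le : ∀ k y y' u u', ‖g k y u - g k y' u'‖ ≤ C * discountedDist na nb lam k y y' u u'
  norm_zero_le : ∀ k, ‖g k 0 0‖ ≤ C
  congr : ∀ k y y' u, (∀ i, -(na : ℤ) ≤ i → y i = y' i) → g k y u = g k y' u

/-- The time average over `0 ≤ k < N` of `‖g k‖ ^ 2` along a data record. -/
noncomputable def meanSquare (g : ℕ → Signal ny → Signal nu → F) (N : ℕ) (y : Signal ny)
    (u : Signal nu) : ℝ :=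
  (N : ℝ)⁻¹ * ∑ k ∈ Finset.range N, ‖g k y u‖ ^ 2

namespace IsStableFunctional

theorem norm_le (h : IsStableFunctional na nb g C lam) (k : ℕ) (y : Signal ny) (u : Signal nu) :
    ‖g k y u‖ ≤ C * (1 + discountedDist na nb lam k y 0 u 0) := by
  linarith [h.norm_sub_le k y 0 u 0, norm_le_norm_add_norm_sub' (g k y u) (g k 0 0),
    h.norm_zero_le k]

theorem continuous (h : IsStableFunctional na nb g C lam) (k : ℕ) :
    Continuous fun x : Signal ny × Signal nu => g k x.1 x.2 := by
  refine continuous_iff_continuousAt.2 fun x₀ => tendsto_iff_norm_sub_tendsto_zero.2 ?_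
  refine squeeze_zero (fun _ => norm_nonneg _) (fun x => h.norm_sub_le k x.1 x₀.1 x.2 x₀.2) ?_
  have hcont : Continuous fun x : Signal ny × Signal nu =>
      C * discountedDist na nb lam k x.1 x₀.1 x.2 x₀.2 := by
    unfold discountedDist
    fun_prop
  simpa [discountedDist] using hcont.tendsto x₀

theorem meanSquare_congr (h : IsStableFunctional na nb g C lam) (N : ℕ) {y y' : Signal ny}
    (u : Signal nu) (hy : ∀ i, -(na : ℤ) ≤ i → y i = y' i) :
    meanSquare g N y u = meanSquare g N y' u := by
  simp only [meanSquare, h.congr _ y y' u hy]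

variable [MeasurableSpace F] [BorelSpace F] {α : Type*} [MeasurableSpace α]
  {y : ℤ → α → EuclideanSpace ℝ (Fin ny)} {u : ℤ → α → EuclideanSpace ℝ (Fin nu)}

theorem measurable (h : IsStableFunctional na nb g C lam) (k : ℕ) (hy : ∀ k, Measurable (y k))
    (hu : ∀ k, Measurable (u k)) : Measurable fun a => g k (y · a) (u · a) :=
  (h.continuous k).measurable.comp
    ((measurable_pi_lambda _ hy).prodMk (measurable_pi_lambda _ hu))

theorem measurable_meanSquare (h : IsStableFunctional na nb g C lam) (N : ℕ)
    (hy : ∀ k, Measurable (y k)) (hu : ∀ k, Measurable (u k)) :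
    Measurable fun a => meanSquare g N (y · a) (u · a) :=
  (Finset.measurable_fun_sum _ fun k _ => (h.measurable k hy hu).norm.pow_const 2).const_mul _

end IsStableFunctional

end StableFunctional

section Domination

/-- `b ^ 2` is dominated by a Cesàro convergent sequence; unlike Cesàro convergence of `b ^ 2`
itself, this is stable under sums and geometric filters. -/
def IsSqCesaroDominated (b : ℕ → ℝ) : Prop :=
  ∃ c : ℕ → ℝ, CesaroConvergent c ∧ ∀ k, b k ^ 2 ≤ c k

theorem isSqCesaroDominated_const (x : ℝ) : IsSqCesaroDominated fun _ => x :=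
  ⟨fun _ => x ^ 2, cesaroConvergent_of_tendsto tendsto_const_nhds, fun _ => le_rfl⟩

namespace IsSqCesaroDominated

variable {a b : ℕ → ℝ}

theorem add (ha : IsSqCesaroDominated a) (hb : IsSqCesaroDominated b) :
    IsSqCesaroDominated fun k => a k + b k := by
  obtain ⟨c, hc, hac⟩ := ha
  obtain ⟨d, hd, hbd⟩ := hb
  exact ⟨fun k => 2 * (c k + d k), (hc.add hd).const_mul 2,
    fun k => add_sq_le.trans (mul_le_mul_of_nonneg_left (add_le_add (hac k) (hbd k)) zero_le_two)⟩

theorem const_mul (x : ℝ) (ha : IsSqCesaroDominated a) :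
    IsSqCesaroDominated fun k => x * a k := by
  obtain ⟨c, hc, hac⟩ := ha
  refine ⟨fun k => x ^ 2 * c k, hc.const_mul _, fun k => ?_⟩
  rw [mul_pow]
  exact mul_le_mul_of_nonneg_left (hac k) (sq_nonneg x)

theorem geomFilter {lam : ℝ} (h0 : 0 ≤ lam) (h1 : lam < 1) (ha : IsSqCesaroDominated a) :
    IsSqCesaroDominated (geomFilter lam a) := by
  obtain ⟨c, hc, hac⟩ := ha
  refine ⟨fun k => (1 - lam)⁻¹ * OrthAug.geomFilter lam c k,
    (hc.geomFilter h0 h1).const_mul _, fun k => ?_⟩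
  exact (sq_geomFilter_le h0 h1 a k).trans (mul_le_mul_of_nonneg_left
    (geomFilter_mono h0 hac k) (inv_nonneg.2 (sub_nonneg.2 h1.le)))

theorem exists_le_cesaroConvergent_sq (ha : IsSqCesaroDominated a) :
    ∃ β : ℕ → ℝ, (∀ k, 0 ≤ β k) ∧ (∀ k, a k ≤ β k) ∧ CesaroConvergent fun k => β k ^ 2 := by
  obtain ⟨c, hc, hac⟩ := ha
  have hc0 (k : ℕ) : 0 ≤ c k := (sq_nonneg _).trans (hac k)
  refine ⟨fun k => √(c k), fun k => Real.sqrt_nonneg _, fun k => Real.le_sqrt_of_sq_le (hac k), ?_⟩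
  simpa only [Real.sq_sqrt (hc0 _)] using hc

end IsSqCesaroDominated

end Domination

section Moments

variable {Ω : Type*} {mΩ : MeasurableSpace Ω} {P : Measure Ω} {b : ℕ → ℝ}

theorem eLpNorm_geomFilter_le {lam : ℝ} (h0 : 0 ≤ lam) {p : ENNReal} (hp : 1 ≤ p)
    {a : ℕ → Ω → ℝ} (ha : ∀ i, AEStronglyMeasurable (a i) P) (hb : ∀ i, 0 ≤ b i)
    (hab : ∀ i, eLpNorm (a i) p P ≤ ENNReal.ofReal (b i)) (k : ℕ) :
    eLpNorm (fun ω => geomFilter lam (a · ω) k) p P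
      ≤ ENNReal.ofReal (geomFilter lam b k) := by
  have hsum : (fun ω => geomFilter lam (a · ω) k)
      = ∑ i ∈ Finset.range (k + 1), lam ^ (k - i) • a i := by
    ext ω
    simp [geomFilter]
  rw [hsum, geomFilter,
    ENNReal.ofReal_sum_of_nonneg fun i _ => mul_nonneg (pow_nonneg h0 _) (hb i)]
  refine (eLpNorm_sum_le (fun i _ => (ha i).const_smul _) hp).trans
    (Finset.sum_le_sum fun i _ => ?_)
  rw [eLpNorm_const_smul, ENNReal.ofReal_mul (pow_nonneg h0 _),
    Real.enorm_of_nonneg (pow_nonneg h0 _)]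
  exact mul_le_mul_right (hab i) _

theorem eLpNorm_le_of_norm_le_add_mul [IsProbabilityMeasure P] {F : Type*}
    [NormedAddCommGroup F] {U : Ω → F} {W : Ω → ℝ} {x c B : ℝ} (hx : 0 ≤ x) (hc : 0 ≤ c)
    (hB : 0 ≤ B) (hW : AEStronglyMeasurable W P) (hWB : eLpNorm W 2 P ≤ ENNReal.ofReal B)
    (hU : ∀ ω, ‖U ω‖ ≤ x + c * W ω) : eLpNorm U 2 P ≤ ENNReal.ofReal (x + c * B) :=
  calc eLpNorm U 2 P ≤ eLpNorm ((fun _ => x) + c • W) 2 P := eLpNorm_mono_real hU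
    _ ≤ eLpNorm (fun _ : Ω => x) 2 P + eLpNorm (c • W) 2 P :=
        eLpNorm_add_le aestronglyMeasurable_const (hW.const_smul c) one_le_two
    _ ≤ ENNReal.ofReal x + ENNReal.ofReal c * ENNReal.ofReal B := by
        rw [eLpNorm_two_const, eLpNorm_const_smul, Real.norm_of_nonneg hx,
          Real.enorm_of_nonneg hc]
        gcongr
    _ = ENNReal.ofReal (x + c * B) := by
        rw [← ENNReal.ofReal_mul hc, ← ENNReal.ofReal_add hx (mul_nonneg hc hB)]

end Moments

section Forgetting

variable {Ω : Type*} {mΩ : MeasurableSpace Ω} {P : Measure Ω} {na nb ny nu : ℕ}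
  {f : Regressor na nb ny nu → EuclideanSpace ℝ (Fin ny)} {v : Signal nu}
  {e : ℕ → Ω → EuclideanSpace ℝ (Fin ny)} {C C' lam mu : ℝ}
  {F : Type*} [NormedAddCommGroup F] {g : ℕ → Signal ny → Signal nu → F}

theorem simulate_splice_of_lt (f : Regressor na nb ny nu → EuclideanSpace ℝ (Fin ny))
    (v : Signal nu) (y₀ : Signal ny) (w w' : ℕ → EuclideanSpace ℝ (Fin ny)) {j : ℕ} {i : ℤ}
    (hij : i < j) :
    simulate f v (extendNoise (splice j w w')) y₀ i = simulate f v (extendNoise w) y₀ i :=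
  simulate_congr fun m hm => by
    rw [extendNoise_natCast, extendNoise_natCast, splice_of_lt (by omega)]

theorem aestronglyMeasurable_norm_simulate_splice_sub (hf : Measurable f) (v : Signal nu)
    (he : IsL2Noise e P) (y₀ : Signal ny) (w : ℕ → EuclideanSpace ℝ (Fin ny)) (j m : ℕ) :
    AEStronglyMeasurable (fun ω =>
      ‖simulate f v (extendNoise (splice (j + 1) w (e · ω))) y₀ ((j + m : ℕ) : ℤ)
        - simulate f v (extendNoise (splice j w (e · ω))) y₀ ((j + m : ℕ) : ℤ)‖) P := by
  have hmeas (i : ℕ) : Measurable fun ω =>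
      simulate f v (extendNoise (splice i w (e · ω))) y₀ ((j + m : ℕ) : ℤ) :=
    (measurable_simulate_extendNoise hf v y₀ _).comp
      ((measurable_splice i w).comp he.measurable_pi)
  exact ((hmeas _).sub (hmeas _)).norm.aestronglyMeasurable

namespace MeanSquareStable

variable [IsProbabilityMeasure P]

theorem eLpNorm_geomFilter_simulate_splice_le (h : MeanSquareStable f v e P C lam)
    (hmu : 0 ≤ mu) (hlam : 0 < lam) (hf : Measurable f) (he : IsL2Noise e P) (y₀ : Signal ny)
    (w : ℕ → EuclideanSpace ℝ (Fin ny)) (j n : ℕ) :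
    eLpNorm (fun ω => geomFilter mu (fun m =>
        ‖simulate f v (extendNoise (splice (j + 1) w (e · ω))) y₀ ((j + m : ℕ) : ℤ)
          - simulate f v (extendNoise (splice j w (e · ω))) y₀ ((j + m : ℕ) : ℤ)‖) n) 2 P
      ≤ ENNReal.ofReal (geomFilter mu
        (fun m => (1 + noiseScale e P) * (1 + C / lam) * (1 + ‖w j‖) * lam ^ m) n) := by
  have := h.const_nonneg
  have := noiseScale_nonneg (e := e) (P := P)
  refine eLpNorm_geomFilter_le hmu one_le_two
    (fun m => aestronglyMeasurable_norm_simulate_splice_sub hf v he y₀ w j m)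
    (fun m => by positivity) (fun m => ?_) n
  rw [eLpNorm_norm, mul_right_comm]
  exact h.eLpNorm_simulate_splice_le hlam hf he y₀ w j m

theorem exists_eLpNorm_norm_add_norm_simulate_le (h : MeanSquareStable f v e P C lam)
    (hf : Measurable f) (he : IsL2Noise e P) (y₀ : Signal ny)
    (hv : IsSqCesaroDominated fun k : ℕ => ‖v k‖) :
    ∃ b : ℕ → ℝ, (∀ i, 0 ≤ b i) ∧ IsSqCesaroDominated b ∧ ∀ i : ℕ,
      eLpNorm (fun ω => ‖v i‖ + ‖simulate f v (extendNoise (e · ω)) y₀ i‖) 2 P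
        ≤ ENNReal.ofReal (b i) := by
  obtain ⟨K, hK0, hK⟩ := h.exists_eLpNorm_simulate_le hf he y₀
  have hfilter (i : ℕ) : 0 ≤ geomFilter lam (fun i => ‖v i‖) i :=
    geomFilter_nonneg h.rate_nonneg (fun _ => norm_nonneg _) i
  have hbound (i : ℕ) : 0 ≤ K * (1 + geomFilter lam (fun i => ‖v i‖) i) :=
    mul_nonneg hK0 (by linarith [hfilter i])
  have hdom := hv.add (((isSqCesaroDominated_const 1).add
    (hv.geomFilter h.rate_nonneg h.rate_lt_one)).const_mul K)
  refine ⟨_, fun i => add_nonneg (norm_nonneg (v i)) (hbound i), hdom, fun i => ?_⟩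
  have hmeas : Measurable fun ω => simulate f v (extendNoise (e · ω)) y₀ (i : ℤ) :=
    (measurable_simulate_extendNoise hf v y₀ i).comp he.measurable_pi
  refine (eLpNorm_le_of_norm_le_add_mul (norm_nonneg _) zero_le_one (hbound i)
    hmeas.norm.aestronglyMeasurable ((eLpNorm_norm _).trans_le (hK i)) fun ω => ?_).trans_eq
    (by rw [one_mul])
  rw [one_mul, Real.norm_of_nonneg (by positivity)]

end MeanSquareStable

namespace IsStableFunctional

theorem causal (h : IsStableFunctional na nb g C mu) {k : ℕ} {y y' : Signal ny}
    (hy : ∀ i ≤ (k : ℤ), y i = y' i) : g k y v = g k y' v := by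
  have hdist : discountedDist na nb mu k y y' v v = 0 := by
    refine Finset.sum_eq_zero fun i hi => ?_
    rw [hy i (Finset.mem_Icc.1 hi).2]
    simp
  have hle := h.norm_sub_le k y y' v v
  rw [hdist, mul_zero] at hle
  exact sub_eq_zero.1 (norm_le_zero_iff.1 hle)

theorem norm_le_geomFilter (h : IsStableFunctional na nb g C mu) (k : ℕ) (y : Signal ny)
    (v : Signal nu) :
    ‖g k y v‖ ≤ C * (1 + initialSize na nb y v)
      + C * geomFilter mu (fun i : ℕ => ‖v i‖ + ‖y i‖) k := by
  refine (h.norm_le k y v).trans ?_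
  rw [← mul_add]
  refine mul_le_mul_of_nonneg_left ?_ h.const_nonneg
  linarith [discountedDist_zero_le (na := na) (nb := nb) h.rate_nonneg h.rate_lt_one.le y v k]

theorem norm_simulate_splice_sub_le (h : IsStableFunctional na nb g C mu)
    (f : Regressor na nb ny nu → EuclideanSpace ℝ (Fin ny)) (v : Signal nu) (y₀ : Signal ny)
    (w w' : ℕ → EuclideanSpace ℝ (Fin ny)) {j k : ℕ} (hjk : j ≤ k) :
    ‖g k (simulate f v (extendNoise (splice (j + 1) w w')) y₀) v
        - g k (simulate f v (extendNoise (splice j w w')) y₀) v‖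
      ≤ C * geomFilter mu (fun m =>
          ‖simulate f v (extendNoise (splice (j + 1) w w')) y₀ ((j + m : ℕ) : ℤ)
            - simulate f v (extendNoise (splice j w w')) y₀ ((j + m : ℕ) : ℤ)‖) (k - j) := by
  rw [← discountedDist_of_eq_before (na := na) (nb := nb) mu v hjk fun i hi => by
    rw [simulate_splice_of_lt f v y₀ _ _ hi, simulate_splice_of_lt f v y₀ _ _ (by omega)]]
  exact h.norm_sub_le k _ _ v v

variable [IsProbabilityMeasure P]

theorem eLpNorm_simulate_splice_le (h : IsStableFunctional na nb g C mu)
    (hs : MeanSquareStable f v e P C' lam) (hmu : mu < lam) (hf : Measurable f)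
    (he : IsL2Noise e P) (y₀ : Signal ny) (w : ℕ → EuclideanSpace ℝ (Fin ny)) {j k : ℕ}
    (hjk : j ≤ k) :
    eLpNorm (fun ω => g k (simulate f v (extendNoise (splice (j + 1) w (e · ω))) y₀) v
        - g k (simulate f v (extendNoise (splice j w (e · ω))) y₀) v) 2 P
      ≤ ENNReal.ofReal (C * ((1 + noiseScale e P) * (1 + C' / lam) * (lam / (lam - mu)))
        * lam ^ (k - j) * (1 + ‖w j‖)) := by
  set A := (1 + noiseScale e P) * (1 + C' / lam)
  have hlam : 0 < lam := h.rate_nonneg.trans_lt hmu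
  have hA : 0 ≤ A := by
    have := hs.const_nonneg
    have := noiseScale_nonneg (e := e) (P := P)
    positivity
  refine (eLpNorm_le_of_norm_le_add_mul le_rfl h.const_nonneg
    (geomFilter_nonneg h.rate_nonneg (fun m => by positivity) _)
    (Finset.aestronglyMeasurable_fun_sum _ fun m _ =>
      (aestronglyMeasurable_norm_simulate_splice_sub hf v he y₀ w j m).const_mul _)
    (hs.eLpNorm_geomFilter_simulate_splice_le h.rate_nonneg hlam hf he y₀ w j (k - j)) fun ω =>
      (h.norm_simulate_splice_sub_le f v y₀ w (e · ω) hjk).trans_eq (zero_add _).symm).trans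
    (ENNReal.ofReal_le_ofReal ?_)
  calc 0 + C * geomFilter mu (fun m => A * (1 + ‖w j‖) * lam ^ m) (k - j)
      = C * (A * (1 + ‖w j‖)) * geomFilter mu (lam ^ ·) (k - j) := by
        rw [geomFilter_const_mul mu _ (lam ^ ·), zero_add, ← mul_assoc]
    _ ≤ C * (A * (1 + ‖w j‖)) * (lam / (lam - mu) * lam ^ (k - j)) := by
        have := h.const_nonneg
        gcongr
        exact geomFilter_pow_le h.rate_nonneg hmu _
    _ = C * (A * (lam / (lam - mu))) * lam ^ (k - j) * (1 + ‖w j‖) := by ring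

theorem exists_eLpNorm_simulate_le (h : IsStableFunctional na nb g C mu)
    (hs : MeanSquareStable f v e P C' lam) (hf : Measurable f) (he : IsL2Noise e P)
    (y₀ : Signal ny) (hv : IsSqCesaroDominated fun k : ℕ => ‖v k‖) :
    ∃ β : ℕ → ℝ, (∀ k, 0 ≤ β k) ∧ (CesaroConvergent fun k => β k ^ 2) ∧
      ∀ k, eLpNorm (fun ω => g k (simulate f v (extendNoise (e · ω)) y₀) v) 2 P
        ≤ ENNReal.ofReal (β k) := by
  obtain ⟨b, hb0, hb, hsize⟩ := hs.exists_eLpNorm_norm_add_norm_simulate_le hf he y₀ hv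
  have hx : 0 ≤ C * (1 + initialSize na nb y₀ v) :=
    mul_nonneg h.const_nonneg (by linarith [initialSize_nonneg (na := na) (nb := nb) y₀ v])
  obtain ⟨β, hβ0, hle, hβ⟩ := ((isSqCesaroDominated_const (C * (1 + initialSize na nb y₀ v))).add
    ((hb.geomFilter h.rate_nonneg h.rate_lt_one).const_mul C)).exists_le_cesaroConvergent_sq
  have hmeas (i : ℕ) : AEStronglyMeasurable
      (fun ω => ‖v i‖ + ‖simulate f v (extendNoise (e · ω)) y₀ i‖) P :=
    (((measurable_simulate_extendNoise hf v y₀ i).comp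
      he.measurable_pi).norm.const_add _).aestronglyMeasurable
  refine ⟨β, hβ0, hβ, fun k => (eLpNorm_le_of_norm_le_add_mul hx h.const_nonneg
    (geomFilter_nonneg h.rate_nonneg hb0 k)
    (Finset.aestronglyMeasurable_fun_sum _ fun i _ => (hmeas i).const_mul _)
    (eLpNorm_geomFilter_le h.rate_nonneg one_le_two hmeas hb0 hsize k) fun ω => ?_).trans
    (ENNReal.ofReal_le_ofReal (hle k))⟩
  have hnorm := h.norm_le_geomFilter k (simulate f v (extendNoise (e · ω)) y₀) v
  rwa [initialSize_simulate] at hnorm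

variable [MeasurableSpace F] [BorelSpace F]

theorem exists_isForgetting (h : IsStableFunctional na nb g C mu)
    (hs : MeanSquareStable f v e P C' lam) (hf : Measurable f) (he : IsL2Noise e P)
    (y₀ : Signal ny) (hv : IsSqCesaroDominated fun k : ℕ => ‖v k‖) :
    ∃ (D kappa : ℝ) (β : ℕ → ℝ),
      IsForgetting e P (fun k w => g k (simulate f v (extendNoise w) y₀) v) D kappa β := by
  obtain ⟨kappa, hmax, hkappa1⟩ := exists_between (max_lt hs.rate_lt_one h.rate_lt_one)
  obtain ⟨hlam, hmu⟩ := max_lt_iff.1 hmax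
  have hkappa : 0 < kappa := h.rate_nonneg.trans_lt hmu
  obtain ⟨β, hβ0, hβ, hsize⟩ := h.exists_eLpNorm_simulate_le hs hf he y₀ hv
  refine ⟨C * ((1 + noiseScale e P) * (1 + C' / kappa) * (kappa / (kappa - mu))), kappa, β,
    ?_, hkappa.le, hkappa1, fun k => ?_, fun k w w' hw => h.causal fun i hi => ?_,
    fun w j k hjk => ?_, hβ0, hsize, hβ⟩
  · have := h.const_nonneg
    have := hs.const_nonneg
    have := noiseScale_nonneg (e := e) (P := P)
    have := sub_pos.2 hmu
    positivity
  · exact h.measurable (u := fun i _ => v i) k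
      (fun i => measurable_simulate_extendNoise hf v y₀ i) fun _ => measurable_const
  · exact simulate_congr fun m hm => by
      rw [extendNoise_natCast, extendNoise_natCast, hw m (by omega)]
  · exact h.eLpNorm_simulate_splice_le (hs.mono hlam.le hkappa1) hmu hf he y₀ w hjk

variable [SecondCountableTopology F]

theorem integrable_norm_sq_simulate (h : IsStableFunctional na nb g C mu)
    (hs : MeanSquareStable f v e P C' lam) (hf : Measurable f) (he : IsL2Noise e P)
    (y₀ : Signal ny) (hv : IsSqCesaroDominated fun k : ℕ => ‖v k‖) (k : ℕ) :
    Integrable (fun ω => ‖g k (simulate f v (extendNoise (e · ω)) y₀) v‖ ^ 2) P := by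
  obtain ⟨D, kappa, β, hΦ⟩ := h.exists_isForgetting hs hf he y₀ hv
  exact (hΦ.memLp he.measurable k).integrable_norm_pow'

theorem integral_meanSquare_simulate (h : IsStableFunctional na nb g C mu)
    (hs : MeanSquareStable f v e P C' lam) (hf : Measurable f) (he : IsL2Noise e P)
    (y₀ : Signal ny) (hv : IsSqCesaroDominated fun k : ℕ => ‖v k‖) (N : ℕ) :
    ∫ ω, meanSquare g N (simulate f v (extendNoise (e · ω)) y₀) v ∂P
      = (N : ℝ)⁻¹ * ∑ k ∈ Finset.range N,
        ∫ ω, ‖g k (simulate f v (extendNoise (e · ω)) y₀) v‖ ^ 2 ∂P := by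
  simp only [meanSquare]
  rw [integral_const_mul,
    integral_finsetSum _ fun k _ => h.integrable_norm_sq_simulate hs hf he y₀ hv k]

theorem exists_integral_meanSquare_simulate_le (h : IsStableFunctional na nb g C mu)
    (hs : MeanSquareStable f v e P C' lam) (hf : Measurable f) (he : IsL2Noise e P)
    (y₀ : Signal ny) (hv : IsSqCesaroDominated fun k : ℕ => ‖v k‖) :
    ∃ K, 0 ≤ K ∧ ∀ N : ℕ,
      ∫ ω, meanSquare g N (simulate f v (extendNoise (e · ω)) y₀) v ∂P ≤ K := by
  obtain ⟨D, kappa, β, hΦ⟩ := h.exists_isForgetting hs hf he y₀ hv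
  obtain ⟨K, hK0, hK⟩ := hΦ.exists_sum_sq_le
  refine ⟨K, hK0, fun N => ?_⟩
  rw [h.integral_meanSquare_simulate hs hf he y₀ hv]
  refine inv_mul_le_of_le_mul₀ N.cast_nonneg hK0 ((Finset.sum_le_sum fun k _ => ?_).trans
    ((hK N).trans_eq (mul_comm _ _)))
  exact integral_norm_sq_le (hΦ.memLp he.measurable k).aestronglyMeasurable (hΦ.size_nonneg k)
    (hΦ.size_le k)

theorem ae_tendsto_meanSquare_simulate_sub_integral (h : IsStableFunctional na nb g C mu)
    (hs : MeanSquareStable f v e P C' lam) (hf : Measurable f) (he : IsL2Noise e P)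
    (y₀ : Signal ny) (hv : IsSqCesaroDominated fun k : ℕ => ‖v k‖) :
    ∀ᵐ ω ∂P, Tendsto (fun N : ℕ => meanSquare g N (simulate f v (extendNoise (e · ω)) y₀) v
      - ∫ ω', meanSquare g N (simulate f v (extendNoise (e · ω')) y₀) v ∂P) atTop (𝓝 0) := by
  obtain ⟨D, kappa, β, hΦ⟩ := h.exists_isForgetting hs hf he y₀ hv
  simp only [h.integral_meanSquare_simulate hs hf he y₀ hv]
  simpa only [meanSquare, Finset.sum_sub_distrib, mul_sub] using hΦ.ae_tendsto_mean_norm_sq_sub he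

end IsStableFunctional

end Forgetting

section Independence

variable {Ω α β : Type*} {mΩ : MeasurableSpace Ω} {P : Measure Ω} [IsProbabilityMeasure P]
  [MeasurableSpace α] [MeasurableSpace β] {A : Ω → α} {B : Ω → β}

theorem ae_prodMk_mem_of_indepFun (hA : Measurable A) (hB : Measurable B) (hAB : IndepFun A B P)
    {s : Set (α × β)} (hs : MeasurableSet s) (h : ∀ᵐ ω ∂P, ∀ᵐ ω' ∂P, (A ω, B ω') ∈ s) :
    ∀ᵐ ω ∂P, (A ω, B ω) ∈ s := by
  have := Measure.isProbabilityMeasure_map (μ := P) hA.aemeasurable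
  have := Measure.isProbabilityMeasure_map (μ := P) hB.aemeasurable
  have hmap := (indepFun_iff_map_prod_eq_prod_map_map hA.aemeasurable hB.aemeasurable).1 hAB
  refine (ae_map_iff (p := (· ∈ s)) (hA.prodMk hB).aemeasurable hs).1 ?_
  rw [hmap]
  refine (Measure.ae_prod_mem_iff_ae_ae_mem hs).2 ?_
  have hmeas : MeasurableSet {x | ∀ᵐ y ∂P.map B, (x, y) ∈ s} :=
    measurable_measure_prodMk_left hs.compl (measurableSet_singleton 0)
  refine (ae_map_iff hA.aemeasurable hmeas).2 ?_
  filter_upwards [h] with ω hω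
  exact (ae_map_iff hB.aemeasurable (measurable_prodMk_left hs)).2 hω

theorem ae_tendsto_sub_integral_of_indepFun (hA : Measurable A) (hB : Measurable B)
    (hAB : IndepFun A B P) {F : ℕ → α × β → ℝ} (hF : ∀ N, Measurable (F N))
    (h : ∀ᵐ ω ∂P, ∀ᵐ ω' ∂P, Tendsto
      (fun N => F N (A ω, B ω') - ∫ ω'', F N (A ω, B ω'') ∂P) atTop (𝓝 0)) :
    ∀ᵐ ω ∂P, Tendsto (fun N => F N (A ω, B ω) - ∫ ω', F N (A ω, B ω') ∂P) atTop (𝓝 0) := by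
  have hG (N : ℕ) : Measurable fun z : α × β => F N z - ∫ ω', F N (z.1, B ω') ∂P := by
    have hsection : StronglyMeasurable fun x : α × Ω => F N (x.1, B x.2) :=
      ((hF N).comp (measurable_fst.prodMk (hB.comp measurable_snd))).stronglyMeasurable
    have hintegral : StronglyMeasurable fun a : α => ∫ ω', F N (a, B ω') ∂P :=
      hsection.integral_prod_right
    exact (hF N).sub (hintegral.measurable.comp measurable_fst)
  exact ae_prodMk_mem_of_indepFun hA hB hAB
    (s := {z | Tendsto (fun N => F N z - ∫ ω', F N (z.1, B ω') ∂P) atTop (𝓝 0)})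
    (measurableSet_tendsto _ hG) h

end Independence

section InitialOutputs

variable {na ny : ℕ}

/-- The record with outputs `b 0, …, b (n_a - 1)` at the times `-1, …, -n_a` and `0` elsewhere. -/
def initialOutputs (b : Fin na → EuclideanSpace ℝ (Fin ny)) : Signal ny := fun i =>
  if h : (-1 - i).toNat < na then b ⟨(-1 - i).toNat, h⟩ else 0

theorem initialOutputs_apply (y : Signal ny) {i : ℤ} (h : -(na : ℤ) ≤ i) (hi : i < 0) :
    initialOutputs (fun j : Fin na => y (-1 - (j.val : ℤ))) i = y i := by
  have hlt : (-1 - i).toNat < na := by omega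
  rw [initialOutputs, dif_pos hlt]
  congr 1
  simp only
  omega

theorem measurable_initialOutputs (i : ℤ) :
    Measurable fun b : Fin na → EuclideanSpace ℝ (Fin ny) => initialOutputs b i := by
  unfold initialOutputs
  split_ifs
  · exact measurable_pi_apply _
  · exact measurable_const

end InitialOutputs

section Experiment

variable {Ω : Type*} {mΩ : MeasurableSpace Ω} {P : Measure Ω} {na nb ny nu : ℕ}
  {f : Regressor na nb ny nu → EuclideanSpace ℝ (Fin ny)}
  {u : ℤ → Ω → EuclideanSpace ℝ (Fin nu)} {e y : ℤ → Ω → EuclideanSpace ℝ (Fin ny)}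

theorem simulate_extendNoise (f : Regressor na nb ny nu → EuclideanSpace ℝ (Fin ny))
    (v : Signal nu) (w y₀ : Signal ny) :
    simulate f v (extendNoise fun i : ℕ => w i) y₀ = simulate f v w y₀ :=
  funext fun _ => simulate_congr fun _ _ => rfl

theorem IsQuasiStationary.isSqCesaroDominated_norm {v : Signal nu} (h : IsQuasiStationary v) :
    IsSqCesaroDominated fun k : ℕ => ‖v k‖ := by
  obtain ⟨R, hR⟩ := h 0
  refine ⟨_, ⟨∑ a, R a a, (tendsto_finsetSum Finset.univ fun a _ => hR a a).congr fun N => ?_⟩,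
    fun _ => le_rfl⟩
  rw [← Finset.mul_sum, Finset.sum_comm]
  congr 1
  refine Finset.sum_congr rfl fun k _ => ?_
  rw [EuclideanSpace.real_norm_sq_eq]
  exact Finset.sum_congr rfl fun a _ => by simp [sq]

theorem IsWhiteNoise.isL2Noise (he : IsWhiteNoise e P) : IsL2Noise (fun k : ℕ => e k) P where
  measurable k := he.measurable k
  iIndepFun := he.indep.precomp Nat.cast_injective
  identDistrib k := he.identDistrib k
  memLp_zero := he.memLp

theorem StableSystem.ae_exists_meanSquareStable [IsProbabilityMeasure P]
    (h : StableSystem f u e P) (hf : Measurable f) (he : IsWhiteNoise e P) :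
    ∀ᵐ ω ∂P, ∃ C lam : ℝ, MeanSquareStable f (u · ω) (fun k : ℕ => e k) P C lam := by
  obtain ⟨C, lam, hC, h0, h1, hst⟩ := h 2 two_pos
  filter_upwards [hst] with ω hω
  refine exists_meanSquareStable_of_local hf (fun k => he.measurable k) hC h0 h1
    fun k₀ x₀ x₁ hx m => ?_
  have hcongr (x : Regressor na nb ny nu) (ω' : Ω) :
      outputFrom f (u · ω) (extendNoise fun i : ℕ => e i ω') k₀ x m
        = outputFrom f (u · ω) (e · ω') k₀ x m :=
    outputFrom_congr fun i _ => by
      exact_mod_cast extendNoise_natCast (fun i : ℕ => e i ω') (k₀ + i)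
  simp only [hcongr]
  exact (hω k₀ x₀ x₁ (hx.trans_lt one_lt_two) m).le

/-- A data-generating experiment: the output `y` of the system `f` with input `u` and noise `e`,
where the input and the initial outputs are independent of the noise from time `0` on. The input
has bounded average power, and the system forgets its initial regressor in mean square. -/
structure IsStableExperiment (f : Regressor na nb ny nu → EuclideanSpace ℝ (Fin ny))
    (u : ℤ → Ω → EuclideanSpace ℝ (Fin nu)) (e y : ℤ → Ω → EuclideanSpace ℝ (Fin ny))
    (P : Measure Ω) : Prop where
  measurable_system : Measurable f
  measurable_input : ∀ k, Measurable (u k)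
  measurable_output : ∀ k, Measurable (y k)
  isL2Noise : IsL2Noise (fun k : ℕ => e k) P
  output_eq : ∀ᵐ ω ∂P, ∀ k : ℤ, 0 ≤ k →
    y k ω = f (regressor na nb (y · ω) (u · ω) k) + e k ω
  indepFun : IndepFun (fun ω => ((u · ω), (fun i : Fin na => y (-1 - (i.val : ℤ)) ω)))
    (fun ω => fun k : ℕ => e (k : ℤ) ω) P
  input_dominated : ∀ᵐ ω ∂P, IsSqCesaroDominated fun k : ℕ => ‖u k ω‖
  stable : ∀ᵐ ω ∂P, ∃ C lam : ℝ, MeanSquareStable f (u · ω) (fun k : ℕ => e k) P C lam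

theorem IsStableExperiment.ae_integrable_meanSquare [IsProbabilityMeasure P] (F : Type*)
    [NormedAddCommGroup F] [MeasurableSpace F] [BorelSpace F] [SecondCountableTopology F]
    (hX : IsStableExperiment f u e y P) :
    ∀ᵐ ω ∂P, ∀ (g : ℕ → Signal ny → Signal nu → F) (C lam : ℝ),
      IsStableFunctional na nb g C lam → ∀ N : ℕ, Integrable
        (fun ω' => meanSquare g N (simulate f (u · ω) (e · ω') (y · ω)) (u · ω)) P := by
  filter_upwards [hX.input_dominated, hX.stable] with ω hu ⟨C', lam', hs⟩ g C lam hg N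
  have hsim (ω' : Ω) := simulate_extendNoise f (u · ω) (e · ω') (y · ω)
  simpa only [meanSquare, hsim] using (integrable_finsetSum _ fun k _ =>
    hg.integrable_norm_sq_simulate hs hX.measurable_system hX.isL2Noise (y · ω) hu k).const_mul _

variable {F : Type*} [NormedAddCommGroup F] {g : ℕ → Signal ny → Signal nu → F} {C lam : ℝ}

theorem IsStableFunctional.meanSquare_simulate_initialOutputs
    (h : IsStableFunctional na nb g C lam) (N : ℕ) (v : Signal nu) (w y₀ : Signal ny) :
    meanSquare g N (simulate f v (extendNoise fun k : ℕ => w k)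
        (initialOutputs fun i : Fin na => y₀ (-1 - (i.val : ℤ)))) v
      = meanSquare g N (simulate f v w y₀) v := by
  rw [simulate_extendNoise]
  exact h.meanSquare_congr N v fun i hi =>
    simulate_congr_initial (fun _ hi hi' => initialOutputs_apply y₀ hi hi') hi

variable [MeasurableSpace F] [BorelSpace F]

theorem IsStableFunctional.measurable_meanSquare_simulate_initialOutputs
    (h : IsStableFunctional na nb g C lam) (hf : Measurable f) (N : ℕ) :
    Measurable fun z : (Signal nu × (Fin na → EuclideanSpace ℝ (Fin ny))) ×
      (ℕ → EuclideanSpace ℝ (Fin ny)) =>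
        meanSquare g N (simulate f z.1.1 (extendNoise z.2) (initialOutputs z.1.2)) z.1.1 := by
  have hv (k : ℤ) : Measurable fun z : (Signal nu × (Fin na → EuclideanSpace ℝ (Fin ny))) ×
      (ℕ → EuclideanSpace ℝ (Fin ny)) => z.1.1 k :=
    (measurable_pi_apply k).comp (measurable_fst.comp measurable_fst)
  have hw (k : ℤ) : Measurable fun z : (Signal nu × (Fin na → EuclideanSpace ℝ (Fin ny))) ×
      (ℕ → EuclideanSpace ℝ (Fin ny)) => extendNoise z.2 k :=
    (measurable_pi_apply _).comp measurable_snd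
  have hb (k : ℤ) : Measurable fun z : (Signal nu × (Fin na → EuclideanSpace ℝ (Fin ny))) ×
      (ℕ → EuclideanSpace ℝ (Fin ny)) => initialOutputs z.1.2 k :=
    (measurable_initialOutputs k).comp (measurable_snd.comp measurable_fst)
  exact h.measurable_meanSquare N (measurable_simulate hf hv hw hb) hv

namespace IsStableExperiment

variable [SecondCountableTopology F] [IsProbabilityMeasure P]

theorem ae_exists_integral_meanSquare_le (hX : IsStableExperiment f u e y P)
    (hg : IsStableFunctional na nb g C lam) :
    ∀ᵐ ω ∂P, ∃ K, 0 ≤ K ∧ ∀ N : ℕ,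
      ∫ ω', meanSquare g N (simulate f (u · ω) (e · ω') (y · ω)) (u · ω) ∂P ≤ K := by
  filter_upwards [hX.input_dominated, hX.stable] with ω hu ⟨C', lam', hs⟩
  have hsim (ω' : Ω) := simulate_extendNoise f (u · ω) (e · ω') (y · ω)
  simpa only [hsim] using
    hg.exists_integral_meanSquare_simulate_le hs hX.measurable_system hX.isL2Noise (y · ω) hu

theorem ae_tendsto_meanSquare_sub_integral (hX : IsStableExperiment f u e y P)
    (hg : IsStableFunctional na nb g C lam) :
    ∀ᵐ ω ∂P, Tendsto (fun N : ℕ => meanSquare g N (y · ω) (u · ω)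
      - ∫ ω', meanSquare g N (simulate f (u · ω) (e · ω') (y · ω)) (u · ω) ∂P)
      atTop (𝓝 0) := by
  have hinitial : Measurable fun ω =>
      ((u · ω), (fun i : Fin na => y (-1 - (i.val : ℤ)) ω)) :=
    (measurable_pi_lambda _ hX.measurable_input).prodMk
      (measurable_pi_lambda _ fun i => hX.measurable_output _)
  have hlimit := ae_tendsto_sub_integral_of_indepFun hinitial hX.isL2Noise.measurable_pi
    hX.indepFun
    (hg.measurable_meanSquare_simulate_initialOutputs hX.measurable_system) (by
      filter_upwards [hX.input_dominated, hX.stable] with ω hu ⟨C', lam', hs⟩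
      exact hg.ae_tendsto_meanSquare_simulate_sub_integral hs hX.measurable_system hX.isL2Noise
        (initialOutputs fun i : Fin na => y (-1 - (i.val : ℤ)) ω) hu)
  filter_upwards [hlimit, hX.output_eq] with ω hω hsys
  have hself : simulate f (u · ω) (e · ω) (y · ω) = (y · ω) := funext (simulate_eq_self hsys)
  have hsim (N : ℕ) (ω' : Ω) :=
    hg.meanSquare_simulate_initialOutputs (f := f) N (u · ω) (e · ω') (y · ω)
  simpa only [hsim, hself] using hω

end IsStableExperiment

end Experiment

section DataWeight

variable {na nb ny nu : ℕ} {lam : ℝ}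

/-- The record `y` with the values before time `-n_a` replaced by `0`. -/
def truncate (na : ℕ) (y : Signal ny) : Signal ny := fun i =>
  if -(na : ℤ) ≤ i then y i else 0

theorem truncate_congr {y y' : Signal ny} (h : ∀ i, -(na : ℤ) ≤ i → y i = y' i) :
    truncate na y = truncate na y' := by
  funext i
  unfold truncate
  split_ifs with hi
  · exact h i hi
  · rfl

theorem discountedDist_truncate_le (h0 : 0 ≤ lam) (k : ℕ) (y y' : Signal ny) (u u' : Signal nu) :
    discountedDist na nb lam k (truncate na y) (truncate na y') u u'
      ≤ discountedDist na nb lam k y y' u u' := by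
  refine Finset.sum_le_sum fun i _ => mul_le_mul_of_nonneg_left ?_ (pow_nonneg h0 _)
  gcongr
  unfold truncate
  split_ifs
  · exact le_rfl
  · simp

/-- The discounted size `1 + ∑_i λ^{k-i} (‖u_i‖ + ‖y_i‖)` of the data seen by a stable functional
at time `k`. It is itself a stable functional, and up to a constant it dominates every other one
with the same rate. -/
noncomputable def dataWeight (na nb : ℕ) {ny nu : ℕ} (lam : ℝ) (k : ℕ) (y : Signal ny)
    (u : Signal nu) : ℝ :=
  1 + discountedDist na nb lam k (truncate na y) 0 u 0

theorem dataWeight_pos (h0 : 0 ≤ lam) (k : ℕ) (y : Signal ny) (u : Signal nu) :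
    0 < dataWeight na nb lam k y u :=
  add_pos_of_pos_of_nonneg one_pos (discountedDist_nonneg h0 k _ _ _ _)

theorem isStableFunctional_dataWeight (h0 : 0 ≤ lam) (h1 : lam < 1) :
    IsStableFunctional na nb (dataWeight na nb lam : ℕ → Signal ny → Signal nu → ℝ) 1 lam where
  const_nonneg := zero_le_one
  rate_nonneg := h0
  rate_lt_one := h1
  norm_sub_le k y y' u u' := by
    have hle (y y' : Signal ny) (u u' : Signal nu) :
        dataWeight na nb lam k y u - dataWeight na nb lam k y' u'
          ≤ discountedDist na nb lam k y y' u u' := by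
      have htriangle := discountedDist_le_add (na := na) (nb := nb) h0 k (truncate na y)
        (truncate na y') u u'
      have htruncate := discountedDist_truncate_le (na := na) (nb := nb) h0 k y y' u u'
      unfold dataWeight
      linarith
    have hsymm : discountedDist na nb lam k y' y u' u = discountedDist na nb lam k y y' u u' := by
      simp only [discountedDist, norm_sub_rev]
    rw [one_mul, Real.norm_eq_abs]
    exact abs_sub_le_iff.2 ⟨hle y y' u u', (hle y' y u' u).trans_eq hsymm⟩
  norm_zero_le k := by
    simp [dataWeight, truncate, discountedDist]
  congr k y y' u h := by
    simp only [dataWeight, truncate_congr h]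

variable {F : Type*} [NormedAddCommGroup F] {g g' : ℕ → Signal ny → Signal nu → F} {C c : ℝ}

theorem IsStableFunctional.norm_le_dataWeight (h : IsStableFunctional na nb g C lam) (k : ℕ)
    (y : Signal ny) (u : Signal nu) : ‖g k y u‖ ≤ C * dataWeight na nb lam k y u := by
  rw [h.congr k y (truncate na y) u fun i hi => (if_pos hi).symm]
  exact h.norm_le k _ u

theorem abs_meanSquare_sub_le (h : IsStableFunctional na nb g' C lam) {y : Signal ny}
    {u : Signal nu} (hc : ∀ k, ‖g k y u - g' k y u‖ ≤ c * dataWeight na nb lam k y u) (N : ℕ) :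
    |meanSquare g N y u - meanSquare g' N y u|
      ≤ c * (c + 2 * C) * meanSquare (dataWeight na nb lam) N y u := by
  have hterm (k : ℕ) : |‖g k y u‖ ^ 2 - ‖g' k y u‖ ^ 2|
      ≤ c * (c + 2 * C) * ‖dataWeight na nb lam k y u‖ ^ 2 :=
    (abs_norm_sq_sub_norm_sq_le (hc k) (h.norm_le_dataWeight k y u)).trans_eq (by
      rw [Real.norm_eq_abs, sq_abs]
      ring)
  simp only [meanSquare]
  rw [← mul_sub, ← Finset.sum_sub_distrib, abs_mul, abs_of_nonneg (by positivity),
    mul_left_comm, Finset.mul_sum]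
  gcongr
  exact (Finset.abs_sum_le_sum_abs _ _).trans (Finset.sum_le_sum fun k _ => hterm k)

end DataWeight

section StableFamily

variable {na nb ny nu : ℕ} {T F : Type*} [TopologicalSpace T] [NormedAddCommGroup F]

/-- Stable functionals `g θ` with common constants whose values depend continuously on the
parameter `θ`, uniformly in time and in the data record once measured against `dataWeight`. -/
structure IsStableFamily (na nb : ℕ) {ny nu : ℕ} {T F : Type*} [TopologicalSpace T]
    [NormedAddCommGroup F] (g : T → ℕ → Signal ny → Signal nu → F) (C lam : ℝ) : Prop where
  isStableFunctional : ∀ θ, IsStableFunctional na nb (g θ) C lam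
  exists_modulus : ∀ θ₀, ∃ κ : T → ℝ, Tendsto κ (𝓝 θ₀) (𝓝 0) ∧
    ∀ᶠ θ in 𝓝 θ₀, ∀ k y u, ‖g θ k y u - g θ₀ k y u‖ ≤ κ θ * dataWeight na nb lam k y u

variable {g : T → ℕ → Signal ny → Signal nu → F} {C lam : ℝ}

theorem IsStableFamily.equicontinuous_of_abs_sub_le (hg : IsStableFamily na nb g C lam)
    {V : ℕ → T → ℝ} {M : ℝ} (hV : ∀ (θ θ₀ : T) (c : ℝ), 0 ≤ c →
      (∀ k y u, ‖g θ k y u - g θ₀ k y u‖ ≤ c * dataWeight na nb lam k y u) →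
        ∀ N, |V N θ - V N θ₀| ≤ c * (c + 2 * C) * M) : Equicontinuous V := by
  intro θ₀
  obtain ⟨κ, hκ, hmodulus⟩ := hg.exists_modulus θ₀
  refine Metric.equicontinuousAt_of_continuity_modulus
    (fun θ => κ θ * (κ θ + 2 * C) * M) ?_ V ?_
  · simpa using (hκ.mul (hκ.add_const (2 * C))).mul_const M
  · filter_upwards [hmodulus] with θ hθ N
    have hweight : 0 < dataWeight na nb lam 0 (0 : Signal ny) (0 : Signal nu) :=
      dataWeight_pos (hg.isStableFunctional θ₀).rate_nonneg _ _ _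
    have hκ0 : 0 ≤ κ θ :=
      nonneg_of_mul_nonneg_left ((norm_nonneg _).trans (hθ 0 0 0)) hweight
    rw [dist_comm, Real.dist_eq]
    exact hV θ θ₀ (κ θ) hκ0 hθ N

end StableFamily

section Compact

variable {T : Type*} [TopologicalSpace T] [CompactSpace T] {V E : ℕ → T → ℝ}

theorem tendstoUniformly_of_equicontinuous (hV : Equicontinuous V) {v : T → ℝ}
    (h : ∀ θ, Tendsto (V · θ) atTop (𝓝 (v θ))) : TendstoUniformly V v atTop :=
  UniformFun.tendsto_iff_tendstoUniformly.1
    ((hV.tendsto_uniformFun_iff_pi atTop v).2 (tendsto_pi_nhds.2 h))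

theorem tendstoUniformly_sub_of_dense (hV : Equicontinuous V) (hE : Equicontinuous E) {s : Set T}
    (hs : Dense s) (h : ∀ θ ∈ s, Tendsto (fun N => V N θ - E N θ) atTop (𝓝 0)) :
    TendstoUniformly (fun N θ => V N θ - E N θ) (fun _ => 0) atTop := by
  have hsub : Equicontinuous fun N θ => V N θ - E N θ :=
    equicontinuous_iff_continuous.2
      ((equicontinuous_iff_continuous.1 hV).sub (equicontinuous_iff_continuous.1 hE))
  have hclosed := hsub.isClosed_setOfPred_tendsto (l := atTop)
    (continuous_const (y := (0 : ℝ)))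
  exact tendstoUniformly_of_equicontinuous hsub fun θ =>
    hclosed.closure_subset_iff.2 h (hs θ)

end Compact

section UniformLaw

variable {Ω : Type*} {mΩ : MeasurableSpace Ω} {P : Measure Ω} [IsProbabilityMeasure P]
  {na nb ny nu : ℕ} {f : Regressor na nb ny nu → EuclideanSpace ℝ (Fin ny)}
  {u : ℤ → Ω → EuclideanSpace ℝ (Fin nu)} {e y : ℤ → Ω → EuclideanSpace ℝ (Fin ny)}
  {C lam : ℝ}

theorem IsStableExperiment.ae_exists_meanSquare_dataWeight_le (hX : IsStableExperiment f u e y P)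
    (h0 : 0 ≤ lam) (h1 : lam < 1) :
    ∀ᵐ ω ∂P, ∃ M, ∀ N : ℕ,
      meanSquare (dataWeight na nb lam) N (y · ω) (u · ω) ≤ M ∧
      ∫ ω', meanSquare (dataWeight na nb lam) N (simulate f (u · ω) (e · ω') (y · ω)) (u · ω) ∂P
        ≤ M := by
  have hweight := isStableFunctional_dataWeight (na := na) (nb := nb) (ny := ny) (nu := nu) h0 h1
  filter_upwards [hX.ae_exists_integral_meanSquare_le hweight,
    hX.ae_tendsto_meanSquare_sub_integral hweight] with ω ⟨K, _, hK⟩ hlimit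
  obtain ⟨B, hB⟩ := hlimit.bddAbove_range
  have hB0 : 0 ≤ B := by simpa [meanSquare] using hB ⟨0, rfl⟩
  refine ⟨K + B, fun N => ⟨?_, ?_⟩⟩
  · linarith [hK N, hB ⟨N, rfl⟩]
  · linarith [hK N]

variable {T F : Type*} [TopologicalSpace T] [NormedAddCommGroup F] [MeasurableSpace F]
  [BorelSpace F] [SecondCountableTopology F] {g : T → ℕ → Signal ny → Signal nu → F}

theorem IsStableExperiment.ae_equicontinuous_meanSquare (hX : IsStableExperiment f u e y P)
    (hg : IsStableFamily na nb g C lam) :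
    ∀ᵐ ω ∂P, Equicontinuous (fun N θ => meanSquare (g θ) N (y · ω) (u · ω)) ∧
      Equicontinuous fun N θ =>
        ∫ ω', meanSquare (g θ) N (simulate f (u · ω) (e · ω') (y · ω)) (u · ω) ∂P := by
  rcases isEmpty_or_nonempty T with _ | ⟨⟨θ'⟩⟩
  · exact .of_forall fun ω => ⟨isEmptyElim, isEmptyElim⟩
  obtain ⟨hC, h0, h1⟩ : 0 ≤ C ∧ 0 ≤ lam ∧ lam < 1 :=
    have h := hg.isStableFunctional θ'
    ⟨h.const_nonneg, h.rate_nonneg, h.rate_lt_one⟩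
  filter_upwards [hX.ae_exists_meanSquare_dataWeight_le h0 h1, hX.ae_integrable_meanSquare F,
    hX.ae_integrable_meanSquare ℝ] with ω ⟨M, hM⟩ hint hintWeight
  constructor <;> refine hg.equicontinuous_of_abs_sub_le (M := M) fun θ θ₀ c hc hdist N => ?_
  · refine (abs_meanSquare_sub_le (hg.isStableFunctional θ₀) (fun k => hdist k _ _) N).trans ?_
    gcongr
    exact (hM N).1
  · rw [← integral_sub (hint _ _ _ (hg.isStableFunctional θ) N)
      (hint _ _ _ (hg.isStableFunctional θ₀) N), ← Real.norm_eq_abs]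
    refine (norm_integral_le_of_norm_le
      ((hintWeight _ _ _ (isStableFunctional_dataWeight h0 h1) N).const_mul (c * (c + 2 * C)))
      (.of_forall fun ω' => abs_meanSquare_sub_le (hg.isStableFunctional θ₀)
        (fun k => hdist k _ _) N)).trans ?_
    rw [integral_const_mul]
    gcongr
    exact (hM N).2

variable [CompactSpace T] [TopologicalSpace.SeparableSpace T]

theorem IsStableExperiment.ae_tendstoUniformly_meanSquare_sub_integral
    (hX : IsStableExperiment f u e y P) (hg : IsStableFamily na nb g C lam) :
    ∀ᵐ ω ∂P, TendstoUniformly (fun N θ => meanSquare (g θ) N (y · ω) (u · ω)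
      - ∫ ω', meanSquare (g θ) N (simulate f (u · ω) (e · ω') (y · ω)) (u · ω) ∂P)
      (fun _ => 0) atTop := by
  obtain ⟨s, hs, hdense⟩ := TopologicalSpace.exists_countable_dense T
  have hlimit := (ae_ball_iff hs).2 fun θ _ =>
    hX.ae_tendsto_meanSquare_sub_integral (hg.isStableFunctional θ)
  filter_upwards [hX.ae_equicontinuous_meanSquare hg, hlimit] with ω ⟨hV, hE⟩ h
  exact tendstoUniformly_sub_of_dense hV hE hdense h

theorem IsStableExperiment.ae_tendstoUniformly_meanSquare (hX : IsStableExperiment f u e y P)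
    (hg : IsStableFamily na nb g C lam) {v : Ω → T → ℝ}
    (hv : ∀ᵐ ω ∂P, ∀ θ, Tendsto (fun N : ℕ =>
      ∫ ω', meanSquare (g θ) N (simulate f (u · ω) (e · ω') (y · ω)) (u · ω) ∂P)
      atTop (𝓝 (v ω θ))) :
    ∀ᵐ ω ∂P, TendstoUniformly (fun N θ => meanSquare (g θ) N (y · ω) (u · ω)) (v ω) atTop := by
  filter_upwards [hX.ae_equicontinuous_meanSquare hg,
    hX.ae_tendstoUniformly_meanSquare_sub_integral hg, hv] with ω ⟨hV, _⟩ hsub hω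
  exact tendstoUniformly_of_equicontinuous hV fun θ => by
    simpa using (hsub.tendsto_at θ).add (hω θ)

end UniformLaw

section Predictor

variable {na nb ny nu p q : ℕ} {γ : OneStepPredictor na nb ny nu p q}
  {Θ' : Set (Param p q)} {C lam : ℝ}

theorem OneStepPredictor.eval_congr (γ : OneStepPredictor na nb ny nu p q) (k : ℕ)
    {y y' : Signal ny} (u : Signal nu) (θ : Param p q) (h : ∀ i, -(na : ℤ) ≤ i → y i = y' i) :
    γ.eval k y u θ = γ.eval k y' u θ := by
  unfold OneStepPredictor.eval
  congr 1
  exact funext fun i => h i i.2.1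

/-- The prediction error `y_k - γ_k(θ, y, u)`. -/
noncomputable def OneStepPredictor.residual (γ : OneStepPredictor na nb ny nu p q)
    (θ : Param p q) (k : ℕ) (y : Signal ny) (u : Signal nu) : EuclideanSpace ℝ (Fin ny) :=
  y k - γ.eval k y u θ

theorem OneStepPredictor.isStableFunctional_residual {θ : Param p q} (hC : 0 ≤ C)
    (h0 : 0 ≤ lam) (h1 : lam < 1)
    (hlip : ∀ (k : ℕ) (y y' : Signal ny) (u u' : Signal nu),
      ‖γ.eval k y u θ - γ.eval k y' u' θ‖ ≤ C * discountedDist na nb lam k y y' u u')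
    (hzero : ∀ k, ‖γ.eval k 0 0 θ‖ ≤ C) :
    IsStableFunctional na nb (γ.residual θ) (1 + C) lam where
  const_nonneg := by positivity
  rate_nonneg := h0
  rate_lt_one := h1
  norm_sub_le k y y' u u' := by
    have houtput := norm_sub_le_discountedDist (na := na) (nb := nb) h0 k y y' u u'
    rw [residual, residual, sub_sub_sub_comm]
    linarith [norm_sub_le (y k - y' k) (γ.eval k y u θ - γ.eval k y' u' θ), hlip k y y' u u']
  norm_zero_le k := by
    simpa [residual] using (hzero k).trans (le_add_of_nonneg_left zero_le_one)
  congr k y y' u h := by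
    rw [residual, residual, γ.eval_congr k u θ h, h k (by omega)]

theorem OneStepPredictor.norm_eval_sub_le_of_convex {s : Set (Param p q)} (hs : Convex ℝ s)
    (hdiff : ∀ (k : ℕ) (y : Signal ny) (u : Signal nu), ∀ θ ∈ s,
      DifferentiableAt ℝ (γ.eval k y u) θ)
    (hderiv : ∀ k, ∀ θ ∈ s, ∀ (y y' : Signal ny) (u u' : Signal nu),
      ‖fderiv ℝ (γ.eval k y u) θ - fderiv ℝ (γ.eval k y' u') θ‖
        ≤ C * discountedDist na nb lam k y y' u u')
    {θ₀ θ : Param p q} (hθ₀ : θ₀ ∈ s) (hθ : θ ∈ s) (k : ℕ) (y : Signal ny) (u : Signal nu) :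
    ‖γ.eval k y u θ - γ.eval k y u θ₀‖ ≤ ‖γ.eval k 0 0 θ - γ.eval k 0 0 θ₀‖
      + C * discountedDist na nb lam k y 0 u 0 * ‖θ - θ₀‖ := by
  have hmean := hs.norm_image_sub_le_of_norm_fderiv_le (𝕜 := ℝ)
    (f := fun θ => γ.eval k y u θ - γ.eval k 0 0 θ)
    (fun x hx => (hdiff k y u x hx).sub (hdiff k 0 0 x hx))
    (fun x hx => by
      rw [fderiv_fun_sub (hdiff k y u x hx) (hdiff k 0 0 x hx)]
      exact hderiv k x hx y 0 u 0) hθ₀ hθ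
  rw [sub_sub_sub_comm] at hmean
  linarith [norm_sub_norm_le (γ.eval k y u θ - γ.eval k y u θ₀)
    (γ.eval k 0 0 θ - γ.eval k 0 0 θ₀)]

theorem OneStepPredictor.exists_modulus_residual (hΘ' : IsOpen Θ') (hC : 0 ≤ C) (h0 : 0 ≤ lam)
    (hdiff : ∀ (k : ℕ) (y : Signal ny) (u : Signal nu), ∀ θ ∈ Θ',
      DifferentiableAt ℝ (γ.eval k y u) θ)
    (hderiv : ∀ k, ∀ θ ∈ Θ', ∀ (y y' : Signal ny) (u u' : Signal nu),
      ‖fderiv ℝ (γ.eval k y u) θ - fderiv ℝ (γ.eval k y' u') θ‖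
        ≤ C * discountedDist na nb lam k y y' u u')
    (hzero : ∀ k, ∀ θ ∈ Θ', γ.eval k 0 0 θ = γ.eval 0 0 0 θ) {θ₀ : Param p q} (hθ₀ : θ₀ ∈ Θ') :
    ∃ κ : Param p q → ℝ, Tendsto κ (𝓝 θ₀) (𝓝 0) ∧ ∀ᶠ θ in 𝓝 θ₀, ∀ k y u,
      ‖γ.residual θ k y u - γ.residual θ₀ k y u‖ ≤ κ θ * dataWeight na nb lam k y u := by
  refine ⟨fun θ => ‖γ.eval 0 0 0 θ - γ.eval 0 0 0 θ₀‖ + C * ‖θ - θ₀‖, ?_, ?_⟩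
  · have hvalue := tendsto_iff_norm_sub_tendsto_zero.1 (hdiff 0 0 0 θ₀ hθ₀).continuousAt.tendsto
    simpa using hvalue.add ((tendsto_norm_sub_self θ₀).const_mul C)
  · obtain ⟨δ, hδ, hball⟩ := Metric.isOpen_iff.1 hΘ' θ₀ hθ₀
    filter_upwards [Metric.ball_mem_nhds θ₀ hδ] with θ hθ k y u
    have hmean := γ.norm_eval_sub_le_of_convex (convex_ball θ₀ δ)
      (fun k y u x hx => hdiff k y u x (hball hx)) (fun k x hx => hderiv k x (hball hx))
      (Metric.mem_ball_self hδ) hθ k (truncate na y) u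
    have hcongr (θ : Param p q) : γ.eval k y u θ = γ.eval k (truncate na y) u θ :=
      γ.eval_congr k u θ fun i hi => (if_pos hi).symm
    have hdist := discountedDist_nonneg (na := na) (nb := nb) h0 k (truncate na y) 0 u 0
    rw [residual, residual, sub_sub_sub_cancel_left, norm_sub_rev, hcongr, hcongr]
    rw [hzero k θ (hball hθ), hzero k θ₀ hθ₀] at hmean
    unfold dataWeight
    nlinarith [mul_nonneg (norm_nonneg (γ.eval 0 0 0 θ - γ.eval 0 0 0 θ₀)) hdist,
      mul_nonneg hC (norm_nonneg (θ - θ₀))]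

theorem StablePredictor.exists_isStableFamily {Θ : Set (Param p q)} (hΘ' : IsOpen Θ')
    (hsub : Θ ⊆ Θ')
    (hdiff : ∀ (k : ℕ) (y : Signal ny) (u : Signal nu), ∀ θ ∈ Θ',
      DifferentiableAt ℝ (γ.eval k y u) θ)
    (hzero : ∀ k, ∀ θ ∈ Θ', γ.eval k 0 0 θ = γ.eval 0 0 0 θ) (h : StablePredictor γ Θ') :
    ∃ C lam : ℝ, IsStableFamily na nb (fun θ : Θ => γ.residual θ) C lam := by
  obtain ⟨C, lam, hC, h0, h1, hγ⟩ := h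
  refine ⟨1 + C, lam, fun θ => ?_, fun θ₀ => ?_⟩
  · exact γ.isStableFunctional_residual hC h0 h1 (fun k => (hγ k θ (hsub θ.2)).1)
      fun k => (hγ k θ (hsub θ.2)).2.1
  · obtain ⟨κ, hκ, hmodulus⟩ := γ.exists_modulus_residual hΘ' hC h0 hdiff
      (fun k θ hθ => (hγ k θ hθ).2.2) hzero (hsub θ₀.2)
    have hval : Tendsto (Subtype.val : Θ → Param p q) (𝓝 θ₀) (𝓝 θ₀) :=
      continuous_subtype_val.tendsto θ₀
    exact ⟨κ ∘ Subtype.val, hκ.comp hval, hval.eventually hmodulus⟩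

end Predictor

section OrthPrediction

variable {na nb ny nu p q : ℕ} {φ : Regressor na nb ny nu → Matrix (Fin ny) (Fin p) ℝ}
  {fANN : EuclideanSpace ℝ (Fin q) → Regressor na nb ny nu → EuclideanSpace ℝ (Fin ny)}
  {S : PointRule na nb ny nu} {γ : OneStepPredictor na nb ny nu p q} {θ : Param p q}

theorem regressor_zero (k : ℤ) : regressor na nb (0 : Signal ny) (0 : Signal nu) k = 0 := by
  ext i
  rcases i with ⟨i, c⟩ | ⟨i, c⟩ <;> simp [regressor]

theorem eval_zero_eq_of_orthPrediction_eq
    (hγ : ∀ N k : ℕ, k < N → ∀ (y : Signal ny) (u : Signal nu),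
      orthPrediction φ fANN S N θ y u k = γ.eval k y u θ) (k : ℕ) :
    γ.eval k 0 0 θ = γ.eval 0 0 0 θ := by
  rw [← hγ (k + 1) k k.lt_succ_self, ← hγ (k + 1) 0 k.succ_pos]
  simp only [orthPrediction, regressor_zero]

theorem cost_eq_meanSquare_residual
    (hγ : ∀ N k : ℕ, k < N → ∀ (y : Signal ny) (u : Signal nu),
      orthPrediction φ fANN S N θ y u k = γ.eval k y u θ) (N : ℕ) (y : Signal ny)
    (u : Signal nu) : cost φ fANN S N θ y u = meanSquare (γ.residual θ) N y u := by
  unfold cost meanSquare OneStepPredictor.residual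
  congr 1
  exact Finset.sum_congr rfl fun k hk => by rw [hγ N k (Finset.mem_range.1 hk)]

end OrthPrediction

end OrthAug

theorem theorem2_general {Ω : Type*} [MeasurableSpace Ω] {P : Measure Ω} [IsProbabilityMeasure P]
    {na nb ny nu p q : ℕ} {f : OrthAug.Regressor na nb ny nu → EuclideanSpace ℝ (Fin ny)}
    {u : ℤ → Ω → EuclideanSpace ℝ (Fin nu)} {e y : ℤ → Ω → EuclideanSpace ℝ (Fin ny)}
    (hX : OrthAug.IsStableExperiment f u e y P)
    (φ : OrthAug.Regressor na nb ny nu → Matrix (Fin ny) (Fin p) ℝ)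
    (fANN : EuclideanSpace ℝ (Fin q) → OrthAug.Regressor na nb ny nu →
      EuclideanSpace ℝ (Fin ny))
    (S : OrthAug.PointRule na nb ny nu)
    (Θ Θ' : Set (OrthAug.Param p q)) (hΘ : IsCompact Θ) (hΘ' : IsOpen Θ') (hsub : Θ ⊆ Θ')
    (γ : OrthAug.OneStepPredictor na nb ny nu p q)
    (hγ : ∀ N k : ℕ, k < N → ∀ θ ∈ Θ', ∀ (y' : ℤ → EuclideanSpace ℝ (Fin ny))
      (u' : ℤ → EuclideanSpace ℝ (Fin nu)),
      OrthAug.orthPrediction φ fANN S N θ y' u' k = γ.eval k y' u' θ)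
    (hdiff : ∀ (k : ℕ) (y' : ℤ → EuclideanSpace ℝ (Fin ny))
      (u' : ℤ → EuclideanSpace ℝ (Fin nu)), ∀ θ ∈ Θ', DifferentiableAt ℝ (γ.eval k y' u') θ)
    (hpred : OrthAug.StablePredictor γ Θ') :
    (∀ᵐ ω ∂P, TendstoUniformlyOn
      (fun (N : ℕ) (θ : OrthAug.Param p q) =>
        OrthAug.cost φ fANN S N θ (fun i => y i ω) (fun i => u i ω)
          - OrthAug.expectedCost f φ fANN S e P N θ (fun i => y i ω) (fun i => u i ω))
      (fun _ => 0) atTop Θ) ∧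
    (∀ Vbar : Ω → OrthAug.Param p q → ℝ,
      (∀ᵐ ω ∂P, ∀ θ ∈ Θ, Tendsto
        (fun N : ℕ =>
          OrthAug.expectedCost f φ fANN S e P N θ (fun i => y i ω) (fun i => u i ω))
        atTop (𝓝 (Vbar ω θ))) →
      ∀ᵐ ω ∂P, TendstoUniformlyOn
        (fun (N : ℕ) (θ : OrthAug.Param p q) =>
          OrthAug.cost φ fANN S N θ (fun i => y i ω) (fun i => u i ω))
        (Vbar ω) atTop Θ) := by
  have := isCompact_iff_compactSpace.1 hΘ
  obtain ⟨C, lam, hg⟩ := hpred.exists_isStableFamily hΘ' hsub hdiff fun k θ hθ =>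
    OrthAug.eval_zero_eq_of_orthPrediction_eq (fun N k hk => hγ N k hk θ hθ) k
  have hcost (θ : Θ) (N : ℕ) (y' : OrthAug.Signal ny) (u' : OrthAug.Signal nu) :
      OrthAug.cost φ fANN S N θ y' u' = OrthAug.meanSquare (γ.residual θ) N y' u' :=
    OrthAug.cost_eq_meanSquare_residual (fun N k hk => hγ N k hk θ (hsub θ.2)) N y' u'
  simp only [tendstoUniformlyOn_iff_tendstoUniformly_comp_coe, Function.comp_def,
    OrthAug.expectedCost, hcost]
  refine ⟨hX.ae_tendstoUniformly_meanSquare_sub_integral hg, fun Vbar hVbar => ?_⟩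
  refine hX.ae_tendstoUniformly_meanSquare hg ?_
  filter_upwards [hVbar] with ω hω θ
  simpa only [hcost] using hω θ θ.2

theorem theorem2 {Ω : Type*} [MeasurableSpace Ω] (P : Measure Ω) [IsProbabilityMeasure P]
    {na nb ny nu p q : ℕ}
    -- the data-generating system and the signals
    (f : OrthAug.Regressor na nb ny nu → EuclideanSpace ℝ (Fin ny)) (hf : Measurable f)
    (u : ℤ → Ω → EuclideanSpace ℝ (Fin nu)) (hu : ∀ k, Measurable (u k))
    (e : ℤ → Ω → EuclideanSpace ℝ (Fin ny)) (he : OrthAug.IsWhiteNoise e P)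
    (y : ℤ → Ω → EuclideanSpace ℝ (Fin ny)) (hy : ∀ k, Measurable (y k))
    (hsys : ∀ᵐ ω ∂P, ∀ k : ℤ, 0 ≤ k →
      y k ω = f (OrthAug.regressor na nb (fun i => y i ω) (fun i => u i ω) k) + e k ω)
    -- the input and the initial outputs are independent of the noise from time 0 on
    (hind : IndepFun
      (fun ω => ((fun k : ℤ => u k ω), (fun i : Fin na => y (-1 - (i.val : ℤ)) ω)))
      (fun ω => (fun k : ℕ => e (k : ℤ) ω)) P)
    (hqs : ∀ᵐ ω ∂P, OrthAug.IsQuasiStationary (fun k => u k ω))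
    (hstab : OrthAug.StableSystem f u e P)
    -- the model structure and its one-step-ahead predictor
    (φ : OrthAug.Regressor na nb ny nu → Matrix (Fin ny) (Fin p) ℝ)
    (fANN : EuclideanSpace ℝ (Fin q) → OrthAug.Regressor na nb ny nu →
      EuclideanSpace ℝ (Fin ny))
    (S : OrthAug.PointRule na nb ny nu)
    (Θ Θ' : Set (OrthAug.Param p q)) (hΘ : IsCompact Θ) (hΘ' : IsOpen Θ') (hsub : Θ ⊆ Θ')
    (γ : OrthAug.OneStepPredictor na nb ny nu p q)
    (hγ : ∀ N k : ℕ, k < N → ∀ θ ∈ Θ', ∀ (y' : ℤ → EuclideanSpace ℝ (Fin ny))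
      (u' : ℤ → EuclideanSpace ℝ (Fin nu)),
      OrthAug.orthPrediction φ fANN S N θ y' u' k = γ.eval k y' u' θ)
    (hdiff : ∀ (k : ℕ) (y' : ℤ → EuclideanSpace ℝ (Fin ny))
      (u' : ℤ → EuclideanSpace ℝ (Fin nu)), ∀ θ ∈ Θ', DifferentiableAt ℝ (γ.eval k y' u') θ)
    (hpred : OrthAug.StablePredictor γ Θ') :
    -- the empirical cost is uniformly close to its expectation
    (∀ᵐ ω ∂P, TendstoUniformlyOn
      (fun (N : ℕ) (θ : OrthAug.Param p q) =>
        OrthAug.cost φ fANN S N θ (fun i => y i ω) (fun i => u i ω)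
          - OrthAug.expectedCost f φ fANN S e P N θ (fun i => y i ω) (fun i => u i ω))
      (fun _ => 0) atTop Θ) ∧
    -- and converges uniformly to the limit of the expectation
    (∀ Vbar : Ω → OrthAug.Param p q → ℝ,
      (∀ᵐ ω ∂P, ∀ θ ∈ Θ, Tendsto
        (fun N : ℕ =>
          OrthAug.expectedCost f φ fANN S e P N θ (fun i => y i ω) (fun i => u i ω))
        atTop (𝓝 (Vbar ω θ))) →
      ∀ᵐ ω ∂P, TendstoUniformlyOn
        (fun (N : ℕ) (θ : OrthAug.Param p q) =>
          OrthAug.cost φ fANN S N θ (fun i => y i ω) (fun i => u i ω))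
        (Vbar ω) atTop Θ) :=
  theorem2_general ⟨hf, hu, hy, he.isL2Noise, hsys, hind,
    hqs.mono fun _ h => h.isSqCesaroDominated_norm, hstab.ae_exists_meanSquareStable hf he⟩
    φ fANN S Θ Θ' hΘ hΘ' hsub γ hγ hdiff hpred
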